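/- Let $d,n\ge1$ be integers. An environment is a function $\eta:\mathbb Z^d\times\mathbb R^n\to(-\infty,\infty]$. For $\lambda>0$, finite $\Lambda\subset\mathbb Z^d$ and $\varphi:\mathbb Z^d\to\mathbb R^n$ put $$H^{\eta,\lambda,\Lambda}(\varphi)=\frac12\sum_{u\sim v,\ \{u,v\}\cap\Lambda\ne\emptyset}\|\varphi_u-\varphi_v\|^2+\lambda\sum_{v\in\Lambda}\eta_{v,\varphi_v},$$ where the first sum is over unordered pairs of nearest neighbours of $\mathbb Z^d$ and $\|\cdot\|$ is the Euclidean norm. For $\tau:\mathbb Z^d\to\mathbb R^n$ let $\Omega^{\Lambda,\tau}=\{\varphi:\varphi_v=\tau_v\text{ for }v\notin\Lambda\}$, and let $\mathrm{GE}^{\eta,\lambda,\Lambda,\tau}$ be the infimum of $H^{\eta,\lambda,\Lambda}$ over $\Omega^{\Lambda,\tau}$. Write $\Lambda_L=\{-L,\dots,L\}^d$, $\mathrm{GE}^{\eta,\lambda,\Lambda_L}=\mathrm{GE}^{\eta,\lambda,\Lambda_L,0}$, and, for $v\in\Lambda_L$, $r_v=\min_{w\notin\Lambda_L}\|v-w\|_\infty$.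 Let $\eta$ be a random environment, defined with a $\sigma$-algebra on environments that makes every value $\eta_{v,t}$ measurable and is rich enough for all the ground energies $\mathrm{GE}^{\eta,\lambda,\Lambda,\tau}$ to be measurable up to null sets; distributions of environments refer to this $\sigma$-algebra, and, for $A\subset\mathbb Z^d$, conditioning on $\eta_A=(\eta_{v,\cdot})_{v\in A}$ refers to the events of this $\sigma$-algebra that depend on $\eta_A$ only. Assume: * (ExiMin) for every $\lambda>0$, finite $\Lambda$ and $\tau$, almost surely $H^{\eta,\lambda,\Lambda}$ attains a minimum on every non-empty closed subset of $\Omega^{\Lambda,\tau}$, and $\mathrm{GE}^{\eta,\lambda,\Lambda,\tau}<\infty$; * (Stat) for every $s:\mathbb Z^d\to\mathbb R^n$ the shifted environment $\eta^s_{v,t}=\eta_{v,t-s_v}$ has the same distribution as $\eta$. Let $d-2<\chi<d$ and $\alpha,K,\kappa>0$. There are $C,c>0$, depending only on $d,n,\chi,\alpha,K,\kappa$, such that the following holds for every such $\eta$, every $\lambda>0$, every integer $L\ge1$ and every $f(\lambda)>0$. Suppose that * ($\chi$-conc) $\mathbb E|\mathrm{GE}^{\eta,\lambda,\Lambda_L}|<\infty$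 and, for all $\rho>0$, all integers $1\le\ell\le L$ and all $\Delta=(v+\Lambda_\ell)\cap\Lambda_L$ with $v\in\Lambda_L$, almost surely $$\mathbb P\Big(\big|\mathrm{GE}^{\eta,\lambda,\Lambda_L}-\mathbb E(\mathrm{GE}^{\eta,\lambda,\Lambda_L}\mid\eta_{\Delta^c})\big|\ge\rho f(\lambda)\ell^\chi\ \Big|\ \eta_{\Delta^c}\Big)\le Ke^{-\kappa\rho^\alpha}.$$ Let $\varphi$ be any random ground configuration, that is, a random surface which almost surely minimizes $H^{\eta,\lambda,\Lambda_L}$ over $\Omega^{\Lambda_L,0}$ (for instance one selected by a fixed tie-breaking rule), and put $\xi=\frac{\chi-(d-2)}2$. Then $$\mathbb E\|\varphi_v\|\le C\sqrt{f(\lambda)}\,r_v^{\xi}\qquad\text{for each }v\in\Lambda_L .$$ Moreover, for every $t>0$: if $d=1$, then $$\mathbb P\Big(\forall v\in\Lambda_L,\ \|\varphi_v\|\le t\sqrt{f(\lambda)}\Big(\log\log\frac{3(L+1)}{r_v}\Big)^{1/(2\alpha)}r_v^{\xi}\Big)\ge1-Ce^{-ct^{2\alpha}},$$ and, if in addition $L\ge10$,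 the same holds with $3L$ in place of $3(L+1)$; if $d\ge2$, then $$\mathbb P\Big(\forall v\in\Lambda_L,\ \|\varphi_v\|\le t\sqrt{f(\lambda)}\Big(\log\frac{2(L+1)}{r_v}\Big)^{1/(2\alpha)}r_v^{\xi}\Big)\ge1-Ce^{-ct^{2\alpha}},$$ and, if in addition $L\ge2$, the same holds with $2L$ in place of $2(L+1)$. -/

import Mathlib

open MeasureTheory ProbabilityTheory

universe u

/-- Environments `ξ : ℤ^d × ℝ^n → (-∞, ∞]`. No measurable structure is attached to this type: the
`σ`-algebra on which the law of a random environment is defined is an explicit parameter. -/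
structure Environment (d n : ℕ) where
  /-- The value `ξ_{v,t}` at the site `v` and the height `t`. -/
  val : (Fin d → ℤ) → EuclideanSpace ℝ (Fin n) → EReal
  ne_bot : ∀ v t, val v t ≠ ⊥

/-- Surfaces `φ : ℤ^d → ℝ^n`, with the topology of pointwise convergence. -/
abbrev Surface (d n : ℕ) : Type := (Fin d → ℤ) → EuclideanSpace ℝ (Fin n)

/-- The shifted environment `ξ^s_{v,t} = ξ_{v, t - s_v}`. -/
def Environment.shift {d n : ℕ} (ξ : Environment d n) (s : Surface d n) : Environment d n where
  val v t := ξ.val v (t - s v)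
  ne_bot v t := ξ.ne_bot v (t - s v)

/-- The Dirichlet energy of `φ` on `Λ`: the sum of `‖φ_u - φ_v‖²` over the unordered edges `{u, v}`
of the lattice `ℤ^d` that meet `Λ`. Each edge is written once, as `{u, u + e_i}`; it meets `Λ` if and
only if `u ∈ Λ` or `u ∈ Λ - e_i`. -/
noncomputable def dirichletEnergy {d n : ℕ} (Λ : Finset (Fin d → ℤ)) (φ : Surface d n) : ℝ :=
  ∑ i : Fin d, ∑ u ∈ Λ ∪ Λ.image (fun w => w - Pi.single i 1),
    ‖φ (u + Pi.single i 1) - φ u‖ ^ 2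

/-- The finite-volume Hamiltonian `H^{ξ,λ,Λ}(φ)`, with values in `(-∞, ∞]`. -/
noncomputable def hamiltonian {d n : ℕ} (ξ : Environment d n) (lam : ℝ)
    (Λ : Finset (Fin d → ℤ)) (φ : Surface d n) : EReal :=
  ((1 / 2 * dirichletEnergy Λ φ : ℝ) : EReal) + (lam : EReal) * ∑ v ∈ Λ, ξ.val v (φ v)

/-- The configuration space `Ω^{Λ,τ}`: surfaces that agree with `τ` outside `Λ`. -/
def configSpace {d n : ℕ} (Λ : Finset (Fin d → ℤ)) (τ : Surface d n) : Set (Surface d n) :=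
  {φ | ∀ v, v ∉ Λ → φ v = τ v}

/-- The ground energy `GE^{ξ,λ,Λ,τ}`. It is the value of the Hamiltonian at any ground
configuration, whenever there is one. -/
noncomputable def groundEnergy {d n : ℕ} (ξ : Environment d n) (lam : ℝ)
    (Λ : Finset (Fin d → ℤ)) (τ : Surface d n) : EReal :=
  ⨅ φ ∈ configSpace Λ τ, hamiltonian ξ lam Λ φ

/-- `φ` is a ground configuration: it minimizes `H^{ξ,λ,Λ}` over `Ω^{Λ,τ}`. -/
def IsGroundConfig {d n : ℕ} (ξ : Environment d n) (lam : ℝ)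
    (Λ : Finset (Fin d → ℤ)) (τ φ : Surface d n) : Prop :=
  φ ∈ configSpace Λ τ ∧ IsMinOn (hamiltonian ξ lam Λ) (configSpace Λ τ) φ

/-- The cube `Λ_L = {-L, …, L}^d`. -/
noncomputable def box (d L : ℕ) : Finset (Fin d → ℤ) :=
  Fintype.piFinset fun _ => Finset.Icc (-(L : ℤ)) (L : ℤ)

/-- The box `(v + Λ_ℓ) ∩ Λ_L`. -/
noncomputable def localBox (d L ℓ : ℕ) (v : Fin d → ℤ) : Finset (Fin d → ℤ) :=
  (box d ℓ).image (fun w => v + w) ∩ box d L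

/-- `r_v = d_∞(v, Λ_L^c)`; the distance on `Fin d → ℤ` is the `ℓ^∞` distance. -/
noncomputable def boundaryDist {d : ℕ} (L : ℕ) (v : Fin d → ℤ) : ℝ :=
  Metric.infDist v ((box d L : Set (Fin d → ℤ))ᶜ)

/-- The `σ`-algebra generated by the restriction `ξ_A = (ξ_{v,·})_{v ∈ A}` of an environment: the
measurable events that depend on `ξ_A` only. When the `σ`-algebra on environments is a product over
the sites, this is the `σ`-algebra generated by the coordinates in `A`. -/
@[reducible] def restrictionAlgebra {d n : ℕ} [MeasurableSpace (Environment d n)] (A : Set (Fin d → ℤ)) :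
    MeasurableSpace (Environment d n) where
  MeasurableSet' S := MeasurableSet S ∧
    ∀ ξ ζ : Environment d n, (∀ v ∈ A, ξ.val v = ζ.val v) → (ξ ∈ S ↔ ζ ∈ S)
  measurableSet_empty := ⟨MeasurableSet.empty, by simp⟩
  measurableSet_compl S hS :=
    ⟨hS.1.compl, fun ξ ζ h => not_congr (hS.2 ξ ζ h)⟩
  measurableSet_iUnion S hS :=
    ⟨MeasurableSet.iUnion fun i => (hS i).1, fun ξ ζ h => by
      simp only [Set.mem_iUnion]
      exact exists_congr fun i => (hS i).2 ξ ζ h⟩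

/-- `σ(η_A)` on the underlying probability space. -/
@[reducible] def sigmaRestriction {d n : ℕ} [MeasurableSpace (Environment d n)] {Ω : Type u}
    (η : Ω → Environment d n) (A : Set (Fin d → ℤ)) : MeasurableSpace Ω :=
  (restrictionAlgebra A).comap η

/-- `η` is a disorder, i.e. a random environment, on the probability space `(Ω, P)`. The `σ`-algebra
on environments makes every value `ξ_{v,t}` measurable, and it is rich enough for the ground energies
to be measurable (up to null sets of the law of `η`). -/
structure IsDisorder {d n : ℕ} [MeasurableSpace (Environment d n)] {Ω : Type u} [MeasurableSpace Ω]
    (P : Measure Ω) (η : Ω → Environment d n) : Prop where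
  measurable_eval : ∀ v t, Measurable fun ξ : Environment d n => ξ.val v t
  measurable : Measurable η
  aemeasurable_groundEnergy : ∀ (lam : ℝ), 0 < lam → ∀ (Λ : Finset (Fin d → ℤ)) (τ : Surface d n),
    AEMeasurable (fun ξ => groundEnergy ξ lam Λ τ) (P.map η)

/-- (ExiMin): almost surely the Hamiltonian attains a minimum on every (non-empty) closed subset of
the configuration space, and the ground energy is not `+∞`. -/
def ExiMin {d n : ℕ} {Ω : Type u} [MeasurableSpace Ω] (P : Measure Ω)
    (η : Ω → Environment d n) : Prop :=
  ∀ (lam : ℝ), 0 < lam → ∀ (Λ : Finset (Fin d → ℤ)) (τ : Surface d n), ∀ᵐ ω ∂P,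
    (∀ S : Set (Surface d n), S ⊆ configSpace Λ τ → IsClosed S → S.Nonempty →
      ∃ φ ∈ S, IsMinOn (hamiltonian (η ω) lam Λ) S φ) ∧
    groundEnergy (η ω) lam Λ τ < ⊤

/-- (Stat): every shifted disorder `η^s` has the same distribution as `η`. -/
def Stat {d n : ℕ} [MeasurableSpace (Environment d n)] {Ω : Type u} [MeasurableSpace Ω]
    (P : Measure Ω) (η : Ω → Environment d n) : Prop :=
  ∀ s : Surface d n, IdentDistrib (fun ω => (η ω).shift s) η P P

/-- The ground energy `GE^{η,λ,Λ_L}` with zero boundary values, as a real random variable. -/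
noncomputable def boxEnergy {d n : ℕ} {Ω : Type u} (η : Ω → Environment d n) (lam : ℝ) (L : ℕ)
    (ω : Ω) : ℝ :=
  (groundEnergy (η ω) lam (box d L) 0).toReal

/-- (χ-conc): `GE^{η,λ,Λ_L}` is integrable and, given the disorder outside a box
`Δ = (v + Λ_ℓ) ∩ Λ_L`, it has stretched-exponential concentration on the scale `F ℓ^χ` around its
conditional expectation. -/
def ChiConc {d n : ℕ} [MeasurableSpace (Environment d n)] {Ω : Type u} [MeasurableSpace Ω]
    (P : Measure Ω) (η : Ω → Environment d n) (lam : ℝ) (L : ℕ) (χ F α K κ : ℝ) : Prop :=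
  Integrable (boxEnergy η lam L) P ∧
  ∀ ρ : ℝ, 0 < ρ → ∀ ℓ : ℕ, 1 ≤ ℓ → ℓ ≤ L → ∀ v ∈ box d L,
    ∀ᵐ ω ∂P,
      (P⟦{ω' | ρ * F * (ℓ : ℝ) ^ χ ≤ |boxEnergy η lam L ω' -
            (P[boxEnergy η lam L | sigmaRestriction η (localBox d L ℓ v : Set (Fin d → ℤ))ᶜ]) ω'|} |
          sigmaRestriction η (localBox d L ℓ v : Set (Fin d → ℤ))ᶜ⟧) ω
        ≤ K * Real.exp (-κ * ρ ^ α)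

/-!
Shifting the environment at heights `s : ℤ^d → ℝ^n` supported in a box `Δ` leaves its law, and its
restriction to `Δᶜ`, unchanged. Hence the ground energies of `η` and of `η^s` both concentrate around
the same conditional expectation given `η_{Δᶜ}`
(`measureReal_groundEnergy_shift_lt`). Testing the second energy with `φ + s` gives, for `s = γ g e`
and the optimal `γ`, a tail bound for the linear statistic `∑ (-Δ g)(x) φ_x` on the scale
`√(F ℓ^χ B)`, where `ℓ` is the side of a box containing the support of `g` and `B` bounds the
Dirichlet energy of `g` (`hasTail_negLap`).

It remains to write point values of `φ` through such statistics. Let `Q` be the simple random walk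
killed outside `Λ_L`, diagonalized by products of sines, so that `-Δ = 2d(1 - Q)` on the box. With
`q_N` the `d`-th power of the normalized Fejér kernel, a polynomial of degree at most `d N` equal to
`1` at `1`, the telescoping sum `1 = ∑ (q_{2^k} - q_{2^(k+1)}) + q_{2^K}`, `2^K ≤ L < 2^(K+1)`,
decomposes `φ_u = ∑_k φ · p_k(Q) δ_u`. Since
`p_k` is `1 - X` times a polynomial of degree of order `2^k`, the corresponding `g` has range of order
`2^k` (`sineSum_scalePoly_eq_zero`). Its energy is of order `N^(2-d)` with `N = 2^k` for
`δ_u`, and of order `m² N^(-d)` for `δ_u - δ_w` with `|u - w| ≤ m ≤ N`: both follow from the spectral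
sum `sum_inv_one_add_modeEnergy_le` and the Lipschitz bound for the sines, `sineMode_sub_sq_le`.
With `ξ = (χ - (d-2))/2 ∈ (0,1)`, the pieces of `φ_u - φ_w` live on the scales `√F N^ξ` for `N ≤ m`
and `√F m N^(ξ-1)` for `N ≥ m`, which sum to `√F m^ξ` (`exists_hasTail_increment`). As the sine modes
vanish outside the box, `w` may lie outside of it, where `φ_w = 0`; this gives the bound for the mean.

The uniform bounds follow by chaining through dyadic grids (`exists_measureReal_localization`): there
are of order `(L/r)^(d-1)` cubes of side `r` at distance of order `r` from the boundary, which costs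
`log (L/r)` if `d ≥ 2`. If `d = 1`, only the number of dyadic values of `r` matters, which
costs `log log (L/r)`.
-/

/-! ### Hamiltonians of shifted environments -/

lemma zero_mem_box (d L : ℕ) : (0 : Fin d → ℤ) ∈ box d L := by
  simp [box]

lemma mem_box {d L : ℕ} {v : Fin d → ℤ} : v ∈ box d L ↔ ∀ i, |v i| ≤ L := by
  simp [box, abs_le]

lemma mem_localBox {d L ℓ : ℕ} {v x : Fin d → ℤ} :
    x ∈ localBox d L ℓ v ↔ (∀ i, |x i - v i| ≤ ℓ) ∧ x ∈ box d L := by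
  simp only [localBox, Finset.mem_inter, Finset.mem_image]
  refine and_congr_left fun _ => ⟨?_, fun h => ⟨x - v, mem_box.2 (by simpa using h), by simp⟩⟩
  rintro ⟨w, hw, rfl⟩ i
  simpa using mem_box.1 hw i

/-- The positive lattice Laplacian `-Δ g`. -/
def negLap {d : ℕ} (g : (Fin d → ℤ) → ℝ) (x : Fin d → ℤ) : ℝ :=
  ∑ i : Fin d, (2 * g x - g (x + Pi.single i 1) - g (x - Pi.single i 1))

/-- Discrete Green identity for a function `f` that vanishes outside `Λ`. -/
lemma sum_edges_mul_eq {d : ℕ} (Λ : Finset (Fin d → ℤ)) (f g : (Fin d → ℤ) → ℝ)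
    (hf : ∀ x, x ∉ Λ → f x = 0) :
    ∑ i : Fin d, ∑ u ∈ Λ ∪ Λ.image (fun w => w - Pi.single i 1),
      (f (u + Pi.single i 1) - f u) * (g (u + Pi.single i 1) - g u) =
    ∑ x ∈ Λ, f x * negLap g x := by
  simp only [negLap, Finset.mul_sum]
  rw [Finset.sum_comm (s := Λ)]
  refine Finset.sum_congr rfl fun i _ => ?_
  simp only [sub_mul, Finset.sum_sub_distrib]
  have h1 : ∑ u ∈ Λ ∪ Λ.image (fun w => w - Pi.single i 1), f u * (g (u + Pi.single i 1) - g u)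
      = ∑ u ∈ Λ, f u * (g (u + Pi.single i 1) - g u) := by
    symm
    refine Finset.sum_subset Finset.subset_union_left fun x _ hx => ?_
    rw [hf x hx, zero_mul]
  have h2 : ∑ u ∈ Λ ∪ Λ.image (fun w => w - Pi.single i 1),
        f (u + Pi.single i 1) * (g (u + Pi.single i 1) - g u)
      = ∑ x ∈ Λ, f x * (g x - g (x - Pi.single i 1)) := by
    rw [← Finset.sum_subset (Finset.subset_union_right (s₁ := Λ)), Finset.sum_image]
    · simp
    · intro a _ b _ h
      simpa using h
    · intro x _ hx
      rw [hf, zero_mul]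
      exact fun h => hx (Finset.mem_image.2 ⟨_, h, by simp⟩)
  rw [h1, h2, ← Finset.sum_sub_distrib]
  exact Finset.sum_congr rfl fun x _ => by ring

section Shift

variable {d n : ℕ}

lemma Environment.sum_ne_bot (ξ : Environment d n) (Λ : Finset (Fin d → ℤ)) (φ : Surface d n) :
    ∑ v ∈ Λ, ξ.val v (φ v) ≠ ⊥ := by
  classical
  induction Λ using Finset.induction_on with
  | empty => simp
  | insert a s ha ih =>
    rw [Finset.sum_insert ha]
    exact EReal.add_ne_bot_iff.2 ⟨ξ.ne_bot _ _, ih⟩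

lemma potential_ne_bot (ξ : Environment d n) {lam : ℝ} (hl : 0 < lam) (Λ : Finset (Fin d → ℤ))
    (φ : Surface d n) : (lam : EReal) * ∑ v ∈ Λ, ξ.val v (φ v) ≠ ⊥ := by
  have h := ξ.sum_ne_bot Λ φ
  generalize ∑ v ∈ Λ, ξ.val v (φ v) = x at h
  induction x using EReal.rec with
  | bot => exact absurd rfl h
  | coe x => rw [← EReal.coe_mul]; exact EReal.coe_ne_bot _
  | top => rw [EReal.coe_mul_top_of_pos hl]; exact bot_ne_top.symm

lemma hamiltonian_ne_bot (ξ : Environment d n) {lam : ℝ} (hl : 0 < lam) (Λ : Finset (Fin d → ℤ))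
    (φ : Surface d n) : hamiltonian ξ lam Λ φ ≠ ⊥ :=
  EReal.add_ne_bot_iff.2 ⟨EReal.coe_ne_bot _, potential_ne_bot ξ hl Λ φ⟩

lemma IsGroundConfig.groundEnergy_eq {ξ : Environment d n} {lam : ℝ} {Λ : Finset (Fin d → ℤ)}
    {τ φ : Surface d n} (h : IsGroundConfig ξ lam Λ τ φ) :
    groundEnergy ξ lam Λ τ = hamiltonian ξ lam Λ φ :=
  le_antisymm (iInf₂_le φ h.1) (le_iInf₂ fun _ hψ => h.2 hψ)

/-- Testing the ground energy of the shifted environment with the shifted ground configuration. -/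
lemma groundEnergy_shift_toReal_le {ξ : Environment d n} {lam : ℝ} (hl : 0 < lam)
    {Λ : Finset (Fin d → ℤ)} {φ s : Surface d n} (h : IsGroundConfig ξ lam Λ 0 φ)
    (htop : groundEnergy ξ lam Λ 0 < ⊤) (hs : ∀ v, v ∉ Λ → s v = 0)
    (hbot : groundEnergy (ξ.shift s) lam Λ 0 ≠ ⊥) :
    (groundEnergy (ξ.shift s) lam Λ 0).toReal ≤ (groundEnergy ξ lam Λ 0).toReal +
      (1 / 2 * dirichletEnergy Λ (φ + s) - 1 / 2 * dirichletEnergy Λ φ) := by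
  have hmem : φ + s ∈ configSpace Λ (0 : Surface d n) := fun v hv => by
    have h1 := h.1 v hv
    simp only [Pi.add_apply, h1, hs v hv, add_zero]
  have hle : groundEnergy (ξ.shift s) lam Λ 0 ≤ hamiltonian (ξ.shift s) lam Λ (φ + s) :=
    iInf₂_le _ hmem
  have hW : ∑ v ∈ Λ, (ξ.shift s).val v ((φ + s) v) = ∑ v ∈ Λ, ξ.val v (φ v) := by
    refine Finset.sum_congr rfl fun v _ => ?_
    simp [Environment.shift]
  rw [h.groundEnergy_eq] at htop ⊢
  unfold hamiltonian at hle htop ⊢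
  rw [hW] at hle
  have hWb := potential_ne_bot ξ hl Λ φ
  generalize (lam : EReal) * ∑ v ∈ Λ, ξ.val v (φ v) = W at *
  induction W using EReal.rec with
  | bot => exact absurd rfl hWb
  | top => exact absurd htop (by rw [EReal.coe_add_top]; exact lt_irrefl _)
  | coe w =>
    rw [← EReal.coe_add] at hle ⊢
    have h3 := EReal.toReal_le_toReal hle hbot (EReal.coe_ne_top _)
    rw [EReal.toReal_coe] at h3 ⊢
    linarith

/-- Energy of `φ + γ g e` for a unit vector `e` and a function `g` vanishing outside `Λ`. -/
lemma dirichletEnergy_add_smul (Λ : Finset (Fin d → ℤ)) (φ : Surface d n)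
    (g : (Fin d → ℤ) → ℝ) (e : EuclideanSpace ℝ (Fin n)) (he : ‖e‖ = 1)
    (hφ : ∀ x, x ∉ Λ → φ x = 0) (hg : ∀ x, x ∉ Λ → g x = 0) (γ : ℝ) :
    dirichletEnergy Λ (φ + fun x => (γ * g x) • e) = dirichletEnergy Λ φ +
      2 * γ * ∑ x ∈ Λ, inner ℝ (φ x) e * negLap g x +
      γ ^ 2 * ∑ x ∈ Λ, g x * negLap g x := by
  rw [← sum_edges_mul_eq Λ g g hg,
    ← sum_edges_mul_eq Λ (fun x => inner ℝ (φ x) e) g (fun x hx => by simp [hφ x hx])]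
  unfold dirichletEnergy
  simp only [Finset.mul_sum, ← Finset.sum_add_distrib]
  refine Finset.sum_congr rfl fun i _ => Finset.sum_congr rfl fun u _ => ?_
  have : (φ + fun x => (γ * g x) • e) (u + Pi.single i 1) - (φ + fun x => (γ * g x) • e) u =
      (φ (u + Pi.single i 1) - φ u) + (γ * (g (u + Pi.single i 1) - g u)) • e := by
    simp only [Pi.add_apply]
    module
  rw [this, norm_add_sq_real, inner_smul_right, inner_sub_left, norm_smul, he, mul_one,
    Real.norm_eq_abs, sq_abs]
  ring

end Shift

/-! ### Concentration of the ground energy of shifted environments -/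

section Concentration

variable {d n : ℕ}

lemma restrictionAlgebra_le [m : MeasurableSpace (Environment d n)] (A : Set (Fin d → ℤ)) :
    restrictionAlgebra A ≤ m := fun _ hS => hS.1

/-- A random variable measurable with respect to `ξ_A` takes the same value at two environments
that agree on `A`. -/
lemma eq_of_measurable_restrictionAlgebra [MeasurableSpace (Environment d n)]
    {A : Set (Fin d → ℤ)} {Y : Environment d n → ℝ} (hY : Measurable[restrictionAlgebra A] Y)
    {ξ ζ : Environment d n} (h : ∀ v ∈ A, ξ.val v = ζ.val v) : Y ξ = Y ζ := by
  have := (hY (measurableSet_singleton (Y ζ))).2 ξ ζ h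
  simpa using this

variable {Ω : Type u} [MeasurableSpace Ω] {P : Measure Ω} [IsProbabilityMeasure P]
  [MeasurableSpace (Environment d n)] {η : Ω → Environment d n} {lam : ℝ} {L : ℕ}

lemma sigmaRestriction_le (hη : Measurable η) (A : Set (Fin d → ℤ)) :
    sigmaRestriction η A ≤ ‹MeasurableSpace Ω› := by
  rintro S ⟨T, hT, rfl⟩
  exact hη hT.1

lemma measureReal_le_of_condProb_le {Ω : Type u} {m m₀ : MeasurableSpace Ω} {P : Measure Ω}
    [IsProbabilityMeasure P] (hm : m ≤ m₀) {S : Set Ω} (hS : NullMeasurableSet S P) {b : ℝ}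
    (h : ∀ᵐ ω ∂P, (P⟦S | m⟧) ω ≤ b) : P.real S ≤ b := by
  have h1 : ∫ ω, (P⟦S | m⟧) ω ∂P = P.real S := by
    rw [integral_condExp hm]
    have : ∫ ω, S.indicator (fun _ => (1 : ℝ)) ω ∂P = ∫ ω in S, (1 : ℝ) ∂P :=
      integral_indicator₀ hS
    rw [this]; simp
  rw [← h1]
  calc ∫ ω, (P⟦S | m⟧) ω ∂P ≤ ∫ ω, b ∂P :=
        integral_mono_ae integrable_condExp (integrable_const b) h
    _ = b := by simp

/-- A shift supported in the local box `Δ` changes the ground energy by at most twice the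
concentration scale: both energies concentrate around the same conditional expectation given the
disorder outside `Δ`. -/
lemma measureReal_groundEnergy_shift_lt {χ F α K κ : ℝ} (hlam : 0 < lam)
    (hη : IsDisorder P η) (hE : ExiMin P η) (hStat : Stat P η)
    (hconc : ChiConc P η lam L χ F α K κ) {ρ : ℝ} (hρ : 0 < ρ) {ℓ : ℕ} (h1 : 1 ≤ ℓ) (hL : ℓ ≤ L)
    {v : Fin d → ℤ} (hv : v ∈ box d L) {s : Surface d n}
    (hs : ∀ x, x ∉ localBox d L ℓ v → s x = 0) :
    P.real {ω | groundEnergy ((η ω).shift s) lam (box d L) 0 = ⊥ ∨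
      (groundEnergy ((η ω).shift s) lam (box d L) 0).toReal <
        (groundEnergy (η ω) lam (box d L) 0).toReal - 2 * (ρ * F * (ℓ : ℝ) ^ χ)}
      ≤ 2 * (K * Real.exp (-κ * ρ ^ α)) := by
  set A : Set (Fin d → ℤ) := (localBox d L ℓ v : Set (Fin d → ℤ))ᶜ with hA
  set a := ρ * F * (ℓ : ℝ) ^ χ with ha
  have hG := hη.aemeasurable_groundEnergy lam hlam (box d L) 0
  obtain ⟨X, hXm, hX⟩ := hG
  have hm : sigmaRestriction η A ≤ ‹MeasurableSpace Ω› := sigmaRestriction_le hη.measurable A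
  -- the conditional expectation is a function of the disorder outside the local box
  obtain ⟨Y, hYm, hY⟩ : ∃ Y : Environment d n → ℝ, Measurable[restrictionAlgebra A] Y ∧
      P[boxEnergy η lam L | sigmaRestriction η A] = Y ∘ η := by
    have : Measurable[sigmaRestriction η A] (P[boxEnergy η lam L | sigmaRestriction η A]) :=
      stronglyMeasurable_condExp.measurable
    exact @Measurable.exists_eq_measurable_comp _ _ _ (restrictionAlgebra A) η _ _ _ _ this
  have hYm' : Measurable Y := hYm.mono (restrictionAlgebra_le A) le_rfl
  have hst := hStat s
  have hXη : ∀ᵐ ω ∂P, groundEnergy (η ω) lam (box d L) 0 = X (η ω) :=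
    ae_of_ae_map hη.measurable.aemeasurable hX
  have hXs : ∀ᵐ ω ∂P, groundEnergy ((η ω).shift s) lam (box d L) 0 = X ((η ω).shift s) := by
    have hX' := hX
    rw [← hst.map_eq] at hX'
    exact ae_of_ae_map hst.aemeasurable_fst hX'
  set B : Set (Environment d n) := {ξ | X ξ = ⊥ ∨ a ≤ |(X ξ).toReal - Y ξ|} with hB
  have hBm : MeasurableSet B := by
    refine (hXm (measurableSet_singleton ⊥)).union ?_
    exact measurableSet_le measurable_const
      ((measurable_ereal_toReal.comp hXm).sub hYm').abs
  have hPB : P.real (η ⁻¹' B) ≤ K * Real.exp (-κ * ρ ^ α) := by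
    have hc := hconc.2 ρ hρ ℓ h1 hL v hv
    rw [← hA] at hc
    have hnm : NullMeasurableSet {ω' | ρ * F * (ℓ : ℝ) ^ χ ≤ |boxEnergy η lam L ω' -
        (P[boxEnergy η lam L | sigmaRestriction η A]) ω'|} P := by
      refine nullMeasurableSet_le aemeasurable_const ?_
      exact (hconc.1.aestronglyMeasurable.aemeasurable.sub
        integrable_condExp.aestronglyMeasurable.aemeasurable).abs
    refine le_trans (le_of_eq ?_) (measureReal_le_of_condProb_le hm hnm hc)
    refine measureReal_congr ?_
    filter_upwards [hXη, hE lam hlam (box d L) 0] with ω hω hmin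
    obtain ⟨φ, hφ, hφm⟩ := hmin.1 _ subset_rfl (by
      have : configSpace (box d L) (0 : Surface d n) =
        ⋂ v, ⋂ (_ : v ∉ box d L), (fun φ : Surface d n => φ v) ⁻¹' {0} := by
        ext φ; simp [configSpace]
      rw [this]
      exact isClosed_iInter fun v => isClosed_iInter fun _ =>
        isClosed_singleton.preimage (continuous_apply v)) ⟨0, fun _ _ => rfl⟩
    have hb : X (η ω) ≠ ⊥ := by
      rw [← hω, IsGroundConfig.groundEnergy_eq ⟨hφ, hφm⟩]
      exact hamiltonian_ne_bot _ hlam _ _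
    apply propext
    change (X (η ω) = ⊥ ∨ a ≤ |(X (η ω)).toReal - Y (η ω)|) ↔
      ρ * F * (ℓ : ℝ) ^ χ ≤ |boxEnergy η lam L ω -
        (P[boxEnergy η lam L | sigmaRestriction η A]) ω|
    rw [hY, boxEnergy, hω]
    simp [hb, ha]
  have hPB' : P.real ((fun ω => (η ω).shift s) ⁻¹' B) = P.real (η ⁻¹' B) := by
    unfold Measure.real
    rw [hst.measure_mem_eq hBm]
  have hsub : {ω | groundEnergy ((η ω).shift s) lam (box d L) 0 = ⊥ ∨
      (groundEnergy ((η ω).shift s) lam (box d L) 0).toReal <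
        (groundEnergy (η ω) lam (box d L) 0).toReal - 2 * a} ≤ᵐ[P]
      (η ⁻¹' B ∪ (fun ω => (η ω).shift s) ⁻¹' B : Set Ω) := by
    filter_upwards [hXη, hXs] with ω h1 h2
    intro h
    change _ ∨ _ at h
    change (X (η ω) = ⊥ ∨ a ≤ |(X (η ω)).toReal - Y (η ω)|) ∨
      (X ((η ω).shift s) = ⊥ ∨ a ≤ |(X ((η ω).shift s)).toReal - Y ((η ω).shift s)|)
    have hYeq : Y ((η ω).shift s) = Y (η ω) := by
      refine eq_of_measurable_restrictionAlgebra hYm fun x hx => ?_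
      have hx' : s x = 0 := hs x (by simpa [hA] using hx)
      ext t
      simp [Environment.shift, hx']
    rw [h1, h2] at h
    rw [hYeq]
    rcases h with h | h
    · exact Or.inr (Or.inl h)
    · by_contra hcon
      push Not at hcon
      obtain ⟨⟨_, h3⟩, _, h4⟩ := hcon
      rw [abs_lt] at h3 h4
      linarith
  calc _ ≤ P.real (η ⁻¹' B ∪ (fun ω => (η ω).shift s) ⁻¹' B : Set Ω) :=
        ENNReal.toReal_mono (measure_ne_top _ _) (measure_mono_ae hsub)
    _ ≤ P.real (η ⁻¹' B) + P.real ((fun ω => (η ω).shift s) ⁻¹' B) := measureReal_union_le _ _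
    _ ≤ _ := by rw [hPB']; linarith

/-- The random variable `Z` has a stretched-exponential upper tail with exponent `β` on the
scale `a`. -/
def HasTail {Ω : Type u} [MeasurableSpace Ω] (P : Measure Ω) (β C c : ℝ) (Z : Ω → ℝ) (a : ℝ) :
    Prop :=
  ∀ t : ℝ, 0 < t → P.real {ω | t * a < Z ω} ≤ C * Real.exp (-c * t ^ β)

/-- Linear statistics of a ground configuration: if `g` is supported in a local box of side `ℓ` and
has Dirichlet energy at most `B`, then `∑ (-Δ g)(x) φ_x` lives on the scale `√(F ℓ^χ B)`. This
follows from comparing ground energies under the shifts `± γ g e_i` with the optimal `γ`. -/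
lemma hasTail_negLap {χ F α K κ : ℝ} (hlam : 0 < lam) (hF : 0 < F)
    (hη : IsDisorder P η) (hE : ExiMin P η) (hStat : Stat P η)
    (hconc : ChiConc P η lam L χ F α K κ) {φ : Ω → Surface d n}
    (hφ : ∀ᵐ ω ∂P, IsGroundConfig (η ω) lam (box d L) 0 (φ ω))
    {ℓ : ℕ} (h1 : 1 ≤ ℓ) (hL : ℓ ≤ L) {v : Fin d → ℤ} (hv : v ∈ box d L) {g : (Fin d → ℤ) → ℝ}
    (hg : ∀ x, x ∉ localBox d L ℓ v → g x = 0) {B : ℝ} (hB : 0 < B)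
    (hgB : ∑ x ∈ box d L, g x * negLap g x ≤ B) :
    HasTail P (2 * α) (4 * n * K) κ (fun ω => ‖∑ x ∈ box d L, negLap g x • φ ω x‖)
      (2 * n * √(F * (ℓ : ℝ) ^ χ * B)) := by
  intro t ht
  set D := t ^ 2 * F * (ℓ : ℝ) ^ χ with hD
  have hℓ : (0 : ℝ) < (ℓ : ℝ) ^ χ := Real.rpow_pos_of_pos (by exact_mod_cast h1) _
  have hD0 : 0 < D := by positivity
  set q := √(D * B) with hq
  have hq0 : 0 < q := Real.sqrt_pos.2 (by positivity)
  have hq2 : q * q = D * B := Real.mul_self_sqrt (by positivity)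
  have hqt : q = t * √(F * (ℓ : ℝ) ^ χ * B) := by
    rw [hq, hD, show t ^ 2 * F * (ℓ : ℝ) ^ χ * B = t ^ 2 * (F * (ℓ : ℝ) ^ χ * B) by ring,
      Real.sqrt_mul (by positivity), Real.sqrt_sq ht.le]
  -- the optimal size of the shift
  set γ := 2 * q / B with hγ
  have hγ0 : 0 < γ := by positivity
  have hgΛ : ∀ x, x ∉ box d L → g x = 0 := fun x hx => hg x fun h => hx (mem_localBox.1 h).2
  let sgn : Bool → ℝ := fun b => if b then 1 else -1
  let s : Fin n × Bool → Surface d n := fun p x =>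
    (sgn p.2 * γ * g x) • EuclideanSpace.single p.1 (1 : ℝ)
  let bad : Fin n × Bool → Set Ω := fun p =>
    {ω | groundEnergy ((η ω).shift (s p)) lam (box d L) 0 = ⊥ ∨
      (groundEnergy ((η ω).shift (s p)) lam (box d L) 0).toReal <
        (groundEnergy (η ω) lam (box d L) 0).toReal - 2 * (t ^ 2 * F * (ℓ : ℝ) ^ χ)}
  have hbad : ∀ p, P.real (bad p) ≤ 2 * (K * Real.exp (-κ * t ^ (2 * α))) := fun p => by
    have := measureReal_groundEnergy_shift_lt hlam hη hE hStat hconc (ρ := t ^ 2) (by positivity)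
      h1 hL hv (s := s p) (fun x hx => by simp [s, hg x hx])
    rwa [← Real.rpow_natCast, ← Real.rpow_mul ht.le, Nat.cast_ofNat, Real.rpow_ofNat] at this
  have hsub : {ω | t * (2 * n * √(F * (ℓ : ℝ) ^ χ * B)) <
      ‖∑ x ∈ box d L, negLap g x • φ ω x‖} ≤ᵐ[P]
      (⋃ p ∈ (Finset.univ : Finset (Fin n × Bool)), bad p : Set Ω) := by
    filter_upwards [hφ, hE lam hlam (box d L) 0] with ω hω hmin hlt
    change _ < _ at hlt
    change ω ∈ (⋃ p ∈ (Finset.univ : Finset (Fin n × Bool)), bad p : Set Ω)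
    by_contra hcon
    simp only [Set.mem_iUnion, not_exists] at hcon
    refine absurd hlt (not_lt.2 ?_)
    set V := ∑ x ∈ box d L, negLap g x • φ ω x with hV
    have hinner : ∀ i, ∑ x ∈ box d L,
        inner ℝ (φ ω x) (EuclideanSpace.single i (1 : ℝ)) * negLap g x = V i := fun i => by
      rw [hV, WithLp.ofLp_sum, Finset.sum_apply]
      refine Finset.sum_congr rfl fun x _ => ?_
      simp [EuclideanSpace.inner_single_right, mul_comm]
    have key : ∀ p : Fin n × Bool, -(2 * q) ≤ sgn p.2 * V p.1 := fun p => by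
      have hp : ω ∉ bad p := hcon p (Finset.mem_univ _)
      have hp' : ¬(_ ∨ _) := hp
      push Not at hp'
      obtain ⟨hp1, hp2⟩ := hp'
      have h3 := groundEnergy_shift_toReal_le hlam hω hmin.2
        (s := s p) (fun x hx => by simp [s, hgΛ x hx]) hp1
      have h4 := dirichletEnergy_add_smul (box d L) (φ ω) g
        (EuclideanSpace.single p.1 (1 : ℝ)) (by simp) (fun x hx => hω.1 x hx) hgΛ (sgn p.2 * γ)
      change dirichletEnergy (box d L) (φ ω + s p) = _ at h4
      rw [h4, hinner] at h3
      have hs2 : (sgn p.2 * γ) ^ 2 = γ ^ 2 := by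
        rw [mul_pow]; cases p.2 <;> simp [sgn]
      rw [hs2] at h3
      have h5 : γ ^ 2 * ∑ x ∈ box d L, g x * negLap g x ≤ γ ^ 2 * B := by gcongr
      have h6 : γ ^ 2 * B = 4 * D := by
        rw [hγ, div_pow, mul_pow, pow_two q, hq2]; field_simp
        norm_num
      have h7 : -(4 * D) ≤ γ * (sgn p.2 * V p.1) := by
        rw [← hD] at hp2
        linarith
      have h8 : γ * (2 * q) = 4 * D := by
        rw [hγ, show 2 * q / B * (2 * q) = 4 * (q * q) / B by ring, hq2]; field_simp
      by_contra hc
      push Not at hc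
      have := mul_lt_mul_of_pos_left hc hγ0
      linarith
    have habs : ∀ i, |V i| ≤ 2 * q := fun i => by
      have ht := key (i, true)
      have hf := key (i, false)
      simp only [sgn, if_true, Bool.false_eq_true, if_false] at ht hf
      rw [abs_le]; constructor <;> linarith
    calc ‖V‖ = ‖∑ i, (V i) • EuclideanSpace.single i (1 : ℝ)‖ := by
          congr 1
          ext j
          simp [Pi.single_apply]
      _ ≤ ∑ i : Fin n, ‖(V i) • EuclideanSpace.single i (1 : ℝ)‖ := norm_sum_le _ _
      _ ≤ ∑ i : Fin n, 2 * q := Finset.sum_le_sum fun i _ => by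
          rw [norm_smul]; simpa using habs i
      _ = t * (2 * n * √(F * (ℓ : ℝ) ^ χ * B)) := by
          rw [Finset.sum_const, Finset.card_univ, Fintype.card_fin, hqt, nsmul_eq_mul]; ring
  calc _ ≤ P.real (⋃ p ∈ (Finset.univ : Finset (Fin n × Bool)), bad p : Set Ω) :=
        ENNReal.toReal_mono (measure_ne_top _ _) (measure_mono_ae hsub)
    _ ≤ ∑ p : Fin n × Bool, P.real (bad p) := measureReal_biUnion_finset_le _ _
    _ ≤ ∑ p : Fin n × Bool, 2 * (K * Real.exp (-κ * t ^ (2 * α))) :=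
        Finset.sum_le_sum fun p _ => hbad p
    _ = _ := by
        rw [Finset.sum_const, Finset.card_univ, Fintype.card_prod, Fintype.card_fin,
          Fintype.card_bool, nsmul_eq_mul]
        push_cast; ring

end Concentration

/-! ### The Dirichlet sine basis of the box -/

lemma two_mul_sin_half_mul_sum_cos (x : ℝ) (M : ℕ) :
    2 * Real.sin (x / 2) * ∑ j ∈ Finset.Icc 1 M, Real.cos (j * x) =
      Real.sin ((M + 1 / 2) * x) - Real.sin (x / 2) := by
  induction M with
  | zero => simp; ring_nf
  | succ M ih =>
    rw [Finset.sum_Icc_succ_top (by omega), mul_add, ih]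
    have h1 : ((M + 1 : ℕ) + 1 / 2 : ℝ) * x = (M + 1 : ℕ) * x + x / 2 := by ring
    have h2 : (M + 1 / 2 : ℝ) * x = (M + 1 : ℕ) * x - x / 2 := by push_cast; ring
    rw [h1, h2, Real.sin_add, Real.sin_sub]
    ring

lemma two_mul_sum_cos_pi {N : ℕ} (hN : 1 ≤ N) (m : ℝ) (hm : Real.sin (Real.pi * m / N / 2) ≠ 0)
    (hs : Real.sin (Real.pi * m) = 0) :
    2 * ∑ j ∈ Finset.Icc 1 (N - 1), Real.cos (j * (Real.pi * m / N)) =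
      -Real.cos (Real.pi * m) - 1 := by
  have h := two_mul_sin_half_mul_sum_cos (Real.pi * m / N) (N - 1)
  have hN0 : (N : ℝ) ≠ 0 := by positivity
  have h1 : (((N - 1 : ℕ) : ℝ) + 1 / 2) * (Real.pi * m / N) =
      Real.pi * m - Real.pi * m / N / 2 := by
    rw [Nat.cast_sub hN]; field_simp; push_cast; ring
  rw [h1, Real.sin_sub, hs] at h
  apply mul_left_cancel₀ hm
  linarith

lemma sum_sin_mul_sin {N p q : ℕ} (hp : p ∈ Finset.Icc 1 (N - 1)) (hq : q ∈ Finset.Icc 1 (N - 1)) :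
    ∑ j ∈ Finset.Icc 1 (N - 1), Real.sin (Real.pi * p * j / N) * Real.sin (Real.pi * q * j / N) =
      if p = q then (N : ℝ) / 2 else 0 := by
  rw [Finset.mem_Icc] at hp hq
  have hN : 1 ≤ N := by omega
  have hNpos : (0 : ℝ) < N := by exact_mod_cast hN
  have hpi := Real.pi_pos
  have hprod : ∀ j : ℕ, Real.sin (Real.pi * p * j / N) * Real.sin (Real.pi * q * j / N) =
      1 / 2 * (Real.cos (j * (Real.pi * ((p : ℝ) - q) / N)) -
        Real.cos (j * (Real.pi * ((p : ℝ) + q) / N))) := fun j => by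
    have h1 : (j : ℝ) * (Real.pi * ((p : ℝ) - q) / N) =
      Real.pi * p * j / N - Real.pi * q * j / N := by ring
    have h2 : (j : ℝ) * (Real.pi * ((p : ℝ) + q) / N) =
      Real.pi * p * j / N + Real.pi * q * j / N := by ring
    rw [h1, h2, Real.cos_sub, Real.cos_add]
    ring
  simp only [hprod, ← Finset.mul_sum, Finset.sum_sub_distrib]
  have hplus := two_mul_sum_cos_pi hN ((p : ℝ) + q) (by
    refine (Real.sin_pos_of_pos_of_lt_pi ?_ ?_).ne'
    · have : (1 : ℝ) ≤ p := by exact_mod_cast hp.1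
      positivity
    · rw [div_div, div_lt_iff₀ (by positivity), mul_lt_mul_iff_right₀ hpi]
      have : (p : ℝ) + q < N * 2 := by exact_mod_cast (by omega : p + q < N * 2)
      linarith) (by
    have := Real.sin_nat_mul_pi (p + q)
    rw [mul_comm]; exact_mod_cast this)
  have hcos : Real.cos (Real.pi * ((p : ℝ) + q)) = Real.cos (Real.pi * ((p : ℝ) - q)) := by
    have : Real.pi * ((p : ℝ) + q) = Real.pi * ((p : ℝ) - q) + q * (2 * Real.pi) := by ring
    rw [this, Real.cos_add_nat_mul_two_pi]
  by_cases hpq : p = q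
  · subst hpq
    rw [sub_self, mul_zero, Real.cos_zero] at hcos
    rw [hcos] at hplus
    have : ((N - 1 : ℕ) : ℝ) = N - 1 := by rw [Nat.cast_sub hN]; simp
    simp only [sub_self, mul_zero, zero_div, Real.cos_zero, Finset.sum_const, Nat.card_Icc,
      Nat.add_sub_cancel, nsmul_eq_mul, mul_one, if_true, this]
    linarith
  · have hminus := two_mul_sum_cos_pi hN ((p : ℝ) - q) (by
      have hne : (p : ℝ) - q ≠ 0 := sub_ne_zero.2 (by exact_mod_cast hpq)
      have hlt : |(p : ℝ) - q| < N := by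
        rw [abs_lt]
        have h1 : (p : ℝ) < N := by exact_mod_cast (by omega : p < N)
        have h2 : (q : ℝ) < N := by exact_mod_cast (by omega : q < N)
        have h3 : (0 : ℝ) ≤ p := by positivity
        have h4 : (0 : ℝ) ≤ q := by positivity
        constructor <;> linarith
      intro h0
      rw [Real.sin_eq_zero_iff_of_lt_of_lt] at h0
      · have : Real.pi * ((p : ℝ) - q) = 0 := by
          field_simp at h0; simpa using h0
        exact hne ((mul_eq_zero.1 this).resolve_left hpi.ne')
      · rw [abs_lt] at hlt
        rw [div_div, lt_div_iff₀ (by positivity)]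
        nlinarith
      · rw [abs_lt] at hlt
        rw [div_div, div_lt_iff₀ (by positivity)]
        nlinarith) (by
      have := Real.sin_int_mul_pi ((p : ℤ) - q)
      rw [mul_comm]; exact_mod_cast this)
    rw [if_neg hpq]
    rw [hcos] at hplus
    linarith

/-- The one-dimensional Dirichlet sine mode of frequency `k` on `{-L, …, L}`, extended by zero to
`ℤ`. The extension is achieved by clipping the argument to the period `{0, …, 2L+2}`, which also
makes the Lipschitz bound global. -/
noncomputable def sineFactor (L k : ℕ) (a : ℤ) : ℝ :=
  Real.sin (Real.pi * k * ((max 0 (min (a + L + 1) (2 * L + 2)) : ℤ) : ℝ) / ((2 * L + 2 : ℕ) : ℝ))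

/-- The frequency angle `π k / (2L+2)`. -/
noncomputable def sineAngle (L k : ℕ) : ℝ := Real.pi * k / ((2 * L + 2 : ℕ) : ℝ)

/-- The frequencies of the sine modes of the box `Λ_L`. -/
def freqBox (d L : ℕ) : Finset (Fin d → ℕ) := Fintype.piFinset fun _ => Finset.Icc 1 (2 * L + 1)

/-- The (unnormalized) Dirichlet eigenfunction of the box `Λ_L` with frequency `k`, extended by
zero. -/
noncomputable def sineMode {d : ℕ} (L : ℕ) (k : Fin d → ℕ) (x : Fin d → ℤ) : ℝ :=
  ∏ i, sineFactor L (k i) (x i)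

/-- Half the eigenvalue of `-Δ` on the sine mode of frequency `k`. -/
noncomputable def modeEnergy {d : ℕ} (L : ℕ) (k : Fin d → ℕ) : ℝ :=
  ∑ i, (1 - Real.cos (sineAngle L (k i)))

lemma sineFactor_of_abs_le {L k : ℕ} {a : ℤ} (ha : |a| ≤ L + 1) :
    sineFactor L k a = Real.sin (sineAngle L k * (a + L + 1)) := by
  rw [abs_le] at ha
  have : max 0 (min (a + L + 1) (2 * L + 2)) = a + L + 1 := by omega
  rw [sineFactor, this, sineAngle]
  congr 1
  push_cast
  ring

lemma sineFactor_eq_zero {L k : ℕ} {a : ℤ} (ha : L < |a|) : sineFactor L k a = 0 := by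
  rw [lt_abs] at ha
  rcases ha with ha | ha
  · have : max 0 (min (a + L + 1) (2 * L + 2)) = 2 * L + 2 := by omega
    rw [sineFactor, this]
    have h : Real.pi * k * ((2 * L + 2 : ℤ) : ℝ) / ((2 * L + 2 : ℕ) : ℝ) = k * Real.pi := by
      push_cast; field_simp
    rw [h, Real.sin_nat_mul_pi]
  · have : max 0 (min (a + L + 1) (2 * L + 2)) = 0 := by omega
    rw [sineFactor, this]
    simp

lemma abs_sineFactor_le_one (L k : ℕ) (a : ℤ) : |sineFactor L k a| ≤ 1 := Real.abs_sin_le_one _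

lemma sineAngle_nonneg (L k : ℕ) : 0 ≤ sineAngle L k := by
  have := Real.pi_pos; unfold sineAngle; positivity

lemma sineAngle_le_pi {L k : ℕ} (hk : k ∈ Finset.Icc 1 (2 * L + 1)) : sineAngle L k ≤ Real.pi := by
  rw [Finset.mem_Icc] at hk
  unfold sineAngle
  rw [div_le_iff₀ (by positivity)]
  have : (k : ℝ) ≤ (2 * L + 2 : ℕ) := by exact_mod_cast (by omega)
  exact mul_le_mul_of_nonneg_left this Real.pi_pos.le

lemma abs_sineFactor_sub_le (L k : ℕ) (a b : ℤ) :
    |sineFactor L k a - sineFactor L k b| ≤ sineAngle L k * |(a : ℝ) - b| := by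
  unfold sineFactor
  refine (Real.abs_sin_sub_sin_le _ _).trans ?_
  set p := max 0 (min (a + L + 1) (2 * L + 2)) with hp
  set q := max 0 (min (b + L + 1) (2 * L + 2)) with hq
  have h1 : Real.pi * k * (p : ℝ) / ((2 * L + 2 : ℕ) : ℝ) -
      Real.pi * k * (q : ℝ) / ((2 * L + 2 : ℕ) : ℝ) = sineAngle L k * ((p : ℝ) - q) := by
    unfold sineAngle; ring
  rw [h1, abs_mul, abs_of_nonneg (sineAngle_nonneg L k)]
  refine mul_le_mul_of_nonneg_left ?_ (sineAngle_nonneg L k)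
  have h2 : |p - q| ≤ |a - b| := by
    rw [abs_le]
    rcases abs_cases (a - b) with h | h <;> omega
  exact_mod_cast h2

lemma sineFactor_add_one_add_sub_one {L k : ℕ} {a : ℤ} (ha : |a| ≤ L) :
    sineFactor L k (a + 1) + sineFactor L k (a - 1) =
      2 * Real.cos (sineAngle L k) * sineFactor L k a := by
  rw [abs_le] at ha
  rw [sineFactor_of_abs_le (by rw [abs_le]; omega), sineFactor_of_abs_le (by rw [abs_le]; omega),
    sineFactor_of_abs_le (by rw [abs_le]; omega)]
  have h1 : sineAngle L k * (((a + 1 : ℤ) : ℝ) + L + 1) =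
    sineAngle L k * (a + L + 1) + sineAngle L k := by push_cast; ring
  have h2 : sineAngle L k * (((a - 1 : ℤ) : ℝ) + L + 1) =
    sineAngle L k * (a + L + 1) - sineAngle L k := by push_cast; ring
  rw [h1, h2, Real.sin_add, Real.sin_sub]
  ring

lemma sum_sineFactor_freq {L : ℕ} {a b : ℤ} (ha : |a| ≤ L) (hb : |b| ≤ L) :
    ∑ k ∈ Finset.Icc 1 (2 * L + 1), sineFactor L k a * sineFactor L k b =
      if a = b then (L + 1 : ℝ) else 0 := by
  rw [abs_le] at ha hb
  have h := sum_sin_mul_sin (N := 2 * L + 2) (p := (a + L + 1).toNat) (q := (b + L + 1).toNat)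
    (by rw [Finset.mem_Icc]; omega) (by rw [Finset.mem_Icc]; omega)
  have e : ∀ c : ℤ, -(L : ℤ) ≤ c → (((c + L + 1).toNat : ℕ) : ℝ) = c + L + 1 := fun c hc => by
    have : (((c + L + 1).toNat : ℕ) : ℤ) = c + L + 1 := by omega
    exact_mod_cast congrArg (fun z : ℤ => (z : ℝ)) this
  rw [e a ha.1, e b hb.1] at h
  have hc : ((a + L + 1).toNat = (b + L + 1).toNat) ↔ a = b := by omega
  have h2 : ((2 * L + 2 : ℕ) : ℝ) / 2 = L + 1 := by push_cast; ring
  simp only [hc, h2] at h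
  rw [← h]
  refine Finset.sum_congr rfl fun k _ => ?_
  rw [sineFactor_of_abs_le (by rw [abs_le]; omega), sineFactor_of_abs_le (by rw [abs_le]; omega)]
  unfold sineAngle
  congr 2 <;> ring

lemma sum_sineFactor_site {L k l : ℕ} (hk : k ∈ Finset.Icc 1 (2 * L + 1))
    (hl : l ∈ Finset.Icc 1 (2 * L + 1)) :
    ∑ a ∈ Finset.Icc (-(L : ℤ)) L, sineFactor L k a * sineFactor L l a =
      if k = l then (L + 1 : ℝ) else 0 := by
  have h := sum_sin_mul_sin (N := 2 * L + 2) hk hl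
  have h2 : ((2 * L + 2 : ℕ) : ℝ) / 2 = L + 1 := by push_cast; ring
  rw [h2] at h
  rw [← h]
  refine Finset.sum_bij (fun a _ => (a + L + 1).toNat) ?_ ?_ ?_ ?_
  · intro a ha; rw [Finset.mem_Icc] at ha ⊢; omega
  · intro a ha b hb hab; rw [Finset.mem_Icc] at ha hb; omega
  · intro j hj
    rw [Finset.mem_Icc] at hj
    exact ⟨(j : ℤ) - L - 1, by rw [Finset.mem_Icc]; omega, by omega⟩
  · intro a ha
    rw [Finset.mem_Icc] at ha
    have e : (((a + L + 1).toNat : ℕ) : ℝ) = a + L + 1 := by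
      have : (((a + L + 1).toNat : ℕ) : ℤ) = a + L + 1 := by omega
      exact_mod_cast congrArg (fun z : ℤ => (z : ℝ)) this
    rw [e, sineFactor_of_abs_le (by rw [abs_le]; omega),
      sineFactor_of_abs_le (by rw [abs_le]; omega)]
    unfold sineAngle
    congr 2 <;> ring

section Modes

variable {d L : ℕ}

lemma prod_ite_eq_ite {ι α : Type*} [Fintype ι] [DecidableEq α] (f g : ι → α) (c : ℝ) :
    ∏ i, (if f i = g i then c else 0) = if f = g then c ^ Fintype.card ι else 0 := by
  classical
  by_cases h : f = g
  · subst h; simp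
  · rw [if_neg h]
    obtain ⟨i, hi⟩ := Function.ne_iff.1 h
    exact Finset.prod_eq_zero (Finset.mem_univ i) (if_neg hi)

lemma sum_sineMode_freq {u x : Fin d → ℤ} (hu : u ∈ box d L) (hx : x ∈ box d L) :
    ∑ k ∈ freqBox d L, sineMode L k u * sineMode L k x =
      if u = x then (L + 1 : ℝ) ^ d else 0 := by
  unfold sineMode freqBox
  simp only [← Finset.prod_mul_distrib]
  rw [Finset.sum_prod_piFinset (Finset.Icc 1 (2 * L + 1))
    (fun i k => sineFactor L k (u i) * sineFactor L k (x i))]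
  rw [Finset.prod_congr rfl fun i _ => sum_sineFactor_freq (mem_box.1 hu i) (mem_box.1 hx i),
    prod_ite_eq_ite, Fintype.card_fin]

lemma sum_sineMode_site {k l : Fin d → ℕ} (hk : k ∈ freqBox d L) (hl : l ∈ freqBox d L) :
    ∑ x ∈ box d L, sineMode L k x * sineMode L l x = if k = l then (L + 1 : ℝ) ^ d else 0 := by
  unfold freqBox at hk hl
  rw [Fintype.mem_piFinset] at hk hl
  unfold sineMode box
  simp only [← Finset.prod_mul_distrib]
  rw [Finset.sum_prod_piFinset (Finset.Icc (-(L : ℤ)) L)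
    (fun i a => sineFactor L (k i) a * sineFactor L (l i) a)]
  rw [Finset.prod_congr rfl fun i _ => sum_sineFactor_site (hk i) (hl i),
    prod_ite_eq_ite, Fintype.card_fin]

lemma sineMode_eq_zero {k : Fin d → ℕ} {x : Fin d → ℤ} (hx : x ∉ box d L) : sineMode L k x = 0 := by
  rw [mem_box] at hx
  push Not at hx
  obtain ⟨i, hi⟩ := hx
  exact Finset.prod_eq_zero (Finset.mem_univ i) (sineFactor_eq_zero hi)

lemma abs_sineMode_le_one (k : Fin d → ℕ) (x : Fin d → ℤ) : |sineMode L k x| ≤ 1 := by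
  rw [sineMode, Finset.abs_prod]
  exact Finset.prod_le_one (fun _ _ => abs_nonneg _) fun _ _ => abs_sineFactor_le_one _ _ _

lemma abs_prod_sub_prod_le {ι : Type*} (s : Finset ι) (f g : ι → ℝ) (hf : ∀ i, |f i| ≤ 1)
    (hg : ∀ i, |g i| ≤ 1) : |∏ i ∈ s, f i - ∏ i ∈ s, g i| ≤ ∑ i ∈ s, |f i - g i| := by
  classical
  induction s using Finset.induction_on with
  | empty => simp
  | insert a s ha ih =>
    rw [Finset.prod_insert ha, Finset.prod_insert ha, Finset.sum_insert ha]
    have h1 : f a * ∏ i ∈ s, f i - g a * ∏ i ∈ s, g i =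
      (f a - g a) * ∏ i ∈ s, f i + g a * (∏ i ∈ s, f i - ∏ i ∈ s, g i) := by ring
    have h2 : |∏ i ∈ s, f i| ≤ 1 := by
      rw [Finset.abs_prod]
      exact Finset.prod_le_one (fun _ _ => abs_nonneg _) fun i _ => hf i
    rw [h1]
    refine (abs_add_le _ _).trans ?_
    rw [abs_mul, abs_mul]
    refine add_le_add (mul_le_of_le_one_right (abs_nonneg _) h2) ?_
    exact (mul_le_of_le_one_left (abs_nonneg _) (hg a)).trans ih

lemma two_div_pi_sq_mul_sq_le_one_sub_cos {x : ℝ} (h0 : 0 ≤ x) (hx : x ≤ Real.pi) :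
    2 / Real.pi ^ 2 * x ^ 2 ≤ 1 - Real.cos x := by
  have h1 : Real.cos x = 1 - 2 * Real.sin (x / 2) ^ 2 := by
    have := Real.cos_two_mul (x / 2)
    rw [mul_div_cancel₀ _ two_ne_zero] at this
    rw [this, Real.cos_sq']; ring
  have h2 : 2 / Real.pi * (x / 2) ≤ Real.sin (x / 2) := Real.mul_le_sin (by linarith) (by linarith)
  have h3 : (2 / Real.pi * (x / 2)) ^ 2 ≤ Real.sin (x / 2) ^ 2 :=
    pow_le_pow_left₀ (by have := Real.pi_pos; positivity) h2 2
  have h4 : (2 / Real.pi * (x / 2)) ^ 2 = 1 / Real.pi ^ 2 * x ^ 2 := by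
    have := Real.pi_pos; field_simp
  rw [h4] at h3
  rw [h1]
  have : 2 / Real.pi ^ 2 * x ^ 2 = 2 * (1 / Real.pi ^ 2 * x ^ 2) := by ring
  linarith

lemma sum_sineAngle_sq_le {k : Fin d → ℕ} (hk : k ∈ freqBox d L) :
    ∑ i, sineAngle L (k i) ^ 2 ≤ Real.pi ^ 2 / 2 * modeEnergy L k := by
  unfold freqBox at hk
  rw [Fintype.mem_piFinset] at hk
  unfold modeEnergy
  rw [Finset.mul_sum]
  refine Finset.sum_le_sum fun i _ => ?_
  have h := two_div_pi_sq_mul_sq_le_one_sub_cos (sineAngle_nonneg L (k i)) (sineAngle_le_pi (hk i))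
  have hpi := Real.pi_pos
  calc sineAngle L (k i) ^ 2
      = Real.pi ^ 2 / 2 * (2 / Real.pi ^ 2 * sineAngle L (k i) ^ 2) := by field_simp
    _ ≤ _ := by gcongr

/-- The increment of a mode is controlled by its energy. -/
lemma sineMode_sub_sq_le {k : Fin d → ℕ} (hk : k ∈ freqBox d L) {u w : Fin d → ℤ} {m : ℝ}
    (hm : ∀ i, |(u i : ℝ) - w i| ≤ m) :
    (sineMode L k u - sineMode L k w) ^ 2 ≤ d * (Real.pi ^ 2 / 2) * m ^ 2 * modeEnergy L k := by
  have h1 : |sineMode L k u - sineMode L k w| ≤ ∑ i, sineAngle L (k i) * m := by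
    refine (abs_prod_sub_prod_le _ _ _ (fun i => abs_sineFactor_le_one _ _ _)
      (fun i => abs_sineFactor_le_one _ _ _)).trans ?_
    refine Finset.sum_le_sum fun i _ => (abs_sineFactor_sub_le _ _ _ _).trans ?_
    exact mul_le_mul_of_nonneg_left (hm i) (sineAngle_nonneg _ _)
  rw [← sq_abs]
  calc |sineMode L k u - sineMode L k w| ^ 2 ≤ (∑ i, sineAngle L (k i) * m) ^ 2 := by gcongr
    _ = m ^ 2 * (∑ i, sineAngle L (k i)) ^ 2 := by rw [← Finset.sum_mul]; ring
    _ ≤ m ^ 2 * (d * ∑ i, sineAngle L (k i) ^ 2) := by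
        gcongr
        have := sq_sum_le_card_mul_sum_sq (s := Finset.univ) (f := fun i => sineAngle L (k i))
        simpa using this
    _ ≤ m ^ 2 * (d * (Real.pi ^ 2 / 2 * modeEnergy L k)) := by
        gcongr; exact sum_sineAngle_sq_le hk
    _ = _ := by ring

lemma modeEnergy_nonneg (k : Fin d → ℕ) : 0 ≤ modeEnergy L k :=
  Finset.sum_nonneg fun i _ => by linarith [Real.cos_le_one (sineAngle L (k i))]

lemma modeEnergy_le (k : Fin d → ℕ) : modeEnergy L k ≤ 2 * d := by
  calc modeEnergy L k ≤ ∑ _i : Fin d, (2 : ℝ) :=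
        Finset.sum_le_sum fun i _ => by linarith [Real.neg_one_le_cos (sineAngle L (k i))]
    _ = 2 * d := by simp [mul_comm]

lemma le_modeEnergy (hd : 1 ≤ d) {k : Fin d → ℕ} (hk : k ∈ freqBox d L) :
    1 / (2 * (L + 1 : ℝ) ^ 2) ≤ modeEnergy L k := by
  have h := sum_sineAngle_sq_le hk
  have hpi := Real.pi_pos
  unfold freqBox at hk
  rw [Fintype.mem_piFinset] at hk
  have h0 : sineAngle L (k ⟨0, hd⟩) ^ 2 ≤ ∑ i, sineAngle L (k i) ^ 2 :=
    Finset.single_le_sum (f := fun i => sineAngle L (k i) ^ 2) (fun i _ => sq_nonneg _)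
      (Finset.mem_univ _)
  have h1 : Real.pi / (2 * (L + 1)) ≤ sineAngle L (k ⟨0, hd⟩) := by
    have hk1 : (1 : ℝ) ≤ k ⟨0, hd⟩ := by exact_mod_cast (Finset.mem_Icc.1 (hk ⟨0, hd⟩)).1
    unfold sineAngle
    have : ((2 * L + 2 : ℕ) : ℝ) = 2 * (L + 1) := by push_cast; ring
    rw [this]
    gcongr
    nlinarith
  have h2 : (Real.pi / (2 * (L + 1))) ^ 2 ≤ Real.pi ^ 2 / 2 * modeEnergy L k :=
    (pow_le_pow_left₀ (by positivity) h1 2).trans (h0.trans h)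
  have h3 : (Real.pi / (2 * (L + 1 : ℝ))) ^ 2 =
      Real.pi ^ 2 / 2 * (1 / (2 * (L + 1 : ℝ) ^ 2)) := by field_simp
  rw [h3] at h2
  exact le_of_mul_le_mul_left h2 (by positivity)

lemma sineMode_add_sub_single {k : Fin d → ℕ} {x : Fin d → ℤ} (hx : x ∈ box d L) (i : Fin d) :
    sineMode L k (x + Pi.single i 1) + sineMode L k (x - Pi.single i 1) =
      2 * Real.cos (sineAngle L (k i)) * sineMode L k x := by
  classical
  have key : ∀ y : Fin d → ℤ, (∀ j, j ≠ i → y j = x j) →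
      sineMode L k y = sineFactor L (k i) (y i) *
        ∏ j ∈ Finset.univ.erase i, sineFactor L (k j) (x j) := fun y hy => by
    rw [sineMode, ← Finset.mul_prod_erase _ _ (Finset.mem_univ i)]
    congr 1
    exact Finset.prod_congr rfl fun j hj => by rw [hy j (Finset.ne_of_mem_erase hj)]
  rw [key _ (fun j hj => by simp [hj]), key _ (fun j hj => by simp [hj]),
    key x (fun _ _ => rfl), ← add_mul]
  simp only [Pi.add_apply, Pi.sub_apply, Pi.single_eq_same]
  rw [sineFactor_add_one_add_sub_one (mem_box.1 hx i)]
  ring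

lemma negLap_sineMode {k : Fin d → ℕ} {x : Fin d → ℤ} (hx : x ∈ box d L) :
    negLap (sineMode L k) x = 2 * modeEnergy L k * sineMode L k x := by
  unfold negLap modeEnergy
  rw [Finset.mul_sum, Finset.sum_mul]
  refine Finset.sum_congr rfl fun i _ => ?_
  have := sineMode_add_sub_single (k := k) hx i
  linarith

/-- The function on the box with sine coefficients `b`. -/
noncomputable def sineSum (L : ℕ) (b : (Fin d → ℕ) → ℝ) (x : Fin d → ℤ) : ℝ :=
  ((L + 1 : ℝ) ^ d)⁻¹ * ∑ k ∈ freqBox d L, b k * sineMode L k x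

lemma sineSum_eq_zero {b : (Fin d → ℕ) → ℝ} {x : Fin d → ℤ} (hx : x ∉ box d L) :
    sineSum L b x = 0 := by
  simp [sineSum, sineMode_eq_zero hx]

lemma negLap_sineSum (b : (Fin d → ℕ) → ℝ) {x : Fin d → ℤ} (hx : x ∈ box d L) :
    negLap (sineSum L b) x = sineSum L (fun k => 2 * modeEnergy L k * b k) x := by
  have h : negLap (sineSum L b) x = ((L + 1 : ℝ) ^ d)⁻¹ *
      ∑ k ∈ freqBox d L, b k * negLap (sineMode L k) x := by
    unfold negLap sineSum
    simp only [Finset.mul_sum]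
    rw [Finset.sum_comm]
    refine Finset.sum_congr rfl fun i _ => ?_
    rw [← Finset.sum_sub_distrib, ← Finset.sum_sub_distrib]
    exact Finset.sum_congr rfl fun k _ => by ring
  rw [h, sineSum]
  congr 1
  refine Finset.sum_congr rfl fun k _ => ?_
  rw [negLap_sineMode hx]; ring

/-- Parseval's identity. -/
lemma sum_sineSum_mul_sineSum (b c : (Fin d → ℕ) → ℝ) :
    ∑ x ∈ box d L, sineSum L b x * sineSum L c x =
      ((L + 1 : ℝ) ^ d)⁻¹ * ∑ k ∈ freqBox d L, b k * c k := by
  have hN : ((L + 1 : ℝ) ^ d) ≠ 0 := by positivity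
  calc ∑ x ∈ box d L, sineSum L b x * sineSum L c x
      = ∑ x ∈ box d L, ∑ k ∈ freqBox d L, ∑ l ∈ freqBox d L,
          ((L + 1 : ℝ) ^ d)⁻¹ * ((L + 1 : ℝ) ^ d)⁻¹ * b k * c l *
            (sineMode L k x * sineMode L l x) := by
        refine Finset.sum_congr rfl fun x _ => ?_
        unfold sineSum
        rw [mul_mul_mul_comm, Finset.sum_mul_sum, Finset.mul_sum]
        refine Finset.sum_congr rfl fun k _ => ?_
        rw [Finset.mul_sum]
        exact Finset.sum_congr rfl fun l _ => by ring
    _ = ∑ k ∈ freqBox d L, ∑ l ∈ freqBox d L,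
          ((L + 1 : ℝ) ^ d)⁻¹ * ((L + 1 : ℝ) ^ d)⁻¹ * b k * c l *
            ∑ x ∈ box d L, (sineMode L k x * sineMode L l x) := by
        rw [Finset.sum_comm]
        refine Finset.sum_congr rfl fun k _ => ?_
        rw [Finset.sum_comm]
        exact Finset.sum_congr rfl fun l _ => by rw [Finset.mul_sum]
    _ = _ := by
        rw [Finset.mul_sum]
        refine Finset.sum_congr rfl fun k hk => ?_
        rw [Finset.sum_eq_single k]
        · rw [sum_sineMode_site hk hk, if_pos rfl]; field_simp
        · intro l hl hlk
          rw [sum_sineMode_site hk hl, if_neg (Ne.symm hlk), mul_zero]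
        · exact fun h => absurd hk h

lemma sum_sineSum_mul_negLap (b : (Fin d → ℕ) → ℝ) :
    ∑ x ∈ box d L, sineSum L b x * negLap (sineSum L b) x =
      ((L + 1 : ℝ) ^ d)⁻¹ * ∑ k ∈ freqBox d L, 2 * modeEnergy L k * b k ^ 2 := by
  rw [Finset.sum_congr rfl fun x hx => by rw [negLap_sineSum b hx], sum_sineSum_mul_sineSum]
  congr 1
  exact Finset.sum_congr rfl fun k _ => by ring

/-- The sine series of the indicator of a point. -/
lemma sineSum_sineMode {u x : Fin d → ℤ} (hu : u ∈ box d L) (hx : x ∈ box d L) :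
    sineSum L (fun k => sineMode L k u) x = if u = x then 1 else 0 := by
  rw [sineSum, sum_sineMode_freq hu hx]
  split_ifs
  · exact inv_mul_cancel₀ (by positivity)
  · simp

/-- The eigenvalue of the simple random walk killed outside the box. -/
noncomputable def walkEigenvalue {d : ℕ} (L : ℕ) (k : Fin d → ℕ) : ℝ := 1 - modeEnergy L k / d

lemma walkEigenvalue_mul_sineMode (hd : 1 ≤ d) {k : Fin d → ℕ} {x : Fin d → ℤ}
    (hx : x ∈ box d L) : walkEigenvalue L k * sineMode L k x =
      (2 * (d : ℝ))⁻¹ *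
        ∑ i, (sineMode L k (x + Pi.single i 1) + sineMode L k (x - Pi.single i 1)) := by
  have hd0 : (d : ℝ) ≠ 0 := by positivity
  rw [Finset.sum_congr rfl fun i _ => sineMode_add_sub_single hx i, ← Finset.sum_mul,
    ← Finset.mul_sum, walkEigenvalue, modeEnergy, Finset.sum_sub_distrib]
  simp only [Finset.sum_const, Finset.card_univ, Fintype.card_fin, nsmul_eq_mul, mul_one]
  field_simp
  ring

/-- Powers of the killed random walk have finite range. -/
lemma sineSum_pow_eq_zero (hd : 1 ≤ d) {u : Fin d → ℤ} (hu : u ∈ box d L) (j : ℕ)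
    {x : Fin d → ℤ} (hx : ¬ ∀ i, |x i - u i| ≤ j) :
    sineSum L (fun k => walkEigenvalue L k ^ j * sineMode L k u) x = 0 := by
  induction j generalizing x with
  | zero =>
    by_cases hxL : x ∈ box d L
    · simp only [pow_zero, one_mul]
      rw [sineSum_sineMode hu hxL, if_neg]
      rintro rfl
      simp at hx
    · exact sineSum_eq_zero hxL
  | succ j ih =>
    by_cases hxL : x ∈ box d L
    · have h : sineSum L (fun k => walkEigenvalue L k ^ (j + 1) * sineMode L k u) x =
          (2 * (d : ℝ))⁻¹ * ∑ i : Fin d,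
            (sineSum L (fun k => walkEigenvalue L k ^ j * sineMode L k u) (x + Pi.single i 1) +
            sineSum L (fun k => walkEigenvalue L k ^ j * sineMode L k u) (x - Pi.single i 1)) := by
        simp only [sineSum, ← mul_add, ← Finset.mul_sum, ← Finset.sum_add_distrib]
        rw [mul_left_comm]
        congr 1
        rw [Finset.sum_comm, Finset.mul_sum]
        refine Finset.sum_congr rfl fun k _ => ?_
        rw [← Finset.mul_sum, mul_left_comm, ← walkEigenvalue_mul_sineMode hd hxL]
        ring
      rw [h, Finset.sum_eq_zero, mul_zero]
      intro i _
      push Not at hx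
      obtain ⟨l, hl⟩ := hx
      have hs : |(Pi.single i (1 : ℤ) : Fin d → ℤ) l| ≤ 1 := by
        by_cases h : l = i
        · subst h; simp
        · simp [h]
      rw [ih, ih, add_zero]
      · refine fun h => absurd (h l) (not_le.2 ?_)
        rw [Pi.sub_apply]
        push_cast at hl
        rw [abs_le] at hs
        rw [lt_abs] at hl ⊢
        omega
      · refine fun h => absurd (h l) (not_le.2 ?_)
        rw [Pi.add_apply]
        push_cast at hl
        rw [abs_le] at hs
        rw [lt_abs] at hl ⊢
        omega
    · exact sineSum_eq_zero hxL

/-- A polynomial of degree at most `D` in the killed random walk has range at most `D`. -/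
lemma sineSum_polynomial_eq_zero (hd : 1 ≤ d) {u : Fin d → ℤ} (hu : u ∈ box d L)
    (p : Polynomial ℝ) {D : ℕ} (hD : p.natDegree ≤ D) {x : Fin d → ℤ}
    (hx : ¬ ∀ i, |x i - u i| ≤ D) :
    sineSum L (fun k => p.eval (walkEigenvalue L k) * sineMode L k u) x = 0 := by
  have h : sineSum L (fun k => p.eval (walkEigenvalue L k) * sineMode L k u) x =
      ∑ j ∈ Finset.range (p.natDegree + 1), p.coeff j *
        sineSum L (fun k => walkEigenvalue L k ^ j * sineMode L k u) x := by
    unfold sineSum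
    simp only [Finset.mul_sum]
    rw [Finset.sum_comm]
    refine Finset.sum_congr rfl fun k _ => ?_
    rw [Polynomial.eval_eq_sum_range, Finset.sum_mul, Finset.sum_mul, Finset.mul_sum]
    exact Finset.sum_congr rfl fun j _ => by ring
  rw [h]
  refine Finset.sum_eq_zero fun j hj => ?_
  rw [Finset.mem_range] at hj
  rw [sineSum_pow_eq_zero hd hu j, mul_zero]
  refine fun h => hx fun i => (h i).trans ?_
  exact_mod_cast (by omega)

end Modes

/-! ### Spectral sums -/

lemma sum_inv_one_add_sq_le {a : ℝ} (ha : 0 < a) (M : ℕ) :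
    ∑ k ∈ Finset.Icc 1 M, (1 + a ^ 2 * (k : ℝ) ^ 2)⁻¹ ≤ 2 / a := by
  have h : ∑ k ∈ Finset.Icc 1 M, (1 + a ^ 2 * (k : ℝ) ^ 2)⁻¹ ≤ 2 / a * (1 - (1 + a * M)⁻¹) := by
    induction M with
    | zero => simp
    | succ M ih =>
      rw [Finset.sum_Icc_succ_top (by omega)]
      have h1 : (0 : ℝ) < 1 + a * M := by positivity
      have h2 : (0 : ℝ) < 1 + a * (M + 1 : ℕ) := by positivity
      have h3 : (1 + a * M)⁻¹ - (1 + a * (M + 1 : ℕ))⁻¹ =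
          a * ((1 + a * M) * (1 + a * (M + 1 : ℕ)))⁻¹ := by
        field_simp
        push_cast; ring
      have h4 : (1 + a ^ 2 * ((M + 1 : ℕ) : ℝ) ^ 2)⁻¹ ≤
          2 * ((1 + a * M) * (1 + a * (M + 1 : ℕ)))⁻¹ := by
        rw [← div_eq_mul_inv, inv_le_comm₀ (by positivity) (by positivity), inv_div,
          div_le_iff₀ two_pos]
        have h5 : (1 + a * M) * (1 + a * (M + 1 : ℕ)) ≤ (1 + a * (M + 1 : ℕ)) ^ 2 := by
          rw [pow_two]
          gcongr
          simp
        nlinarith [sq_nonneg (1 - a * ((M + 1 : ℕ) : ℝ))]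
      have h6 : 2 / a * ((1 + a * M)⁻¹ - (1 + a * (M + 1 : ℕ))⁻¹) =
          2 * ((1 + a * M) * (1 + a * (M + 1 : ℕ)))⁻¹ := by
        rw [h3]; field_simp
      rw [← h6] at h4
      calc _ ≤ 2 / a * (1 - (1 + a * M)⁻¹) +
            2 / a * ((1 + a * M)⁻¹ - (1 + a * (M + 1 : ℕ))⁻¹) := add_le_add ih h4
        _ = _ := by ring
  refine h.trans (mul_le_of_le_one_right (by positivity) ?_)
  have : (0 : ℝ) < (1 + a * M)⁻¹ := by positivity
  linarith

/-- The number of modes of energy at most `n⁻²` is of order `((L+1)/n)^d`, in a smoothed form. -/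
lemma sum_inv_one_add_modeEnergy_le {d L n : ℕ} (hd : 1 ≤ d) (hn : 1 ≤ n) :
    ((L + 1 : ℝ) ^ d)⁻¹ * ∑ k ∈ freqBox d L, ((1 + (n : ℝ) ^ 2 * (modeEnergy L k / d)) ^ d)⁻¹ ≤
      (4 * d / n) ^ d := by
  have hd0 : (1 : ℝ) ≤ d := by exact_mod_cast hd
  have hn0 : (0 : ℝ) < n := by exact_mod_cast hn
  set a : ℝ := n / (2 * d * (L + 1)) with ha
  have ha0 : 0 < a := by positivity
  have h1 : ∀ k ∈ freqBox d L, ((1 + (n : ℝ) ^ 2 * (modeEnergy L k / d)) ^ d)⁻¹ ≤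
      ∏ i, (1 + a ^ 2 * (k i : ℝ) ^ 2)⁻¹ := fun k hk => by
    rw [Finset.prod_inv_distrib]
    have hk' := hk
    unfold freqBox at hk'
    rw [Fintype.mem_piFinset] at hk'
    refine inv_anti₀ (Finset.prod_pos fun i _ => by positivity) ?_
    calc ∏ i : Fin d, (1 + a ^ 2 * (k i : ℝ) ^ 2)
        ≤ ∏ _i : Fin d, (1 + (n : ℝ) ^ 2 * (modeEnergy L k / d)) := by
          refine Finset.prod_le_prod (fun _ _ => by positivity) fun i _ => ?_
          have h2 : 1 - Real.cos (sineAngle L (k i)) ≤ modeEnergy L k :=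
            Finset.single_le_sum (f := fun i => 1 - Real.cos (sineAngle L (k i)))
              (fun i _ => by linarith [Real.cos_le_one (sineAngle L (k i))]) (Finset.mem_univ i)
          have h3 := two_div_pi_sq_mul_sq_le_one_sub_cos (sineAngle_nonneg L (k i))
            (sineAngle_le_pi (hk' i))
          have hpi := Real.pi_pos
          have h4 : 2 / Real.pi ^ 2 * sineAngle L (k i) ^ 2 =
              (k i : ℝ) ^ 2 / (2 * (L + 1) ^ 2) := by
            unfold sineAngle
            push_cast
            field_simp
          rw [h4] at h3
          have h5 : a ^ 2 * (k i : ℝ) ^ 2 ≤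
              (n : ℝ) ^ 2 * ((k i : ℝ) ^ 2 / (2 * (L + 1) ^ 2) / d) := by
            have h6 : a ^ 2 * (k i : ℝ) ^ 2 =
                (n : ℝ) ^ 2 * ((k i : ℝ) ^ 2 / (2 * (L + 1) ^ 2) / d) * (1 / (2 * d)) := by
              rw [ha]; field_simp
            rw [h6]
            refine mul_le_of_le_one_right (by positivity) ?_
            rw [div_le_one (by positivity)]; linarith
          have h7 : (n : ℝ) ^ 2 * ((k i : ℝ) ^ 2 / (2 * (L + 1) ^ 2) / d) ≤
              (n : ℝ) ^ 2 * (modeEnergy L k / d) := by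
            gcongr; exact h3.trans h2
          linarith
      _ = _ := by simp
  calc _ ≤ ((L + 1 : ℝ) ^ d)⁻¹ * ∑ k ∈ freqBox d L, ∏ i, (1 + a ^ 2 * (k i : ℝ) ^ 2)⁻¹ := by
        gcongr with k hk; exact h1 k hk
    _ = ((L + 1 : ℝ) ^ d)⁻¹ *
          (∑ k ∈ Finset.Icc 1 (2 * L + 1), (1 + a ^ 2 * (k : ℝ) ^ 2)⁻¹) ^ d := by
        unfold freqBox
        rw [Finset.sum_prod_piFinset (Finset.Icc 1 (2 * L + 1))
          (fun (_ : Fin d) (k : ℕ) => (1 + a ^ 2 * (k : ℝ) ^ 2)⁻¹)]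
        simp
    _ ≤ ((L + 1 : ℝ) ^ d)⁻¹ * (2 / a) ^ d := by
        gcongr
        exact sum_inv_one_add_sq_le ha0 _
    _ = _ := by
        rw [← inv_pow, ← mul_pow, ha]
        congr 1
        field_simp
        norm_num

/-! ### Fejér polynomials -/

open Polynomial in
/-- The Dirichlet kernel `1 + 2 ∑_{j ≤ i} cos (j θ)` as a polynomial in `cos θ`. -/
noncomputable def dirichletPoly (i : ℕ) : ℝ[X] :=
  1 + C 2 * ∑ j ∈ Finset.Icc 1 i, Chebyshev.T ℝ (j : ℤ)

open Polynomial in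
/-- The (unnormalized) Fejér kernel `(1 - cos (n θ)) / (1 - cos θ)` as a polynomial in `cos θ`. -/
noncomputable def fejerPoly (n : ℕ) : ℝ[X] := ∑ i ∈ Finset.range n, dirichletPoly i

open Polynomial in
/-- The `d`-th power of the normalized Fejér kernel: a polynomial of degree at most `d n` which is
`1` at `1` and decays like `(n² (1 - x))⁻ᵈ`. -/
noncomputable def smoothPoly (d n : ℕ) : ℝ[X] := (C ((n : ℝ) ^ 2)⁻¹ * fejerPoly n) ^ d

section Fejer

open Polynomial

lemma natDegree_fejerPoly_le (n : ℕ) : (fejerPoly n).natDegree ≤ n := by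
  refine natDegree_sum_le_of_forall_le _ _ fun i hi => ?_
  rw [Finset.mem_range] at hi
  refine (natDegree_add_le _ _).trans (max_le (by simp) ?_)
  refine (natDegree_C_mul_le _ _).trans (natDegree_sum_le_of_forall_le _ _ fun j hj => ?_)
  rw [Finset.mem_Icc] at hj
  rw [Chebyshev.natDegree_T]
  omega

lemma natDegree_smoothPoly_le (d n : ℕ) : (smoothPoly d n).natDegree ≤ d * n := by
  refine natDegree_pow_le.trans (Nat.mul_le_mul_left _ ?_)
  exact (natDegree_C_mul_le _ _).trans (natDegree_fejerPoly_le n)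

lemma one_sub_mul_eval_dirichletPoly (i : ℕ) (x : ℝ) :
    (1 - x) * (dirichletPoly i).eval x =
      (Chebyshev.T ℝ (i : ℤ)).eval x - (Chebyshev.T ℝ ((i : ℤ) + 1)).eval x := by
  induction i with
  | zero => simp [dirichletPoly]
  | succ i ih =>
    have h : dirichletPoly (i + 1) = dirichletPoly i + C 2 * Chebyshev.T ℝ ((i : ℤ) + 1) := by
      rw [dirichletPoly, Finset.sum_Icc_succ_top (by omega), mul_add, ← add_assoc, dirichletPoly]
      push_cast; rfl
    have hT := congrArg (eval x) (Chebyshev.T_add_two ℝ (i : ℤ))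
    simp only [eval_sub, eval_mul, eval_ofNat, eval_X] at hT
    rw [h, eval_add, mul_add, ih, eval_mul, eval_C]
    push_cast
    rw [show (i : ℤ) + 1 + 1 = i + 2 by ring, hT]
    ring

lemma one_sub_mul_eval_fejerPoly (n : ℕ) (x : ℝ) :
    (1 - x) * (fejerPoly n).eval x = 1 - (Chebyshev.T ℝ (n : ℤ)).eval x := by
  induction n with
  | zero => simp [fejerPoly]
  | succ n ih =>
    have h : fejerPoly (n + 1) = fejerPoly n + dirichletPoly n := Finset.sum_range_succ _ _
    rw [h, eval_add, mul_add, ih, one_sub_mul_eval_dirichletPoly]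
    push_cast; ring

lemma eval_fejerPoly (n : ℕ) (x : ℝ) : (fejerPoly n).eval x =
    ∑ i ∈ Finset.range n, (1 + 2 * ∑ j ∈ Finset.Icc 1 i, (Chebyshev.T ℝ (j : ℤ)).eval x) := by
  simp [fejerPoly, dirichletPoly, eval_finsetSum]

lemma sum_range_one_add_two_mul (n : ℕ) : ∑ i ∈ Finset.range n, (1 + 2 * (i : ℝ)) = (n : ℝ) ^ 2 := by
  induction n with
  | zero => simp
  | succ n ih => rw [Finset.sum_range_succ, ih]; push_cast; ring

lemma eval_fejerPoly_one (n : ℕ) : (fejerPoly n).eval 1 = (n : ℝ) ^ 2 := by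
  rw [eval_fejerPoly, ← sum_range_one_add_two_mul]
  simp

variable {x : ℝ}

lemma eval_T_le_one (n : ℕ) (hx : |x| ≤ 1) : (Chebyshev.T ℝ (n : ℤ)).eval x ≤ 1 :=
  (abs_le.1 (Chebyshev.abs_eval_T_real_le_one n hx)).2

lemma eval_fejerPoly_nonneg (n : ℕ) (hx : |x| ≤ 1) : 0 ≤ (fejerPoly n).eval x := by
  rcases eq_or_lt_of_le (abs_le.1 hx).2 with h | h
  · rw [h, eval_fejerPoly_one]; positivity
  · have h1 := one_sub_mul_eval_fejerPoly n x
    have h2 := eval_T_le_one n hx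
    have h3 : 0 ≤ (1 - x) * (fejerPoly n).eval x := by linarith
    exact nonneg_of_mul_nonneg_right h3 (by linarith)

lemma eval_fejerPoly_le (n : ℕ) (hx : |x| ≤ 1) : (fejerPoly n).eval x ≤ (n : ℝ) ^ 2 := by
  rw [eval_fejerPoly, ← sum_range_one_add_two_mul]
  refine Finset.sum_le_sum fun i _ => ?_
  have : ∑ j ∈ Finset.Icc 1 i, (Chebyshev.T ℝ (j : ℤ)).eval x ≤ ∑ j ∈ Finset.Icc 1 i, (1 : ℝ) :=
    Finset.sum_le_sum fun j _ => eval_T_le_one j hx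
  simp at this
  linarith

lemma sq_sub_eval_fejerPoly_le (n : ℕ) (hx : |x| ≤ 1) :
    (n : ℝ) ^ 2 - (fejerPoly n).eval x ≤ (n : ℝ) ^ 2 * ((n : ℝ) ^ 2 * (1 - x)) := by
  have hx1 : 0 ≤ 1 - x := by linarith [(abs_le.1 hx).2]
  have h1 : (n : ℝ) ^ 2 - (fejerPoly n).eval x =
      ∑ i ∈ Finset.range n, 2 * ∑ j ∈ Finset.Icc 1 i, (1 - (Chebyshev.T ℝ (j : ℤ)).eval x) := by
    rw [eval_fejerPoly, ← sum_range_one_add_two_mul, ← Finset.sum_sub_distrib]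
    refine Finset.sum_congr rfl fun i _ => ?_
    rw [Finset.sum_sub_distrib]
    simp
    ring
  rw [h1]
  calc ∑ i ∈ Finset.range n, 2 * ∑ j ∈ Finset.Icc 1 i, (1 - (Chebyshev.T ℝ (j : ℤ)).eval x)
      ≤ ∑ i ∈ Finset.range n, (1 + 2 * (i : ℝ)) * ((n : ℝ) ^ 2 * (1 - x)) := by
        refine Finset.sum_le_sum fun i hi => ?_
        rw [Finset.mem_range] at hi
        have h2 : ∑ j ∈ Finset.Icc 1 i, (1 - (Chebyshev.T ℝ (j : ℤ)).eval x) ≤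
            ∑ j ∈ Finset.Icc 1 i, (n : ℝ) ^ 2 * (1 - x) := by
          refine Finset.sum_le_sum fun j hj => ?_
          rw [Finset.mem_Icc] at hj
          rw [← one_sub_mul_eval_fejerPoly, mul_comm]
          refine mul_le_mul_of_nonneg_right ((eval_fejerPoly_le j hx).trans ?_) hx1
          have : (j : ℝ) ≤ n := by exact_mod_cast (by omega)
          gcongr
        simp only [Finset.sum_const, Nat.card_Icc, Nat.add_sub_cancel, nsmul_eq_mul] at h2
        have h3 : 0 ≤ (n : ℝ) ^ 2 * (1 - x) := by positivity
        linarith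
    _ = _ := by rw [← Finset.sum_mul, sum_range_one_add_two_mul]

lemma eval_smoothPoly (d n : ℕ) (x : ℝ) :
    (smoothPoly d n).eval x = (((n : ℝ) ^ 2)⁻¹ * (fejerPoly n).eval x) ^ d := by
  simp [smoothPoly]

lemma eval_smoothPoly_one {n : ℕ} (d : ℕ) (hn : 1 ≤ n) : (smoothPoly d n).eval 1 = 1 := by
  have hn0 : (0 : ℝ) < n := by exact_mod_cast hn
  rw [eval_smoothPoly, eval_fejerPoly_one, inv_mul_cancel₀ (by positivity), one_pow]

lemma smoothPoly_one (d : ℕ) (x : ℝ) : (smoothPoly d 1).eval x = 1 := by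
  simp [eval_smoothPoly, eval_fejerPoly]

lemma eval_smoothPoly_nonneg (d n : ℕ) (hx : |x| ≤ 1) : 0 ≤ (smoothPoly d n).eval x := by
  rw [eval_smoothPoly]
  have := eval_fejerPoly_nonneg n hx
  positivity

lemma inv_mul_eval_fejerPoly_le_one {n : ℕ} (hn : 1 ≤ n) (hx : |x| ≤ 1) :
    ((n : ℝ) ^ 2)⁻¹ * (fejerPoly n).eval x ≤ 1 := by
  have hn0 : (0 : ℝ) < n := by exact_mod_cast hn
  rw [inv_mul_le_iff₀ (by positivity), mul_one]
  exact eval_fejerPoly_le n hx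

lemma eval_smoothPoly_le_one {n : ℕ} (d : ℕ) (hn : 1 ≤ n) (hx : |x| ≤ 1) :
    (smoothPoly d n).eval x ≤ 1 := by
  rw [eval_smoothPoly]
  have := eval_fejerPoly_nonneg n hx
  exact pow_le_one₀ (by positivity) (inv_mul_eval_fejerPoly_le_one hn hx)

lemma one_sub_eval_smoothPoly_le {n : ℕ} (d : ℕ) (hn : 1 ≤ n) (hx : |x| ≤ 1) :
    1 - (smoothPoly d n).eval x ≤ d * ((n : ℝ) ^ 2 * (1 - x)) := by
  have hn0 : (0 : ℝ) < n := by exact_mod_cast hn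
  rw [eval_smoothPoly]
  set f := ((n : ℝ) ^ 2)⁻¹ * (fejerPoly n).eval x with hf
  have hf0 : 0 ≤ f := by have := eval_fejerPoly_nonneg n hx; positivity
  have h1 : 1 - f ≤ (n : ℝ) ^ 2 * (1 - x) := by
    have := sq_sub_eval_fejerPoly_le n hx
    have h2 : (n : ℝ) ^ 2 - (fejerPoly n).eval x = (n : ℝ) ^ 2 * (1 - f) := by
      rw [hf]; field_simp
    rw [h2] at this
    exact le_of_mul_le_mul_left this (by positivity)
  have h3 := one_add_mul_le_pow (a := f - 1) (by linarith) d
  rw [add_sub_cancel] at h3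
  have h4 : (d : ℝ) * (1 - f) ≤ d * ((n : ℝ) ^ 2 * (1 - x)) := by gcongr
  linarith

/-- Decay of the smoothing polynomial away from `1`. -/
lemma eval_smoothPoly_sq_mul_le {n : ℕ} (d : ℕ) (hn : 1 ≤ n) (hx : |x| ≤ 1) :
    (smoothPoly d n).eval x ^ 2 * (1 + (n : ℝ) ^ 2 * (1 - x)) ^ d ≤ 8 ^ d := by
  have hn0 : (0 : ℝ) < n := by exact_mod_cast hn
  have hx1 : 0 ≤ 1 - x := by linarith [(abs_le.1 hx).2]
  rw [eval_smoothPoly, ← pow_mul, mul_comm d 2, pow_mul, ← mul_pow]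
  set f := ((n : ℝ) ^ 2)⁻¹ * (fejerPoly n).eval x with hf
  have hf0 : 0 ≤ f := by have := eval_fejerPoly_nonneg n hx; positivity
  have hf1 : f ≤ 1 := inv_mul_eval_fejerPoly_le_one hn hx
  set s := (n : ℝ) ^ 2 * (1 - x) with hs
  have hs0 : 0 ≤ s := by positivity
  have hfs : f * s ≤ 2 := by
    have h1 := one_sub_mul_eval_fejerPoly n x
    have h2 := (abs_le.1 (Chebyshev.abs_eval_T_real_le_one n hx)).1
    have h3 : f * s = (1 - x) * (fejerPoly n).eval x := by rw [hf, hs]; field_simp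
    rw [h3]; linarith
  gcongr
  nlinarith [mul_nonneg hf0 hs0, mul_nonneg hf0 (sub_nonneg.2 hf1)]

/-- Bounds for the difference of the smoothing polynomials at the scales `n` and `2n`. -/
lemma eval_smoothPoly_sub_sq_mul_le {n : ℕ} {d : ℕ} (hd : 1 ≤ d) (hn : 1 ≤ n) (hx : |x| ≤ 1) :
    (smoothPoly d n - smoothPoly d (2 * n)).eval x ^ 2 * (1 + (n : ℝ) ^ 2 * (1 - x)) ^ d ≤
        32 * d ^ 2 * 8 ^ d ∧
    (smoothPoly d n - smoothPoly d (2 * n)).eval x ^ 2 * (1 + (n : ℝ) ^ 2 * (1 - x)) ^ d ≤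
        32 * d ^ 2 * 8 ^ d * ((n : ℝ) ^ 2 * (1 - x)) := by
  have hn0 : (0 : ℝ) < n := by exact_mod_cast hn
  have hd0 : (1 : ℝ) ≤ d := by exact_mod_cast hd
  have hx1 : 0 ≤ 1 - x := by linarith [(abs_le.1 hx).2]
  have hn2 : 1 ≤ 2 * n := by omega
  have a1 := eval_smoothPoly_sq_mul_le d hn hx
  have a2 := eval_smoothPoly_sq_mul_le d hn2 hx
  have b1 := one_sub_eval_smoothPoly_le d hn hx
  have b2 := one_sub_eval_smoothPoly_le d hn2 hx
  have c1 := eval_smoothPoly_nonneg d n hx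
  have c2 := eval_smoothPoly_nonneg d (2 * n) hx
  have e1 := eval_smoothPoly_le_one d hn hx
  have e2 := eval_smoothPoly_le_one d hn2 hx
  rw [eval_sub]
  set p := (smoothPoly d n).eval x
  set q := (smoothPoly d (2 * n)).eval x
  have hs4 : ((2 * n : ℕ) : ℝ) ^ 2 * (1 - x) = 4 * ((n : ℝ) ^ 2 * (1 - x)) := by push_cast; ring
  rw [hs4] at a2 b2
  set s := (n : ℝ) ^ 2 * (1 - x) with hs
  have hs0 : 0 ≤ s := by positivity
  have hp8 : (1 : ℝ) ≤ 8 ^ d := one_le_pow₀ (by norm_num)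
  have hd2 : (1 : ℝ) ≤ (d : ℝ) ^ 2 := one_le_pow₀ hd0
  have a2' : q ^ 2 * (1 + s) ^ d ≤ 8 ^ d := by
    refine le_trans ?_ a2
    gcongr
    linarith
  have hpq : (p - q) ^ 2 ≤ p ^ 2 + q ^ 2 := by nlinarith [mul_nonneg c1 c2]
  have hA : (p - q) ^ 2 * (1 + s) ^ d ≤ 2 * 8 ^ d := by
    calc _ ≤ (p ^ 2 + q ^ 2) * (1 + s) ^ d := by gcongr
      _ ≤ _ := by rw [add_mul]; linarith
  have hA' : (2 : ℝ) * 8 ^ d ≤ 32 * d ^ 2 * 8 ^ d := by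
    refine mul_le_mul_of_nonneg_right ?_ (by positivity)
    linarith
  refine ⟨hA.trans hA', ?_⟩
  rcases le_total s 1 with h | h
  · have h1 : |p - q| ≤ 4 * d * s := by
      rw [abs_le]
      constructor
      · nlinarith [mul_nonneg (by linarith : (0:ℝ) ≤ d) hs0]
      · nlinarith [mul_nonneg (by linarith : (0:ℝ) ≤ d) hs0]
    have h2 : (p - q) ^ 2 ≤ 16 * d ^ 2 * s := by
      rw [← sq_abs]
      calc |p - q| ^ 2 ≤ (4 * d * s) ^ 2 := by gcongr
        _ = 16 * d ^ 2 * (s * s) := by ring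
        _ ≤ 16 * d ^ 2 * (s * 1) := by gcongr
        _ = _ := by ring
    calc (p - q) ^ 2 * (1 + s) ^ d ≤ (16 * d ^ 2 * s) * 8 ^ d := by
          gcongr
          linarith
      _ ≤ _ := by
          have : 0 ≤ (d : ℝ) ^ 2 * s * 8 ^ d := by positivity
          nlinarith
  · calc _ ≤ 32 * (d : ℝ) ^ 2 * 8 ^ d * 1 := by rw [mul_one]; exact hA.trans hA'
      _ ≤ _ := by gcongr

/-- A polynomial multiplied by `1 - X`: the quotient of the difference of two polynomials that are
`1` at `1`. -/
lemma exists_eval_eq_one_sub_mul {p : ℝ[X]} (hp : p.eval 1 = 0) {D : ℕ} (hD : p.natDegree ≤ D) :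
    ∃ h : ℝ[X], h.natDegree ≤ D ∧ ∀ x, p.eval x = (1 - x) * h.eval x := by
  refine ⟨-(p /ₘ (X - C 1)), ?_, fun x => ?_⟩
  · rw [natDegree_neg, natDegree_divByMonic _ (monic_X_sub_C 1)]
    omega
  · have h := congrArg (eval x) (mul_divByMonic_eq_iff_isRoot.2 (show IsRoot p 1 from hp))
    simp only [eval_mul, eval_sub, eval_X, eval_C] at h
    rw [eval_neg, ← h]
    ring

end Fejer

/-! ### Tails of spectrally localized pieces of the surface -/

lemma HasTail.mono {Ω : Type u} [MeasurableSpace Ω] {P : Measure Ω} [IsProbabilityMeasure P]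
    {β C c a a' C' : ℝ} {Z Z' : Ω → ℝ} (h : HasTail P β C c Z a) (ha : a ≤ a') (hC : C ≤ C')
    (hZ : ∀ᵐ ω ∂P, Z' ω ≤ Z ω) : HasTail P β C' c Z' a' := by
  intro t ht
  have hsub : {ω | t * a' < Z' ω} ≤ᵐ[P] ({ω | t * a < Z ω} : Set Ω) := by
    filter_upwards [hZ] with ω hω h1
    change _ < _ at h1
    change _ < _
    exact ((mul_le_mul_of_nonneg_left ha ht.le).trans_lt h1).trans_le hω
  calc _ ≤ P.real {ω | t * a < Z ω} :=
        ENNReal.toReal_mono (measure_ne_top _ _) (measure_mono_ae hsub)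
    _ ≤ C * Real.exp (-c * t ^ β) := h t ht
    _ ≤ _ := by gcongr

lemma HasTail.add {Ω : Type u} [MeasurableSpace Ω] {P : Measure Ω} [IsProbabilityMeasure P]
    {β C c a a' C' : ℝ} {Z Z' : Ω → ℝ} (h : HasTail P β C c Z a) (h' : HasTail P β C' c Z' a') :
    HasTail P β (C + C') c (fun ω => Z ω + Z' ω) (a + a') := by
  intro t ht
  have hsub : {ω | t * (a + a') < Z ω + Z' ω} ⊆ {ω | t * a < Z ω} ∪ {ω | t * a' < Z' ω} := by
    intro ω hω
    by_contra hcon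
    have h1 : ¬ (t * a < Z ω) := fun h => hcon (Or.inl h)
    have h2 : ¬ (t * a' < Z' ω) := fun h => hcon (Or.inr h)
    have h3 : t * (a + a') < Z ω + Z' ω := hω
    push Not at h1 h2
    linarith
  calc _ ≤ _ := measureReal_mono hsub
    _ ≤ _ := measureReal_union_le _ _
    _ ≤ _ := by rw [add_mul]; exact add_le_add (h t ht) (h' t ht)

section Pieces

variable {d L : ℕ}

lemma modeEnergy_pos (hd : 1 ≤ d) {k : Fin d → ℕ} (hk : k ∈ freqBox d L) : 0 < modeEnergy L k :=
  lt_of_lt_of_le (by positivity) (le_modeEnergy hd hk)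

lemma sineSum_congr {b c : (Fin d → ℕ) → ℝ} (h : ∀ k ∈ freqBox d L, b k = c k) (x : Fin d → ℤ) :
    sineSum L b x = sineSum L c x := by
  unfold sineSum
  rw [Finset.sum_congr rfl fun k hk => by rw [h k hk]]

lemma sineSum_sub (b c : (Fin d → ℕ) → ℝ) (x : Fin d → ℤ) :
    sineSum L (fun k => b k - c k) x = sineSum L b x - sineSum L c x := by
  simp only [sineSum, sub_mul, Finset.sum_sub_distrib, mul_sub]

/-- The vector-valued linear statistic of a surface with sine coefficients `c`. -/
noncomputable def sineStat {n : ℕ} (L : ℕ) (c : (Fin d → ℕ) → ℝ) (φ : Surface d n) :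
    EuclideanSpace ℝ (Fin n) :=
  ∑ x ∈ box d L, sineSum L c x • φ x

lemma sineStat_sub {n : ℕ} (b c : (Fin d → ℕ) → ℝ) (φ : Surface d n) :
    sineStat L (fun k => b k - c k) φ = sineStat L b φ - sineStat L c φ := by
  simp only [sineStat, sineSum_sub, sub_smul, Finset.sum_sub_distrib]

lemma sineStat_sum {n : ℕ} {ι : Type*} (s : Finset ι) (b : ι → (Fin d → ℕ) → ℝ)
    (φ : Surface d n) :
    sineStat L (fun k => ∑ i ∈ s, b i k) φ = ∑ i ∈ s, sineStat L (b i) φ := by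
  simp only [sineStat]
  rw [Finset.sum_comm]
  refine Finset.sum_congr rfl fun x _ => ?_
  rw [← Finset.sum_smul]
  congr 1
  simp only [sineSum, Finset.sum_mul]
  rw [Finset.sum_comm, Finset.mul_sum]

lemma sineStat_sineMode {n : ℕ} {φ : Surface d n} (hφ : φ ∈ configSpace (box d L) 0)
    (u : Fin d → ℤ) : sineStat L (fun k => sineMode L k u) φ = φ u := by
  by_cases hu : u ∈ box d L
  · rw [sineStat, Finset.sum_congr rfl fun x hx => by rw [sineSum_sineMode hu hx]]
    simp [hu]
  · rw [hφ u hu]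
    simp [sineStat, sineSum, sineMode_eq_zero hu]

variable {n : ℕ} {Ω : Type u} [MeasurableSpace Ω] {P : Measure Ω} [IsProbabilityMeasure P]
  [MeasurableSpace (Environment d n)] {η : Ω → Environment d n} {lam : ℝ}

/-- A linear statistic whose coefficients sit at the energy scale `N⁻²`, and whose potential
is supported in a box of side of order `N`, lives on the scale `e √F N^((χ-d)/2)`. -/
lemma hasTail_sineStat {χ F α K κ : ℝ} (hd : 1 ≤ d) (hlam : 0 < lam) (hF : 0 < F)
    (hη : IsDisorder P η) (hE : ExiMin P η) (hStat : Stat P η)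
    (hconc : ChiConc P η lam L χ F α K κ) {φ : Ω → Surface d n}
    (hφ : ∀ᵐ ω ∂P, IsGroundConfig (η ω) lam (box d L) 0 (φ ω))
    {N : ℕ} (hN : 1 ≤ N) {e E₀ : ℝ} (he : 0 < e) (hE₀ : 0 < E₀) {c : (Fin d → ℕ) → ℝ}
    (hc : ∀ k ∈ freqBox d L, c k ^ 2 * (1 + (N : ℝ) ^ 2 * (modeEnergy L k / d)) ^ d ≤
      E₀ * e ^ 2 * (2 * modeEnergy L k))
    (hsupp : ∃ ℓ : ℕ, N ≤ ℓ ∧ ℓ ≤ (2 * d + 1) * N ∧ ℓ ≤ L ∧ ∃ v ∈ box d L,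
      ∀ x ∉ localBox d L ℓ v, sineSum L (fun k => c k / (2 * modeEnergy L k)) x = 0) :
    HasTail P (2 * α) (4 * n * K) κ (fun ω => ‖sineStat L c (φ ω)‖)
      (2 * n * √((2 * d + 1) ^ |χ| * E₀ * (4 * d) ^ d) *
        (√F * (e * (N : ℝ) ^ ((χ - d) / 2)))) := by
  obtain ⟨ℓ, hNℓ, hℓN, hℓL, v, hv, hg⟩ := hsupp
  have hN0 : (0 : ℝ) < N := by exact_mod_cast hN
  have hd0 : (0 : ℝ) < d := by exact_mod_cast hd
  set g := sineSum L (fun k => c k / (2 * modeEnergy L k)) with hgdef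
  have hlap : ∀ x ∈ box d L, negLap g x = sineSum L c x := fun x hx => by
    rw [hgdef, negLap_sineSum _ hx]
    refine sineSum_congr (fun k hk => ?_) x
    have := modeEnergy_pos hd hk
    field_simp
  set B := E₀ * e ^ 2 * (4 * d / N) ^ d with hB
  have hB0 : 0 < B := by positivity
  have hen : ∑ x ∈ box d L, g x * negLap g x ≤ B := by
    rw [hgdef, sum_sineSum_mul_negLap]
    calc ((L + 1 : ℝ) ^ d)⁻¹ * ∑ k ∈ freqBox d L,
          2 * modeEnergy L k * (c k / (2 * modeEnergy L k)) ^ 2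
        ≤ ((L + 1 : ℝ) ^ d)⁻¹ * ∑ k ∈ freqBox d L,
          E₀ * e ^ 2 * ((1 + (N : ℝ) ^ 2 * (modeEnergy L k / d)) ^ d)⁻¹ := by
          refine mul_le_mul_of_nonneg_left (Finset.sum_le_sum fun k hk => ?_) (by positivity)
          have hpos := modeEnergy_pos hd hk
          have h1 : 2 * modeEnergy L k * (c k / (2 * modeEnergy L k)) ^ 2 =
            c k ^ 2 / (2 * modeEnergy L k) := by field_simp
          rw [h1, ← div_eq_mul_inv, div_le_div_iff₀ (by positivity) (by positivity)]
          exact hc k hk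
      _ = E₀ * e ^ 2 * (((L + 1 : ℝ) ^ d)⁻¹ * ∑ k ∈ freqBox d L,
          ((1 + (N : ℝ) ^ 2 * (modeEnergy L k / d)) ^ d)⁻¹) := by
          rw [← Finset.mul_sum]; ring
      _ ≤ B := by
          rw [hB]
          gcongr
          exact sum_inv_one_add_modeEnergy_le hd hN
  have htail := hasTail_negLap hlam hF hη hE hStat hconc hφ (hN.trans hNℓ) hℓL hv hg hB0 hen
  refine htail.mono ?_ le_rfl (Filter.Eventually.of_forall fun ω => le_of_eq ?_)
  · have hℓ0 : (0 : ℝ) < ℓ := by exact_mod_cast hN.trans hNℓ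
    have hℓ1 : (ℓ : ℝ) / N ≤ 2 * d + 1 := by
      rw [div_le_iff₀ hN0]; exact_mod_cast hℓN
    have hℓ2 : 1 ≤ (ℓ : ℝ) / N := by
      rw [one_le_div hN0]; exact_mod_cast hNℓ
    have h1 : (ℓ : ℝ) ^ χ ≤ (2 * d + 1) ^ |χ| * (N : ℝ) ^ χ := by
      have h2 : (ℓ : ℝ) = ℓ / N * N := by field_simp
      rw [h2, Real.mul_rpow (by positivity) hN0.le]
      gcongr
      calc ((ℓ : ℝ) / N) ^ χ ≤ ((ℓ : ℝ) / N) ^ |χ| :=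
            Real.rpow_le_rpow_of_exponent_le hℓ2 (le_abs_self _)
        _ ≤ _ := Real.rpow_le_rpow (by positivity) hℓ1 (abs_nonneg _)
    have h3 : (N : ℝ) ^ ((χ - d) / 2) * (N : ℝ) ^ ((χ - d) / 2) = (N : ℝ) ^ χ / (N : ℝ) ^ d := by
      rw [← Real.rpow_add hN0, add_halves, Real.rpow_sub hN0, Real.rpow_natCast]
    have h4 : F * (ℓ : ℝ) ^ χ * B ≤ ((2 * d + 1) ^ |χ| * E₀ * (4 * d) ^ d) *
        (F * (e * (N : ℝ) ^ ((χ - d) / 2)) ^ 2) := by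
      calc F * (ℓ : ℝ) ^ χ * B ≤ F * ((2 * d + 1) ^ |χ| * (N : ℝ) ^ χ) * B := by gcongr
        _ = _ := by
          have h5 : (e * (N : ℝ) ^ ((χ - d) / 2)) ^ 2 =
              e ^ 2 * ((N : ℝ) ^ ((χ - d) / 2) * (N : ℝ) ^ ((χ - d) / 2)) := by ring
          rw [h5, h3, hB, div_pow]
          ring
    rw [mul_assoc (2 * (n : ℝ))]
    refine mul_le_mul_of_nonneg_left ?_ (by positivity)
    refine (Real.sqrt_le_sqrt h4).trans (le_of_eq ?_)
    rw [Real.sqrt_mul (by positivity), Real.sqrt_mul hF.le, Real.sqrt_sq (by positivity)]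
  · simp only [sineStat]
    rw [Finset.sum_congr rfl fun x hx => by rw [← hlap x hx]]

end Pieces

/-! ### Multiscale decomposition of increments -/

open Polynomial in
/-- The spectral multiplier of the `k`-th dyadic scale; the coarsest scale `K` collects the whole
remaining low-frequency part. -/
noncomputable def scalePoly (d K k : ℕ) : ℝ[X] :=
  if k < K then smoothPoly d (2 ^ k) - smoothPoly d (2 * 2 ^ k) else smoothPoly d (2 ^ K)

lemma sum_eval_scalePoly (d K : ℕ) (x : ℝ) :
    ∑ k ∈ Finset.range (K + 1), (scalePoly d K k).eval x = 1 := by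
  rw [Finset.sum_range_succ]
  have h : ∀ k ∈ Finset.range K, (scalePoly d K k).eval x =
      (smoothPoly d (2 ^ k)).eval x - (smoothPoly d (2 ^ (k + 1))).eval x := fun k hk => by
    rw [scalePoly, if_pos (Finset.mem_range.1 hk), Polynomial.eval_sub, pow_succ']
  rw [Finset.sum_congr rfl h, Finset.sum_range_sub' (fun k => (smoothPoly d (2 ^ k)).eval x),
    scalePoly, if_neg (lt_irrefl _), pow_zero, smoothPoly_one]
  ring

section Multipliers

variable {d L : ℕ}

lemma one_sub_walkEigenvalue (k : Fin d → ℕ) : 1 - walkEigenvalue L k = modeEnergy L k / d := by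
  rw [walkEigenvalue]; ring

lemma abs_walkEigenvalue_le_one (hd : 1 ≤ d) (k : Fin d → ℕ) : |walkEigenvalue L k| ≤ 1 := by
  have hd0 : (0 : ℝ) < d := by exact_mod_cast hd
  have h1 : 0 ≤ modeEnergy L k / d := div_nonneg (modeEnergy_nonneg k) hd0.le
  have h2 : modeEnergy L k / d ≤ 2 := by rw [div_le_iff₀ hd0]; exact modeEnergy_le k
  rw [walkEigenvalue, abs_le]
  constructor <;> linarith

/-- The multiplier of the scale `2^k` is bounded, vanishes linearly at the bottom of the spectrum
(for the coarsest scale this is the spectral gap of the box), and decays on energies above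
`4⁻ᵏ`. -/
lemma eval_scalePoly_sq_mul_le {K k : ℕ} (hd : 1 ≤ d) (hL : L < 2 ^ (K + 1)) (hk : k ≤ K)
    {f : Fin d → ℕ} (hf : f ∈ freqBox d L) :
    (scalePoly d K k).eval (walkEigenvalue L f) ^ 2 *
      (1 + ((2 ^ k : ℕ) : ℝ) ^ 2 * (modeEnergy L f / d)) ^ d ≤ 32 * d ^ 2 * 8 ^ d ∧
    (scalePoly d K k).eval (walkEigenvalue L f) ^ 2 *
      (1 + ((2 ^ k : ℕ) : ℝ) ^ 2 * (modeEnergy L f / d)) ^ d ≤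
        32 * d ^ 2 * 8 ^ d * (((2 ^ k : ℕ) : ℝ) ^ 2 * (modeEnergy L f / d)) := by
  have hx := abs_walkEigenvalue_le_one (L := L) hd f
  have hN : 1 ≤ 2 ^ k := Nat.one_le_two_pow
  rw [← one_sub_walkEigenvalue]
  unfold scalePoly
  split_ifs with h
  · exact eval_smoothPoly_sub_sq_mul_le hd hN hx
  · obtain rfl : k = K := by omega
    have h1 := eval_smoothPoly_sq_mul_le d hN hx
    have hd0 : (1 : ℝ) ≤ d := by exact_mod_cast hd
    have hd2 : (1 : ℝ) ≤ (d : ℝ) ^ 2 := one_le_pow₀ hd0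
    have hp8 : (0 : ℝ) < 8 ^ d := by positivity
    have h2 : 1 / (32 * (d : ℝ)) ≤ ((2 ^ k : ℕ) : ℝ) ^ 2 * (1 - walkEigenvalue L f) := by
      rw [one_sub_walkEigenvalue]
      have h3 := le_modeEnergy hd hf
      have h4 : (L + 1 : ℝ) ≤ 2 * (2 ^ k : ℕ) := by
        have : L + 1 ≤ 2 * 2 ^ k := by rw [← pow_succ']; omega
        exact_mod_cast this
      have h5 : (0 : ℝ) < (2 ^ k : ℕ) := by positivity
      calc 1 / (32 * (d : ℝ)) ≤ ((2 ^ k : ℕ) : ℝ) ^ 2 *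
            (1 / (2 * (2 * ((2 ^ k : ℕ) : ℝ)) ^ 2) / d) := by
            field_simp
            norm_num
        _ ≤ ((2 ^ k : ℕ) : ℝ) ^ 2 * (1 / (2 * (L + 1 : ℝ) ^ 2) / d) := by gcongr
        _ ≤ _ := by gcongr
    refine ⟨h1.trans ?_, h1.trans ?_⟩
    · nlinarith
    · calc (8 : ℝ) ^ d ≤ 32 * d ^ 2 * 8 ^ d * (1 / (32 * d)) := by
            have : 32 * (d : ℝ) ^ 2 * 8 ^ d * (1 / (32 * d)) = d * 8 ^ d := by field_simp
            rw [this]; nlinarith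
        _ ≤ _ := by gcongr

/-- The potential of a single-site piece at a fine scale has finite range. -/
lemma sineSum_scalePoly_eq_zero {K k : ℕ} (hd : 1 ≤ d) (hk : k < K) (u : Fin d → ℤ)
    {x : Fin d → ℤ} (hx : ¬ ∀ i, |x i - u i| ≤ ((2 * d * 2 ^ k : ℕ) : ℤ)) :
    sineSum L (fun f => (scalePoly d K k).eval (walkEigenvalue L f) * sineMode L f u /
      (2 * modeEnergy L f)) x = 0 := by
  by_cases hu : u ∈ box d L
  · have hd0 : (d : ℝ) ≠ 0 := by positivity
    have hN : 1 ≤ 2 ^ k := Nat.one_le_two_pow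
    have hp : (scalePoly d K k).eval 1 = 0 := by
      rw [scalePoly, if_pos hk, Polynomial.eval_sub, eval_smoothPoly_one d hN,
        eval_smoothPoly_one d (by omega), sub_self]
    have hdeg : (scalePoly d K k).natDegree ≤ 2 * d * 2 ^ k := by
      rw [scalePoly, if_pos hk]
      refine (Polynomial.natDegree_sub_le _ _).trans (max_le ?_ ?_)
      · refine (natDegree_smoothPoly_le _ _).trans ?_
        nlinarith
      · refine (natDegree_smoothPoly_le _ _).trans (le_of_eq (by ring))
    obtain ⟨h, hh, hph⟩ := exists_eval_eq_one_sub_mul hp hdeg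
    have h0 := sineSum_polynomial_eq_zero hd hu h hh hx
    have h1 : sineSum L (fun f => (scalePoly d K k).eval (walkEigenvalue L f) * sineMode L f u /
        (2 * modeEnergy L f)) x =
        sineSum L (fun f => (2 * (d : ℝ))⁻¹ * (h.eval (walkEigenvalue L f) * sineMode L f u)) x := by
      refine sineSum_congr (fun f hf => ?_) x
      have := modeEnergy_pos hd hf
      rw [hph, one_sub_walkEigenvalue]
      field_simp
    have h2 : sineSum L (fun f => (2 * (d : ℝ))⁻¹ *
        (h.eval (walkEigenvalue L f) * sineMode L f u)) x = (2 * (d : ℝ))⁻¹ *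
        sineSum L (fun f => h.eval (walkEigenvalue L f) * sineMode L f u) x := by
      unfold sineSum
      rw [mul_left_comm, Finset.mul_sum (a := (2 * (d : ℝ))⁻¹)]
      simp only [mul_assoc]
    rw [h1, h2, h0, mul_zero]
  · simp [sineSum, sineMode_eq_zero hu]

/-- Choice of the local box: one centred at `u`, or the whole box if that would stick out. -/
lemma exists_localBox {N D : ℕ} {u : Fin d → ℤ} (hu : u ∈ box d L) (hNL : N ≤ L) (hND : N ≤ D)
    (hD : D ≤ (2 * d + 1) * N) {b : (Fin d → ℕ) → ℝ}
    (hb : ∀ x, ¬ (∀ i, |x i - u i| ≤ (D : ℤ)) → sineSum L b x = 0) :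
    ∃ ℓ : ℕ, N ≤ ℓ ∧ ℓ ≤ (2 * d + 1) * N ∧ ℓ ≤ L ∧ ∃ v ∈ box d L,
      ∀ x ∉ localBox d L ℓ v, sineSum L b x = 0 := by
  by_cases h : D ≤ L
  · refine ⟨D, hND, hD, h, u, hu, fun x hx => ?_⟩
    rw [mem_localBox, not_and_or] at hx
    rcases hx with hx | hx
    · exact hb x hx
    · exact sineSum_eq_zero hx
  · refine ⟨L, hNL, by omega, le_rfl, 0, zero_mem_box d L, fun x hx => sineSum_eq_zero fun h => ?_⟩
    exact hx (mem_localBox.2 ⟨by simpa using mem_box.1 h, h⟩)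

lemma exists_localBox_of_lt {N : ℕ} (hd : 1 ≤ d) (hNL : N ≤ L) (hN : L < 2 * N)
    (b : (Fin d → ℕ) → ℝ) :
    ∃ ℓ : ℕ, N ≤ ℓ ∧ ℓ ≤ (2 * d + 1) * N ∧ ℓ ≤ L ∧ ∃ v ∈ box d L,
      ∀ x ∉ localBox d L ℓ v, sineSum L b x = 0 := by
  refine ⟨L, hNL, by nlinarith, le_rfl, 0, zero_mem_box d L, fun x hx =>
    sineSum_eq_zero fun h => ?_⟩
  exact hx (mem_localBox.2 ⟨by simpa using mem_box.1 h, h⟩)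

lemma sub_eq_sum_pieces {n : ℕ} {φ : Surface d n} (hφ : φ ∈ configSpace (box d L) 0) (M : ℕ)
    (u w : Fin d → ℤ) : φ u - φ w = ∑ k ∈ Finset.range (M + 1), sineStat L (fun f =>
      (scalePoly d M k).eval (walkEigenvalue L f) * sineMode L f u -
      (scalePoly d M k).eval (walkEigenvalue L f) * sineMode L f w) φ := by
  rw [← sineStat_sum, ← sineStat_sineMode hφ u, ← sineStat_sineMode hφ w, ← sineStat_sub]
  congr 1
  funext f
  rw [Finset.sum_sub_distrib, ← Finset.sum_mul, ← Finset.sum_mul, sum_eval_scalePoly, one_mul,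
    one_mul]

end Multipliers

section Increments

variable {d L n : ℕ} {Ω : Type u} [MeasurableSpace Ω] {P : Measure Ω} [IsProbabilityMeasure P]
  [MeasurableSpace (Environment d n)] {η : Ω → Environment d n} {lam : ℝ}

/-- The constant in the tail bounds of the pieces. -/
noncomputable def pieceConst (d n : ℕ) (χ : ℝ) : ℝ :=
  2 * n * √((2 * d + 1) ^ |χ| * (32 * d ^ 2 * 8 ^ d * d * Real.pi ^ 2) * (4 * d) ^ d)

lemma hasTail_piece_site {χ F α K κ : ℝ} (hd : 1 ≤ d) (hlam : 0 < lam) (hF : 0 < F)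
    (hη : IsDisorder P η) (hE : ExiMin P η) (hStat : Stat P η)
    (hconc : ChiConc P η lam L χ F α K κ) {φ : Ω → Surface d n}
    (hφ : ∀ᵐ ω ∂P, IsGroundConfig (η ω) lam (box d L) 0 (φ ω))
    {M k : ℕ} (hLM : 2 ^ M ≤ L) (hL : L < 2 ^ (M + 1)) (hk : k ≤ M) (u : Fin d → ℤ) :
    HasTail P (2 * α) (4 * n * K) κ (fun ω => ‖sineStat L (fun f =>
      (scalePoly d M k).eval (walkEigenvalue L f) * sineMode L f u) (φ ω)‖)
      (pieceConst d n χ *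
        (√F * (((2 ^ k : ℕ) : ℝ) * ((2 ^ k : ℕ) : ℝ) ^ ((χ - d) / 2)))) := by
  have hN : 1 ≤ 2 ^ k := Nat.one_le_two_pow
  have hkM : 2 ^ k ≤ 2 ^ M := Nat.pow_le_pow_right (by norm_num) hk
  have hd0 : (1 : ℝ) ≤ d := by exact_mod_cast hd
  have hpi : 1 ≤ Real.pi ^ 2 := one_le_pow₀ (by linarith [Real.pi_gt_three])
  refine hasTail_sineStat hd hlam hF hη hE hStat hconc hφ hN (by positivity) (by positivity) ?_ ?_
  · intro f hf
    have h1 := (eval_scalePoly_sq_mul_le hd hL hk hf).2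
    have h2 : sineMode L f u ^ 2 ≤ 1 := by
      rw [← sq_abs]; exact pow_le_one₀ (abs_nonneg _) (abs_sineMode_le_one f u)
    have hm := modeEnergy_nonneg (L := L) f
    set p := (scalePoly d M k).eval (walkEigenvalue L f)
    set N : ℝ := ((2 ^ k : ℕ) : ℝ)
    calc (p * sineMode L f u) ^ 2 * (1 + N ^ 2 * (modeEnergy L f / d)) ^ d
        = (p ^ 2 * (1 + N ^ 2 * (modeEnergy L f / d)) ^ d) * sineMode L f u ^ 2 := by ring
      _ ≤ 32 * d ^ 2 * 8 ^ d * (N ^ 2 * (modeEnergy L f / d)) * 1 := by gcongr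
      _ ≤ 32 * d ^ 2 * 8 ^ d * (N ^ 2 * (modeEnergy L f / 1)) * 1 := by gcongr
      _ = (32 * d ^ 2 * 8 ^ d * 1 * 1) * N ^ 2 * (1 * modeEnergy L f) := by ring
      _ ≤ _ := by gcongr; norm_num
  · by_cases hkM' : k < M
    · by_cases hu : u ∈ box d L
      · exact exists_localBox (D := 2 * d * 2 ^ k) hu (hkM.trans hLM) (by nlinarith) (by nlinarith)
          fun x hx => sineSum_scalePoly_eq_zero hd hkM' u hx
      · exact exists_localBox (D := 2 ^ k) (zero_mem_box d L) (hkM.trans hLM) le_rfl (by nlinarith)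
          fun x hx => by simp [sineSum, sineMode_eq_zero hu]
    · obtain rfl : k = M := by omega
      exact exists_localBox_of_lt hd hLM (by rw [← pow_succ']; exact hL) _

lemma hasTail_piece_pair {χ F α K κ : ℝ} (hd : 1 ≤ d) (hlam : 0 < lam) (hF : 0 < F)
    (hη : IsDisorder P η) (hE : ExiMin P η) (hStat : Stat P η)
    (hconc : ChiConc P η lam L χ F α K κ) {φ : Ω → Surface d n}
    (hφ : ∀ᵐ ω ∂P, IsGroundConfig (η ω) lam (box d L) 0 (φ ω))
    {M k : ℕ} (hLM : 2 ^ M ≤ L) (hL : L < 2 ^ (M + 1)) (hk : k ≤ M) {u w : Fin d → ℤ}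
    (hu : u ∈ box d L) {m : ℕ} (hm : 1 ≤ m) (hmk : m ≤ 2 ^ k) (huw : ∀ i, |u i - w i| ≤ (m : ℤ)) :
    HasTail P (2 * α) (4 * n * K) κ (fun ω => ‖sineStat L (fun f =>
      (scalePoly d M k).eval (walkEigenvalue L f) * sineMode L f u -
      (scalePoly d M k).eval (walkEigenvalue L f) * sineMode L f w) (φ ω)‖)
      (pieceConst d n χ * (√F * ((m : ℝ) * ((2 ^ k : ℕ) : ℝ) ^ ((χ - d) / 2)))) := by
  have hN : 1 ≤ 2 ^ k := Nat.one_le_two_pow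
  have hkM : 2 ^ k ≤ 2 ^ M := Nat.pow_le_pow_right (by norm_num) hk
  have hd0 : (1 : ℝ) ≤ d := by exact_mod_cast hd
  have hm0 : (0 : ℝ) < m := by exact_mod_cast hm
  have hpi : 0 < Real.pi := Real.pi_pos
  refine hasTail_sineStat hd hlam hF hη hE hStat hconc hφ hN hm0 (by positivity) ?_ ?_
  · intro f hf
    have h1 := (eval_scalePoly_sq_mul_le hd hL hk hf).1
    have h2 := sineMode_sub_sq_le hf (u := u) (w := w) (m := m) (fun i => by exact_mod_cast huw i)
    have hm := modeEnergy_nonneg (L := L) f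
    set p := (scalePoly d M k).eval (walkEigenvalue L f)
    set N : ℝ := ((2 ^ k : ℕ) : ℝ)
    calc (p * sineMode L f u - p * sineMode L f w) ^ 2 * (1 + N ^ 2 * (modeEnergy L f / d)) ^ d
        = (p ^ 2 * (1 + N ^ 2 * (modeEnergy L f / d)) ^ d) *
          (sineMode L f u - sineMode L f w) ^ 2 := by ring
      _ ≤ 32 * d ^ 2 * 8 ^ d * (d * (Real.pi ^ 2 / 2) * m ^ 2 * modeEnergy L f) := by gcongr
      _ = (32 * d ^ 2 * 8 ^ d * d * Real.pi ^ 2) * m ^ 2 * (1 / 2 * modeEnergy L f) := by ring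
      _ ≤ _ := by gcongr; norm_num
  · by_cases hkM' : k < M
    · refine exists_localBox (D := (2 * d + 1) * 2 ^ k) hu (hkM.trans hLM) (by nlinarith) le_rfl
        fun x hx => ?_
      simp only [sub_div]
      rw [sineSum_sub, sineSum_scalePoly_eq_zero hd hkM' u, sineSum_scalePoly_eq_zero hd hkM' w,
        sub_zero]
      · refine fun h => hx fun i => ?_
        have h1 := h i
        have h2 := huw i
        have h3 : (m : ℤ) ≤ ((2 ^ k : ℕ) : ℤ) := by exact_mod_cast hmk
        have h4 : (((2 * d + 1) * 2 ^ k : ℕ) : ℤ) =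
          ((2 * d * 2 ^ k : ℕ) : ℤ) + ((2 ^ k : ℕ) : ℤ) := by push_cast; ring
        rw [h4]
        rw [abs_le] at h1 h2 ⊢
        omega
      · refine fun h => hx fun i => (h i).trans ?_
        exact_mod_cast (by nlinarith)
    · obtain rfl : k = M := by omega
      exact exists_localBox_of_lt hd hLM (by rw [← pow_succ']; exact hL) _

/-- The piece of the increment `φ_u - φ_w` at the scale `2^k`. -/
lemma hasTail_piece_increment {χ F α K κ : ℝ} (hd : 1 ≤ d) (hlam : 0 < lam) (hF : 0 < F)
    (hK : 0 < K) (hη : IsDisorder P η) (hE : ExiMin P η) (hStat : Stat P η)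
    (hconc : ChiConc P η lam L χ F α K κ) {φ : Ω → Surface d n}
    (hφ : ∀ᵐ ω ∂P, IsGroundConfig (η ω) lam (box d L) 0 (φ ω))
    {M k : ℕ} (hLM : 2 ^ M ≤ L) (hL : L < 2 ^ (M + 1)) (hk : k ≤ M) {u w : Fin d → ℤ}
    (hu : u ∈ box d L) {m : ℕ} (hm : 1 ≤ m) (huw : ∀ i, |u i - w i| ≤ (m : ℤ)) :
    HasTail P (2 * α) (8 * n * K) κ (fun ω => ‖sineStat L (fun f =>
      (scalePoly d M k).eval (walkEigenvalue L f) * sineMode L f u -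
      (scalePoly d M k).eval (walkEigenvalue L f) * sineMode L f w) (φ ω)‖)
      (2 * pieceConst d n χ *
        (√F * (min ((2 ^ k : ℕ) : ℝ) m * ((2 ^ k : ℕ) : ℝ) ^ ((χ - d) / 2)))) := by
  have hc : 0 ≤ pieceConst d n χ := by unfold pieceConst; positivity
  have hnK : 0 ≤ n * K := by positivity
  rcases le_total m (2 ^ k) with h | h
  · have hmin : min ((2 ^ k : ℕ) : ℝ) m = m := min_eq_right (by exact_mod_cast h)
    rw [hmin]
    refine (hasTail_piece_pair hd hlam hF hη hE hStat hconc hφ hLM hL hk hu hm h huw).mono ?_ ?_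
      (Filter.Eventually.of_forall fun _ => le_rfl)
    · rw [mul_assoc]
      have : 0 ≤ pieceConst d n χ * (√F * ((m : ℝ) * ((2 ^ k : ℕ) : ℝ) ^ ((χ - d) / 2))) := by
        positivity
      linarith
    · linarith
  · have hmin : min ((2 ^ k : ℕ) : ℝ) m = (2 ^ k : ℕ) := min_eq_left (by exact_mod_cast h)
    rw [hmin]
    refine ((hasTail_piece_site hd hlam hF hη hE hStat hconc hφ hLM hL hk u).add
      (hasTail_piece_site hd hlam hF hη hE hStat hconc hφ hLM hL hk w)).mono ?_ ?_
      (Filter.Eventually.of_forall fun ω => ?_)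
    · exact le_of_eq (by ring)
    · exact le_of_eq (by ring)
    · rw [sineStat_sub]; exact norm_sub_le _ _

end Increments

/-! ### Union bounds over geometric scales -/

lemma summable_pow_mul_exp_neg_mul_pow {A B c : ℝ} (hA : 0 ≤ A) (hB : 1 < B) (hc : 0 < c) :
    Summable fun j : ℕ => A ^ j * Real.exp (-(c * B ^ j)) := by
  obtain ⟨p, hp⟩ := pow_unbounded_of_one_lt A hB
  have hB0 : 0 < B := by linarith
  have h1 : Summable fun j : ℕ => (p.factorial / c ^ p) * (A / B ^ p) ^ j :=
    (summable_geometric_of_lt_one (by positivity)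
      (by rw [div_lt_one (by positivity)]; exact hp)).mul_left _
  refine h1.of_nonneg_of_le (fun j => by positivity) fun j => ?_
  have h2 := Real.pow_div_factorial_le_exp (c * B ^ j) (by positivity) p
  have h3 : Real.exp (-(c * B ^ j)) ≤ p.factorial / (c * B ^ j) ^ p := by
    rw [Real.exp_neg, inv_le_comm₀ (Real.exp_pos _) (by positivity), inv_div]
    exact h2
  calc A ^ j * Real.exp (-(c * B ^ j)) ≤ A ^ j * (p.factorial / (c * B ^ j) ^ p) := by gcongr
    _ = _ := by
      rw [mul_pow, div_pow, ← pow_mul, ← pow_mul, mul_comm j p]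
      field_simp

/-- Sums over the distance to a fixed integer. -/
lemma sum_range_dist_le {f : ℕ → ℝ} (hf : ∀ j, 0 ≤ f j) (hs : Summable f) (M j₀ : ℕ) :
    ∑ k ∈ Finset.range M, f (k - j₀ + (j₀ - k)) ≤ 2 * ∑' j, f j := by
  classical
  have key : ∀ (s : Finset ℕ) (g : ℕ → ℕ), Set.InjOn g s → ∑ k ∈ s, f (g k) ≤ ∑' j, f j :=
    fun s g hg => by
      rw [← Finset.sum_image (f := f) hg]
      exact hs.sum_le_tsum _ fun j _ => hf j
  rw [← Finset.sum_filter_add_sum_filter_not (Finset.range M) (fun k => k ≤ j₀), two_mul]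
  refine add_le_add (key _ _ ?_) (key _ _ ?_)
  · intro a ha b hb hab
    simp only [Finset.coe_filter, Finset.mem_range, Set.mem_ofPred_eq] at ha hb
    dsimp only at hab
    omega
  · intro a ha b hb hab
    simp only [Finset.coe_filter, Finset.mem_range, Set.mem_ofPred_eq] at ha hb
    dsimp only at hab
    omega

/-- Union bound with weights: enlarging the threshold of `Z i` by the factor `w i ^ (1/β)` makes
the failure probabilities summable. Small `t` are covered by the term `exp c₀`. -/
lemma measureReal_exists_lt_le {Ω : Type u} [MeasurableSpace Ω] {P : Measure Ω}
    [IsProbabilityMeasure P] {ι : Type*} (s : Finset ι) {Z : ι → Ω → ℝ} {a w : ι → ℝ}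
    {β C c c₀ S : ℝ} (hβ : 0 < β) (hc : 0 < c) (hC : 0 ≤ C)
    (hw : ∀ i ∈ s, 1 ≤ w i) (hZ : ∀ i ∈ s, HasTail P β C c (Z i) (a i))
    (hS : ∑ i ∈ s, Real.exp (-(c₀ * w i)) ≤ S) {t : ℝ} (ht : 0 < t) :
    P.real {ω | ∃ i ∈ s, t * w i ^ (1 / β) * a i < Z i ω} ≤
      (C * S + Real.exp c₀) * Real.exp (-(c / 2) * t ^ β) := by
  have hS0 : 0 ≤ S := (Finset.sum_nonneg fun i _ => (Real.exp_pos _).le).trans hS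
  rcases le_or_gt (2 * c₀ / c) (t ^ β) with h | h
  · have hsub : {ω | ∃ i ∈ s, t * w i ^ (1 / β) * a i < Z i ω} ⊆
        ⋃ i ∈ s, {ω | t * w i ^ (1 / β) * a i < Z i ω} := fun ω hω => by
      obtain ⟨i, hi, h⟩ := hω
      exact Set.mem_biUnion hi h
    have hone : ∀ i ∈ s, P.real {ω | t * w i ^ (1 / β) * a i < Z i ω} ≤
        C * Real.exp (-(c / 2) * t ^ β) * Real.exp (-(c₀ * w i)) := fun i hi => by
      have hwi := hw i hi
      have hw0 : 0 < w i := by linarith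
      refine (hZ i hi (t * w i ^ (1 / β)) (by positivity)).trans ?_
      rw [mul_assoc C, ← Real.exp_add, Real.mul_rpow ht.le (by positivity), ← Real.rpow_mul hw0.le,
        one_div_mul_cancel hβ.ne', Real.rpow_one]
      gcongr
      have h1 : c₀ ≤ c / 2 * t ^ β := by
        rw [div_le_iff₀ hc] at h; linarith
      have h2 : 0 ≤ t ^ β := by positivity
      nlinarith [mul_le_mul_of_nonneg_right h1 hw0.le,
        mul_nonneg (mul_nonneg hc.le h2) (sub_nonneg.2 hwi)]
    calc _ ≤ P.real (⋃ i ∈ s, {ω | t * w i ^ (1 / β) * a i < Z i ω}) := measureReal_mono hsub (measure_ne_top _ _)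
      _ ≤ ∑ i ∈ s, P.real {ω | t * w i ^ (1 / β) * a i < Z i ω} :=
          measureReal_biUnion_finset_le _ _
      _ ≤ ∑ i ∈ s, C * Real.exp (-(c / 2) * t ^ β) * Real.exp (-(c₀ * w i)) :=
          Finset.sum_le_sum hone
      _ = C * Real.exp (-(c / 2) * t ^ β) * ∑ i ∈ s, Real.exp (-(c₀ * w i)) := by
          rw [Finset.mul_sum]
      _ ≤ C * Real.exp (-(c / 2) * t ^ β) * S := by gcongr
      _ = C * S * Real.exp (-(c / 2) * t ^ β) := by ring
      _ ≤ _ := by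
          gcongr
          linarith [Real.exp_pos c₀]
  · calc _ ≤ (1 : ℝ) := measureReal_le_one
      _ ≤ Real.exp c₀ * Real.exp (-(c / 2) * t ^ β) := by
          rw [← Real.exp_add]
          refine Real.one_le_exp ?_
          rw [lt_div_iff₀ hc] at h
          linarith
      _ ≤ _ := by
          gcongr
          linarith [mul_nonneg hC hS0]

/-- A variable with a stretched-exponential tail on the scale `a` has mean of order `a`. -/
lemma HasTail.lintegral_le {Ω : Type u} [MeasurableSpace Ω] {P : Measure Ω}
    [IsProbabilityMeasure P] {β C c a : ℝ} {Z : Ω → ℝ} (h : HasTail P β C c Z a) (hβ : 0 < β)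
    (hc : 0 < c) (ha : 0 < a) (hZ0 : ∀ ω, 0 ≤ Z ω) (hZ : AEMeasurable Z P) :
    ∫⁻ ω, ENNReal.ofReal (Z ω) ∂P ≤
      ENNReal.ofReal (a * ∫ t in Set.Ioi (0 : ℝ), C * Real.exp (-c * t ^ β)) := by
  have h1 : ∫⁻ ω, ENNReal.ofReal (Z ω) ∂P =
      ENNReal.ofReal a * ∫⁻ ω, ENNReal.ofReal (Z ω / a) ∂P := by
    rw [← lintegral_const_mul' _ _ ENNReal.ofReal_ne_top]
    refine lintegral_congr fun ω => ?_
    rw [← ENNReal.ofReal_mul ha.le]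
    congr 1
    field_simp
  have hint : IntegrableOn (fun t : ℝ => C * Real.exp (-c * t ^ β)) (Set.Ioi 0) := by
    have := integrableOn_rpow_mul_exp_neg_mul_rpow (s := 0) (p := β) (b := c) (by norm_num) hβ hc
    simp only [Real.rpow_zero, one_mul] at this
    exact this.const_mul C
  rw [h1, ENNReal.ofReal_mul ha.le]
  gcongr
  rw [lintegral_eq_lintegral_meas_lt P
    (Filter.Eventually.of_forall fun ω => div_nonneg (hZ0 ω) ha.le) (hZ.div_const a)]
  have hle : ∀ t ∈ Set.Ioi (0 : ℝ), P {ω | t < Z ω / a} ≤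
      ENNReal.ofReal (C * Real.exp (-c * t ^ β)) := fun t ht => by
    have h2 : {ω | t < Z ω / a} = {ω | t * a < Z ω} := by
      ext ω; exact lt_div_iff₀ ha
    rw [h2, ← ofReal_measureReal]
    exact ENNReal.ofReal_le_ofReal (h t ht)
  refine (setLIntegral_mono' measurableSet_Ioi hle).trans (le_of_eq ?_)
  rw [ofReal_integral_eq_lintegral_ofReal hint]
  refine (ae_restrict_iff' measurableSet_Ioi).2 (Filter.Eventually.of_forall fun t ht => ?_)
  exact measureReal_nonneg.trans (h t ht)

/-! ### Increments of the ground configuration -/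

/-- The standing assumptions on the disorder and on the random ground configuration `φ`. -/
structure IsConcentratedGround {d n : ℕ} {Ω : Type u} [MeasurableSpace Ω] (P : Measure Ω)
    [MeasurableSpace (Environment d n)] (η : Ω → Environment d n) (lam : ℝ) (L : ℕ)
    (χ F α K κ : ℝ) (φ : Ω → Surface d n) : Prop where
  lam_pos : 0 < lam
  scale_pos : 0 < F
  one_le : 1 ≤ L
  isDisorder : IsDisorder P η
  exiMin : ExiMin P η
  stat : Stat P η
  chiConc : ChiConc P η lam L χ F α K κ
  isGround : ∀ᵐ ω ∂P, IsGroundConfig (η ω) lam (box d L) 0 (φ ω)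

/-- The contribution of the scale `2^k` decays geometrically in the distance between `2^k` and the
size `m` of the increment. -/
lemma min_mul_rpow_le {ξ θ : ℝ} (h1 : θ ≤ ξ) (h2 : θ ≤ 1 - ξ) (hθ : 0 < θ) {m j₀ k : ℕ}
    (hm1 : 2 ^ j₀ ≤ m) (hm2 : m < 2 ^ (j₀ + 1)) :
    min ((2 ^ k : ℕ) : ℝ) m * ((2 ^ k : ℕ) : ℝ) ^ (ξ - 1) ≤
      2 * (m : ℝ) ^ ξ * ((2 : ℝ) ^ (-θ)) ^ (k - j₀ + (j₀ - k)) := by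
  have hm0 : (0 : ℝ) < m := by
    have : 0 < m := lt_of_lt_of_le (by positivity) hm1
    exact_mod_cast this
  have hk0 : (0 : ℝ) < ((2 ^ k : ℕ) : ℝ) := by positivity
  set l := k - j₀ + (j₀ - k) with hl
  have hpow : ((2 : ℝ) ^ (-θ)) ^ l = ((2 : ℝ)⁻¹ ^ l) ^ θ := by
    rw [Real.rpow_neg two_pos.le, ← Real.inv_rpow two_pos.le, Real.rpow_pow_comm (by positivity)]
  have hhalf0 : (0 : ℝ) < (2 : ℝ)⁻¹ ^ l := by positivity
  have hhalf1 : (2 : ℝ)⁻¹ ^ l ≤ 1 := pow_le_one₀ (by norm_num) (by norm_num)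
  have hmx : 0 < (m : ℝ) ^ ξ := by positivity
  rw [hpow]
  rcases le_or_gt k j₀ with h | h
  · have hk : ((2 ^ k : ℕ) : ℝ) ≤ m * (2 : ℝ)⁻¹ ^ l := by
      have e : l = j₀ - k := by omega
      have h3 : ((2 ^ k : ℕ) : ℝ) = ((2 ^ j₀ : ℕ) : ℝ) * (2 : ℝ)⁻¹ ^ l := by
        rw [e, inv_pow]
        push_cast
        rw [← div_eq_mul_inv, eq_div_iff (by positivity), ← pow_add]
        congr 1; omega
      rw [h3]
      gcongr
    calc min ((2 ^ k : ℕ) : ℝ) m * ((2 ^ k : ℕ) : ℝ) ^ (ξ - 1)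
        ≤ ((2 ^ k : ℕ) : ℝ) * ((2 ^ k : ℕ) : ℝ) ^ (ξ - 1) := by gcongr; exact min_le_left _ _
      _ = ((2 ^ k : ℕ) : ℝ) ^ ξ := by
          rw [← Real.rpow_one_add' hk0.le (by linarith)]; congr 1; ring
      _ ≤ (m * (2 : ℝ)⁻¹ ^ l) ^ ξ := Real.rpow_le_rpow hk0.le hk (by linarith)
      _ = (m : ℝ) ^ ξ * ((2 : ℝ)⁻¹ ^ l) ^ ξ := Real.mul_rpow hm0.le hhalf0.le
      _ ≤ (m : ℝ) ^ ξ * ((2 : ℝ)⁻¹ ^ l) ^ θ := by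
          gcongr ?_ * ?_
          exact Real.rpow_le_rpow_of_exponent_ge hhalf0 hhalf1 h1
      _ ≤ _ := by
          gcongr ?_ * _
          linarith
  · have hk : (m : ℝ) / ((2 ^ k : ℕ) : ℝ) ≤ 2 * (2 : ℝ)⁻¹ ^ l := by
      have e : l = k - j₀ := by omega
      rw [div_le_iff₀ hk0]
      have h3 : 2 * (2 : ℝ)⁻¹ ^ l * ((2 ^ k : ℕ) : ℝ) = ((2 ^ (j₀ + 1) : ℕ) : ℝ) := by
        rw [e, inv_pow]
        push_cast
        rw [mul_assoc, inv_mul_eq_div, mul_div_assoc', div_eq_iff (by positivity), ← pow_succ',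
          ← pow_add]
        congr 1; omega
      rw [h3]
      exact_mod_cast hm2.le
    calc min ((2 ^ k : ℕ) : ℝ) m * ((2 ^ k : ℕ) : ℝ) ^ (ξ - 1)
        ≤ (m : ℝ) * ((2 ^ k : ℕ) : ℝ) ^ (ξ - 1) := by gcongr; exact min_le_right _ _
      _ = (m : ℝ) ^ ξ * ((m : ℝ) / ((2 ^ k : ℕ) : ℝ)) ^ (1 - ξ) := by
          rw [Real.div_rpow hm0.le hk0.le, div_eq_mul_inv, ← Real.rpow_neg hk0.le, ← mul_assoc,
            ← Real.rpow_add hm0, add_sub_cancel, Real.rpow_one, neg_sub]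
      _ ≤ (m : ℝ) ^ ξ * (2 * (2 : ℝ)⁻¹ ^ l) ^ (1 - ξ) := by
          gcongr ?_ * ?_
          exact Real.rpow_le_rpow (by positivity) hk (by linarith)
      _ = (m : ℝ) ^ ξ * ((2 : ℝ) ^ (1 - ξ) * ((2 : ℝ)⁻¹ ^ l) ^ (1 - ξ)) := by
          rw [Real.mul_rpow two_pos.le hhalf0.le]
      _ ≤ (m : ℝ) ^ ξ * (2 * ((2 : ℝ)⁻¹ ^ l) ^ θ) := by
          have h4 : (2 : ℝ) ^ (1 - ξ) ≤ 2 := by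
            calc (2 : ℝ) ^ (1 - ξ) ≤ (2 : ℝ) ^ (1 : ℝ) :=
                  Real.rpow_le_rpow_of_exponent_le one_le_two (by linarith)
              _ = 2 := Real.rpow_one _
          have h5 := Real.rpow_le_rpow_of_exponent_ge hhalf0 hhalf1 h2
          gcongr
      _ = _ := by ring

/-- **Hölder-type increment bound**: the increment of a ground configuration over distance `m` lives
on the scale `√F m^ξ`, `ξ = (χ - (d-2))/2`. -/
theorem exists_hasTail_increment (d n : ℕ) (hd : 1 ≤ d) (χ α K κ : ℝ)
    (hχ_lower : (d : ℝ) - 2 < χ) (hχ_upper : χ < d) (hα : 0 < α) (hK : 0 < K) (hκ : 0 < κ) :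
    ∃ C > 0, ∃ c > 0, ∃ A > 0,
      ∀ (Ω : Type u) [MeasurableSpace Ω] (P : Measure Ω) [IsProbabilityMeasure P]
        [MeasurableSpace (Environment d n)] (η : Ω → Environment d n) (lam : ℝ) (L : ℕ) (F : ℝ)
        (φ : Ω → Surface d n), IsConcentratedGround P η lam L χ F α K κ φ →
        ∀ (u w : Fin d → ℤ) (m : ℕ), 1 ≤ m → (∀ i, |u i - w i| ≤ (m : ℤ)) →
          HasTail P (2 * α) C c (fun ω => ‖φ ω u - φ ω w‖)
            (A * (√F * (m : ℝ) ^ ((χ - ((d : ℝ) - 2)) / 2))) := by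
  set ξ := (χ - ((d : ℝ) - 2)) / 2 with hξ
  set θ := min ξ (1 - ξ) with hθ
  have hθ0 : 0 < θ := lt_min (by rw [hξ]; linarith) (by rw [hξ]; linarith)
  have hβ : 0 < 2 * α := by linarith
  -- half of the geometric decay is spent on the weights of the union bound
  set r : ℝ := (2 : ℝ) ^ (-(θ / 2)) with hr
  have hr0 : 0 < r := by positivity
  have hr1 : r < 1 := Real.rpow_lt_one_of_one_lt_of_neg one_lt_two (by linarith)
  have hrr : (2 : ℝ) ^ (-θ) = r * r := by
    rw [hr, ← Real.rpow_add two_pos]; congr 1; ring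
  set B : ℝ := (r ^ (2 * α))⁻¹ with hB
  have hB1 : 1 < B := (one_lt_inv₀ (by positivity)).2 (Real.rpow_lt_one hr0.le hr1 hβ)
  have hsumB : Summable fun j : ℕ => Real.exp (-(1 * B ^ j)) := by
    simpa using summable_pow_mul_exp_neg_mul_pow (A := 1) zero_le_one hB1 one_pos
  have hsumr : Summable fun j : ℕ => r ^ j := summable_geometric_of_lt_one hr0.le hr1
  set S := 2 * ∑' j : ℕ, Real.exp (-(1 * B ^ j)) with hS
  set R := 2 * ∑' j : ℕ, r ^ j with hR
  have hS0 : 0 ≤ S := mul_nonneg two_pos.le (tsum_nonneg fun j => (Real.exp_pos _).le)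
  have hR0 : 0 ≤ R := mul_nonneg two_pos.le (tsum_nonneg fun j => by positivity)
  have hpc : 0 ≤ pieceConst d n χ := by unfold pieceConst; positivity
  refine ⟨8 * n * K * S + Real.exp 1, by positivity, κ / 2, by positivity,
    2 * pieceConst d n χ * (2 * R) + 1, by positivity, ?_⟩
  intro Ω _ P _ _ η lam L F φ h
  have main : ∀ (u w : Fin d → ℤ) (m : ℕ), 1 ≤ m → (∀ i, |u i - w i| ≤ (m : ℤ)) → u ∈ box d L →
      HasTail P (2 * α) (8 * n * K * S + Real.exp 1) (κ / 2) (fun ω => ‖φ ω u - φ ω w‖)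
            ((2 * pieceConst d n χ * (2 * R) + 1) * (√F * (m : ℝ) ^ ξ)) := by
    intro u w m hm huw hu t ht
    set M := Nat.log 2 L with hM
    have hL0 : L ≠ 0 := by have := h.one_le; omega
    have hLM : 2 ^ M ≤ L := Nat.pow_log_le_self 2 hL0
    have hML : L < 2 ^ (M + 1) := Nat.lt_pow_succ_log_self one_lt_two L
    set j₀ := Nat.log 2 m with hj₀
    have hm1 : 2 ^ j₀ ≤ m := Nat.pow_log_le_self 2 (by omega)
    have hm2 : m < 2 ^ (j₀ + 1) := Nat.lt_pow_succ_log_self one_lt_two m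
    set V : ℕ → Surface d n → EuclideanSpace ℝ (Fin n) := fun k ψ => sineStat L (fun f =>
      (scalePoly d M k).eval (walkEigenvalue L f) * sineMode L f u -
      (scalePoly d M k).eval (walkEigenvalue L f) * sineMode L f w) ψ with hV
    set a : ℕ → ℝ := fun k => 2 * pieceConst d n χ *
        (√F * (min ((2 ^ k : ℕ) : ℝ) m * ((2 ^ k : ℕ) : ℝ) ^ ((χ - d) / 2))) with ha
    set lev : ℕ → ℕ := fun k => k - j₀ + (j₀ - k) with hlev
    have hexp : (χ - d) / 2 = ξ - 1 := by rw [hξ]; ring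
    have hak : ∀ k, a k ≤ 2 * pieceConst d n χ * (√F * (2 * (m : ℝ) ^ ξ * (r * r) ^ lev k)) :=
      fun k => by
        have := min_mul_rpow_le (min_le_left ξ (1 - ξ)) (min_le_right ξ (1 - ξ)) hθ0
          (k := k) hm1 hm2
        rw [← hθ, hrr, ← hexp] at this
        simp only [ha]
        gcongr
    have hunion := measureReal_exists_lt_le (P := P) (Finset.range (M + 1))
      (Z := fun k ω => ‖V k (φ ω)‖) (a := a) (w := fun k => B ^ lev k) (c₀ := 1) (S := S)
      hβ hκ (C := 8 * n * K) (by positivity) (fun k _ => one_le_pow₀ hB1.le)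
      (fun k hk => hasTail_piece_increment hd h.lam_pos h.scale_pos hK h.isDisorder h.exiMin h.stat
        h.chiConc h.isGround hLM hML (by rw [Finset.mem_range] at hk; omega) hu hm huw)
      (sum_range_dist_le (f := fun j => Real.exp (-(1 * B ^ j))) (fun j => (Real.exp_pos _).le)
        hsumB _ _) ht
    refine le_trans (ENNReal.toReal_mono (measure_ne_top _ _) (measure_mono_ae ?_)) hunion
    filter_upwards [h.isGround] with ω hω hlt
    change _ < _ at hlt
    change ∃ k ∈ Finset.range (M + 1), t * (B ^ lev k) ^ (1 / (2 * α)) * a k < ‖V k (φ ω)‖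
    by_contra hcon
    push Not at hcon
    refine absurd hlt (not_lt.2 ?_)
    have hwk : ∀ k, (B ^ lev k) ^ (1 / (2 * α)) = (r ^ lev k)⁻¹ := fun k => by
      rw [← Real.rpow_pow_comm (by positivity), hB, Real.inv_rpow (by positivity),
        ← Real.rpow_mul hr0.le, mul_one_div_cancel hβ.ne', Real.rpow_one, inv_pow]
    calc ‖φ ω u - φ ω w‖ = ‖∑ k ∈ Finset.range (M + 1), V k (φ ω)‖ := by
          rw [sub_eq_sum_pieces hω.1 M u w]
      _ ≤ ∑ k ∈ Finset.range (M + 1), ‖V k (φ ω)‖ := norm_sum_le _ _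
      _ ≤ ∑ k ∈ Finset.range (M + 1),
          t * (2 * pieceConst d n χ * (√F * (2 * (m : ℝ) ^ ξ))) * r ^ lev k := by
          refine Finset.sum_le_sum fun k hk => (hcon k hk).trans ?_
          rw [hwk]
          calc t * (r ^ lev k)⁻¹ * a k ≤ t * (r ^ lev k)⁻¹ *
                (2 * pieceConst d n χ * (√F * (2 * (m : ℝ) ^ ξ * (r * r) ^ lev k))) := by
                gcongr; exact hak k
            _ = _ := by
                rw [mul_pow]; field_simp
      _ = t * (2 * pieceConst d n χ * (√F * (2 * (m : ℝ) ^ ξ))) *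
          ∑ k ∈ Finset.range (M + 1), r ^ lev k := by rw [Finset.mul_sum]
      _ ≤ t * (2 * pieceConst d n χ * (√F * (2 * (m : ℝ) ^ ξ))) * R := by
          gcongr
          exact sum_range_dist_le (f := fun j => r ^ j) (fun j => by positivity) hsumr _ _
      _ ≤ t * ((2 * pieceConst d n χ * (2 * R) + 1) * (√F * (m : ℝ) ^ ξ)) := by
          have : 0 ≤ t * (√F * (m : ℝ) ^ ξ) := by positivity
          nlinarith
  intro u w m hm huw
  by_cases hu : u ∈ box d L
  · exact main u w m hm huw hu
  by_cases hw : w ∈ box d L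
  · refine (main w u m hm (fun i => by rw [abs_sub_comm]; exact huw i) hw).mono le_rfl le_rfl
      (Filter.Eventually.of_forall fun ω => ?_)
    rw [norm_sub_rev]
  · intro t ht
    have h0 : P.real {ω | t * ((2 * pieceConst d n χ * (2 * R) + 1) * (√F * (m : ℝ) ^ ξ)) <
        ‖φ ω u - φ ω w‖} = 0 := by
      have : P {ω | t * ((2 * pieceConst d n χ * (2 * R) + 1) * (√F * (m : ℝ) ^ ξ)) <
          ‖φ ω u - φ ω w‖} = 0 := by
        refine measure_eq_zero_iff_ae_notMem.2 ?_
        filter_upwards [h.isGround] with ω hω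
        rw [hω.1 u hu, hω.1 w hw]
        simp only [Pi.zero_apply, sub_self, norm_zero, not_lt]
        positivity
      rw [Measure.real, this, ENNReal.toReal_zero]
    rw [h0]
    positivity

/-! ### The distance to the boundary -/

section Boundary

variable {d L : ℕ}

lemma exists_notMem_box_of_le {v : Fin d → ℤ} {r : ℕ}
    (h : ∃ i, (L : ℤ) + 1 ≤ |v i| + r) (hv : v ∈ box d L) :
    ∃ w, w ∉ box d L ∧ ∀ i, |v i - w i| ≤ (r : ℤ) := by
  obtain ⟨i, hi⟩ := h
  have hvi := mem_box.1 hv i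
  have key : ∀ a : ℤ, |a| = L + 1 → |v i - a| ≤ r →
      ∃ w, w ∉ box d L ∧ ∀ i, |v i - w i| ≤ (r : ℤ) := fun a ha hva => by
    refine ⟨Function.update v i a, fun hw => ?_, fun j => ?_⟩
    · have := mem_box.1 hw i
      rw [Function.update_self, ha] at this
      omega
    · by_cases hj : j = i
      · subst hj; rwa [Function.update_self]
      · rw [Function.update_of_ne hj]; simp
  rw [abs_le] at hvi
  rcases abs_cases (v i) with ⟨h1, h2⟩ | ⟨h1, h2⟩
  · exact key (L + 1) (abs_of_nonneg (by omega)) (by rw [abs_le]; omega)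
  · refine key (-(L + 1)) (by rw [abs_neg]; exact abs_of_nonneg (by omega)) (by rw [abs_le]; omega)

/-- The distance of a site of the box to the complement of the box is an integer
`r ∈ {1, …, L+1}`, and some coordinate of the site is within `r` of `± (L+1)`. -/
lemma exists_boundaryDist_eq (hd : 1 ≤ d) {v : Fin d → ℤ} (hv : v ∈ box d L) :
    ∃ r : ℕ, boundaryDist L v = r ∧ 1 ≤ r ∧ r ≤ L + 1 ∧ ∃ i, (L : ℤ) + 1 ≤ |v i| + r := by
  have hne : ((box d L : Set (Fin d → ℤ))ᶜ).Nonempty := by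
    refine ⟨fun _ => (L : ℤ) + 1, fun h => ?_⟩
    have := mem_box.1 (Finset.mem_coe.1 h) ⟨0, hd⟩
    rw [abs_le] at this
    omega
  obtain ⟨w, hw, hwd⟩ := (isClosed_discrete ((box d L : Set (Fin d → ℤ))ᶜ)).exists_infDist_eq_dist
    hne v
  have : Nonempty (Fin d) := ⟨⟨0, hd⟩⟩
  set r := Finset.univ.sup fun i => (v i - w i).natAbs with hr
  have hle : ∀ i, (v i - w i).natAbs ≤ r := fun i =>
    Finset.le_sup (f := fun i => (v i - w i).natAbs) (Finset.mem_univ i)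
  have hdist : ∀ i, dist (v i) (w i) = ((v i - w i).natAbs : ℝ) := fun i => by
    rw [Int.dist_eq, Nat.cast_natAbs]; push_cast; rfl
  have hdr : dist v w = r := by
    refine le_antisymm ((dist_pi_le_iff (Nat.cast_nonneg _)).2 fun i => ?_) ?_
    · rw [hdist]; exact_mod_cast hle i
    · obtain ⟨i, _, hi⟩ := Finset.exists_mem_eq_sup Finset.univ Finset.univ_nonempty
        (fun i => (v i - w i).natAbs)
      rw [hr, hi, ← hdist]
      exact dist_le_pi_dist v w i
  have hwL : w ∉ box d L := fun h => hw (Finset.mem_coe.2 h)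
  obtain ⟨i, hi⟩ : ∃ i, (L : ℤ) < |w i| := by
    rw [mem_box] at hwL
    push Not at hwL
    exact hwL
  have hvi := mem_box.1 hv i
  have hri := hle i
  have hvw : |w i| ≤ |v i| + r := by
    rcases abs_cases (w i) with h1 | h1 <;> rcases abs_cases (v i) with h2 | h2 <;> omega
  refine ⟨r, by rw [boundaryDist, hwd, hdr], by omega, ?_, i, by omega⟩
  obtain ⟨w', hw', hw'd⟩ := exists_notMem_box_of_le (L := L) (v := v) (r := L + 1)
    ⟨i, by have := abs_nonneg (v i); push_cast; omega⟩ hv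
  have h1 : Metric.infDist v ((box d L : Set (Fin d → ℤ))ᶜ) ≤ dist v w' :=
    Metric.infDist_le_dist_of_mem fun h => hw' (Finset.mem_coe.1 h)
  have h2 : dist v w' ≤ ((L + 1 : ℕ) : ℝ) := (dist_pi_le_iff (Nat.cast_nonneg _)).2 fun i => by
    rw [Int.dist_eq]; exact_mod_cast hw'd i
  rw [hwd, hdr] at h1
  exact_mod_cast h1.trans h2

end Boundary

/-! ### Chaining along dyadic grids -/

section Grid

variable {d L : ℕ}

/-- Rounding down to the grid `2^j ℤ^d`. -/
def gridFloor {d : ℕ} (j : ℕ) (v : Fin d → ℤ) : Fin d → ℤ := fun i => v i / 2 ^ j * 2 ^ j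

lemma gridFloor_zero (v : Fin d → ℤ) : gridFloor 0 v = v := by
  funext i; simp [gridFloor]

lemma gridFloor_succ_gridFloor (j : ℕ) (v : Fin d → ℤ) :
    gridFloor (j + 1) (gridFloor j v) = gridFloor (j + 1) v := by
  funext i
  have h2 : (0 : ℤ) < 2 ^ j := by positivity
  simp only [gridFloor]
  congr 1
  rw [pow_succ, mul_comm (v i / 2 ^ j), Int.mul_ediv_mul_of_pos _ _ h2,
    Int.ediv_ediv_of_nonneg h2.le]

lemma abs_sub_gridFloor_le (j : ℕ) (v : Fin d → ℤ) (i : Fin d) :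
    |v i - gridFloor j v i| ≤ 2 ^ j := by
  have h2 : (0 : ℤ) < 2 ^ j := by positivity
  have h3 := Int.emod_nonneg (v i) h2.ne'
  have h4 := Int.emod_lt_of_pos (v i) h2
  have h5 := Int.emod_add_ediv_mul (v i) (2 ^ j)
  simp only [gridFloor]
  rw [abs_le]
  constructor <;> linarith

/-- The sites of the box within distance less than `2^(J+1)` of its complement. -/
noncomputable def boundaryLayer (d L J : ℕ) : Finset (Fin d → ℤ) :=
  (box d L).filter fun v => ∃ i, (L : ℤ) + 1 < |v i| + 2 ^ (J + 1)

/-- The roundings of the sites of a boundary layer to the grid `2^j ℤ^d`. -/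
noncomputable def layerGrid (d L J j : ℕ) : Finset (Fin d → ℤ) := (boundaryLayer d L J).image (gridFloor j)

lemma card_Icc_ediv_le {a b : ℤ} {D : ℤ} (hD : 0 < D) {E : ℕ} (h : b ≤ a + E * D) :
    (Finset.Icc (a / D) (b / D)).card ≤ E + 1 := by
  rw [Int.card_Icc]
  have h1 : b / D ≤ a / D + E := by
    rw [← Int.add_mul_ediv_right _ _ hD.ne']
    exact Int.ediv_le_ediv hD h
  omega

lemma card_layerGrid_le (hd : 1 ≤ d) {M J j : ℕ} (hL : L + 1 < 2 ^ (M + 1)) (hJ : J ≤ M)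
    (hj : j ≤ J) :
    (layerGrid d L J j).card ≤ d * 6 ^ d * ((2 ^ d) ^ (J - j) * (2 ^ (d - 1)) ^ (M - J)) := by
  classical
  have hD : (0 : ℤ) < 2 ^ j := by positivity
  set I : Finset ℤ := Finset.Icc ((-(L : ℤ)) / 2 ^ j) ((L : ℤ) / 2 ^ j) with hI
  set E : Bool → Finset ℤ := fun b => if b then
    Finset.Icc (((L : ℤ) + 2 - 2 ^ (J + 1)) / 2 ^ j) ((L : ℤ) / 2 ^ j) else
    Finset.Icc ((-(L : ℤ)) / 2 ^ j) ((2 ^ (J + 1) - (L : ℤ) - 2) / 2 ^ j) with hE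
  have hIc : I.card ≤ 6 * 2 ^ (M - j) := by
    refine (card_Icc_ediv_le hD (E := 4 * 2 ^ (M - j)) ?_).trans ?_
    · have h1 : ((4 * 2 ^ (M - j) : ℕ) : ℤ) * 2 ^ j = 2 * 2 ^ (M + 1) := by
        push_cast
        rw [mul_assoc, ← pow_add, pow_succ, show M - j + j = M by omega]; ring
      have h2 : (L : ℤ) + 1 < 2 ^ (M + 1) := by exact_mod_cast hL
      rw [h1]; omega
    · have := Nat.one_le_two_pow (n := M - j)
      omega
  have hEc : ∀ b, (E b).card ≤ 3 * 2 ^ (J - j) := fun b => by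
    have h1 : ((2 * 2 ^ (J - j) : ℕ) : ℤ) * 2 ^ j = 2 ^ (J + 1) := by
      push_cast
      rw [mul_assoc, ← pow_add, pow_succ, show J - j + j = J by omega]; ring
    have h2 := Nat.one_le_two_pow (n := J - j)
    cases b
    · refine (card_Icc_ediv_le hD (E := 2 * 2 ^ (J - j)) ?_).trans (by omega)
      rw [h1]; omega
    · refine (card_Icc_ediv_le hD (E := 2 * 2 ^ (J - j)) ?_).trans (by omega)
      rw [h1]; omega
  have hsub : layerGrid d L J j ⊆ (Finset.univ : Finset (Fin d × Bool)).biUnion fun p =>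
      (Fintype.piFinset fun l => if l = p.1 then E p.2 else I).image
        fun q l => q l * (2 : ℤ) ^ j := by
    intro x hx
    obtain ⟨v, hv, rfl⟩ := Finset.mem_image.1 hx
    obtain ⟨hvL, i, hi⟩ := Finset.mem_filter.1 hv
    have hv' := fun l => abs_le.1 (mem_box.1 hvL l)
    have hmem : ∀ b, v i / 2 ^ j ∈ E b → gridFloor j v ∈
        (Finset.univ : Finset (Fin d × Bool)).biUnion fun p =>
        (Fintype.piFinset fun l => if l = p.1 then E p.2 else I).image
          fun q l => q l * (2 : ℤ) ^ j := fun b hb => by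
      refine Finset.mem_biUnion.2 ⟨(i, b), Finset.mem_univ _, Finset.mem_image.2
        ⟨fun l => v l / 2 ^ j, Fintype.mem_piFinset.2 fun l => ?_, rfl⟩⟩
      by_cases hl : l = i
      · subst hl; simpa using hb
      · simp only [hl, if_false, hI, Finset.mem_Icc]
        exact ⟨Int.ediv_le_ediv hD (hv' l).1, Int.ediv_le_ediv hD (hv' l).2⟩
    rcases abs_cases (v i) with ⟨h1, h2⟩ | ⟨h1, h2⟩
    · refine hmem true ?_
      simp only [hE, if_true, Finset.mem_Icc]
      exact ⟨Int.ediv_le_ediv hD (by omega), Int.ediv_le_ediv hD (hv' i).2⟩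
    · refine hmem false ?_
      simp only [hE, Bool.false_eq_true, if_false, Finset.mem_Icc]
      exact ⟨Int.ediv_le_ediv hD (hv' i).1, Int.ediv_le_ediv hD (by omega)⟩
  have hone : ∀ p : Fin d × Bool, ((Fintype.piFinset fun l => if l = p.1 then E p.2 else I).image
      fun q l => q l * (2 : ℤ) ^ j).card ≤ 3 * 2 ^ (J - j) * (6 * 2 ^ (M - j)) ^ (d - 1) :=
    fun p => by
      refine Finset.card_image_le.trans ?_
      rw [Fintype.card_piFinset, ← Finset.mul_prod_erase _ _ (Finset.mem_univ p.1), if_pos rfl]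
      refine Nat.mul_le_mul (hEc _) ?_
      rw [Finset.prod_congr rfl fun l hl => by rw [if_neg (Finset.ne_of_mem_erase hl)]]
      rw [Finset.prod_const, Finset.card_erase_of_mem (Finset.mem_univ _), Finset.card_univ,
        Fintype.card_fin]
      exact Nat.pow_le_pow_left hIc _
  calc (layerGrid d L J j).card ≤ _ := Finset.card_le_card hsub
    _ ≤ _ := Finset.card_biUnion_le
    _ ≤ ∑ _p : Fin d × Bool, 3 * 2 ^ (J - j) * (6 * 2 ^ (M - j)) ^ (d - 1) :=
        Finset.sum_le_sum fun p _ => hone p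
    _ = d * 6 ^ d * ((2 ^ d) ^ (J - j) * (2 ^ (d - 1)) ^ (M - J)) := by
        obtain ⟨e, rfl⟩ : ∃ e, d = e + 1 := ⟨d - 1, by omega⟩
        rw [Finset.sum_const, Finset.card_univ, Fintype.card_prod, Fintype.card_fin,
          Fintype.card_bool, smul_eq_mul, Nat.add_sub_cancel, show M - j = (J - j) + (M - J) by omega]
        rw [pow_add, pow_right_comm 2 (e + 1), pow_right_comm 2 e]
        generalize 2 ^ (J - j) = x
        generalize 2 ^ (M - J) = y
        ring

end Grid

/-! ### Uniform localization -/

lemma add_div_two_le_mul {x y : ℝ} (hx : 1 ≤ x) (hy : 1 ≤ y) : x / 2 + y / 2 ≤ x * y := by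
  nlinarith [mul_nonneg (sub_nonneg.2 hx) (sub_nonneg.2 hy)]

/-- The weighted number of links of all chains, bounded uniformly in the size of the box. -/
lemma sum_card_layerGrid_le {d L M : ℕ} (hd : 1 ≤ d) (hL : L + 1 < 2 ^ (M + 1)) {y : ℕ → ℝ}
    (hy : ∀ k, 1 ≤ y k) {B c₀ : ℝ} (hB : 1 < B) (hc₀ : 0 < c₀)
    (hsum : Summable fun k : ℕ => ((2 : ℝ) ^ (d - 1)) ^ k * Real.exp (-(c₀ / 2 * y k))) :
    ∑ J ∈ Finset.range (M + 1), ∑ j ∈ Finset.range (J + 1), ∑ _x ∈ layerGrid d L J j,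
        Real.exp (-(c₀ * (y (M - J) * B ^ (J - j)))) ≤
      d * 6 ^ d * ((∑' k : ℕ, ((2 : ℝ) ^ (d - 1)) ^ k * Real.exp (-(c₀ / 2 * y k))) *
        ∑' i : ℕ, ((2 : ℝ) ^ d) ^ i * Real.exp (-(c₀ / 2 * B ^ i))) := by
  set f : ℕ → ℝ := fun k => ((2 : ℝ) ^ (d - 1)) ^ k * Real.exp (-(c₀ / 2 * y k)) with hf
  set g : ℕ → ℝ := fun i => ((2 : ℝ) ^ d) ^ i * Real.exp (-(c₀ / 2 * B ^ i)) with hg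
  have hgs : Summable g := summable_pow_mul_exp_neg_mul_pow (by positivity) hB (by positivity)
  have hf0 : ∀ k, 0 ≤ f k := fun k => by positivity
  have hg0 : ∀ k, 0 ≤ g k := fun k => by positivity
  have hone : ∀ J ∈ Finset.range (M + 1), ∀ j ∈ Finset.range (J + 1),
      ∑ _x ∈ layerGrid d L J j, Real.exp (-(c₀ * (y (M - J) * B ^ (J - j)))) ≤
        d * 6 ^ d * (f (M - J) * g (J - j)) := fun J hJ j hj => by
    rw [Finset.mem_range] at hJ hj
    have hcard : ((layerGrid d L J j).card : ℝ) ≤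
        d * 6 ^ d * (((2 : ℝ) ^ d) ^ (J - j) * ((2 : ℝ) ^ (d - 1)) ^ (M - J)) := by
      exact_mod_cast card_layerGrid_le hd hL (by omega) (by omega)
    have hexp : Real.exp (-(c₀ * (y (M - J) * B ^ (J - j)))) ≤
        Real.exp (-(c₀ / 2 * y (M - J))) * Real.exp (-(c₀ / 2 * B ^ (J - j))) := by
      rw [← Real.exp_add]
      gcongr
      have := mul_le_mul_of_nonneg_left
        (add_div_two_le_mul (hy (M - J)) (one_le_pow₀ hB.le (n := J - j))) hc₀.le
      linarith
    rw [Finset.sum_const, nsmul_eq_mul]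
    calc _ ≤ d * 6 ^ d * (((2 : ℝ) ^ d) ^ (J - j) * ((2 : ℝ) ^ (d - 1)) ^ (M - J)) *
          (Real.exp (-(c₀ / 2 * y (M - J))) * Real.exp (-(c₀ / 2 * B ^ (J - j)))) := by gcongr
      _ = _ := by simp only [hf, hg]; ring
  calc _ ≤ ∑ J ∈ Finset.range (M + 1), ∑ j ∈ Finset.range (J + 1),
        d * 6 ^ d * (f (M - J) * g (J - j)) :=
        Finset.sum_le_sum fun J hJ => Finset.sum_le_sum fun j hj => hone J hJ j hj
    _ = d * 6 ^ d * ∑ J ∈ Finset.range (M + 1),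
          f (M - J) * ∑ j ∈ Finset.range (J + 1), g (J - j) := by
        simp only [Finset.mul_sum]
    _ ≤ d * 6 ^ d * ∑ J ∈ Finset.range (M + 1), f (M - J) * ∑' i, g i := by
        gcongr with J hJ
        have := Finset.sum_range_reflect g (J + 1)
        simp only [Nat.add_sub_cancel] at this
        rw [this]
        exact hgs.sum_le_tsum _ fun i _ => hg0 i
    _ ≤ d * 6 ^ d * ((∑' k, f k) * ∑' i, g i) := by
        rw [← Finset.sum_mul]
        have h1 : ∑ J ∈ Finset.range (M + 1), f (M - J) ≤ ∑' k, f k := by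
          have := Finset.sum_range_reflect f (M + 1)
          simp only [Nat.add_sub_cancel] at this
          rw [this]
          exact hsum.sum_le_tsum _ fun i _ => hf0 i
        have h2 : 0 ≤ ∑' i, g i := tsum_nonneg hg0
        gcongr

/-- The scale on which a single height lives near the boundary. -/
lemma hasTail_norm_of_layer {d n L : ℕ} {χ F α K κ ξ C c A lam : ℝ} {Ω : Type u}
    [MeasurableSpace Ω] {P : Measure Ω} [IsProbabilityMeasure P]
    [MeasurableSpace (Environment d n)] {η : Ω → Environment d n} {φ : Ω → Surface d n}
    (h : IsConcentratedGround P η lam L χ F α K κ φ)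
    (hinc : ∀ (u w : Fin d → ℤ) (m : ℕ), 1 ≤ m → (∀ i, |u i - w i| ≤ (m : ℤ)) →
      HasTail P (2 * α) C c (fun ω => ‖φ ω u - φ ω w‖) (A * (√F * (m : ℝ) ^ ξ)))
    {u w : Fin d → ℤ} (hw : w ∉ box d L) {m : ℕ} (hm : 1 ≤ m) (huw : ∀ i, |u i - w i| ≤ (m : ℤ)) :
    HasTail P (2 * α) C c (fun ω => ‖φ ω u‖) (A * (√F * (m : ℝ) ^ ξ)) := by
  refine (hinc u w m hm huw).mono le_rfl le_rfl ?_
  filter_upwards [h.isGround] with ω hω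
  rw [hω.1 w hw]
  simp

/-- **Chaining.** Each site `v` at distance `r` from the boundary is joined to the boundary by a
chain of grid points of the scales `1, 2, 4, …, 2^J ≤ r`. The weight `y (M - J) B^(J - j)` of a link
of scale `2^j` pays for the number of links: `B^(J - j)` for those inside a cube of side
`2^J`, and `y (M - J)` for the cubes of side `2^J` along the boundary. -/
theorem exists_measureReal_localization (d n : ℕ) (hd : 1 ≤ d) (χ α K κ : ℝ)
    (hχ_lower : (d : ℝ) - 2 < χ) (hχ_upper : χ < d) (hα : 0 < α) (hK : 0 < K) (hκ : 0 < κ)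
    {y : ℕ → ℝ} (hy : ∀ k, 1 ≤ y k) {c₀ : ℝ} (hc₀ : 0 < c₀)
    (hsum : Summable fun k : ℕ => ((2 : ℝ) ^ (d - 1)) ^ k * Real.exp (-(c₀ / 2 * y k))) :
    ∃ C > 0, ∃ c > 0,
      ∀ (Ω : Type u) [MeasurableSpace Ω] (P : Measure Ω) [IsProbabilityMeasure P]
        [MeasurableSpace (Environment d n)] (η : Ω → Environment d n) (lam : ℝ) (L : ℕ) (F : ℝ)
        (φ : Ω → Surface d n), IsConcentratedGround P η lam L χ F α K κ φ →
        ∀ ℓ : (Fin d → ℤ) → ℝ, (∀ v ∈ box d L, ∀ r : ℕ, boundaryDist L v = r →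
          y (Nat.log 2 (L + 1) - Nat.log 2 r) ≤ ℓ v) → ∀ t : ℝ, 0 < t →
        P.real {ω | ∃ v ∈ box d L, t * √F * ℓ v ^ (1 / (2 * α)) *
            boundaryDist L v ^ ((χ - ((d : ℝ) - 2)) / 2) < ‖φ ω v‖} ≤
          C * Real.exp (-c * t ^ (2 * α)) := by
  classical
  obtain ⟨C₁, hC₁, c₁, hc₁, A, hA, hinc'⟩ :=
    exists_hasTail_increment.{u} d n hd χ α K κ hχ_lower hχ_upper hα hK hκ
  set ξ := (χ - ((d : ℝ) - 2)) / 2 with hξ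
  have hξ0 : 0 < ξ := by rw [hξ]; linarith
  have hξ1 : ξ < 1 := by rw [hξ]; linarith
  have hβ : 0 < 2 * α := by linarith
  -- half of the Hölder exponent is spent on the union over the grid points
  set b : ℝ := (2 : ℝ) ^ (ξ / 2) with hb
  have hb1 : 1 < b := Real.one_lt_rpow one_lt_two (by linarith)
  have hb0 : 0 < b := by linarith
  have hbb : (2 : ℝ) ^ ξ = b * b := by rw [hb, ← Real.rpow_add two_pos, add_halves]
  set B : ℝ := b ^ (2 * α) with hB
  have hB1 : 1 < B := Real.one_lt_rpow hb1 hβ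
  have hBb : ∀ i : ℕ, (B ^ i) ^ (1 / (2 * α)) = b ^ i := fun i => by
    rw [← Real.rpow_pow_comm (by positivity), hB, ← Real.rpow_mul hb0.le,
      mul_one_div_cancel hβ.ne', Real.rpow_one]
  set S := d * 6 ^ d * ((∑' k : ℕ, ((2 : ℝ) ^ (d - 1)) ^ k * Real.exp (-(c₀ / 2 * y k))) *
        ∑' i : ℕ, ((2 : ℝ) ^ d) ^ i * Real.exp (-(c₀ / 2 * B ^ i))) with hS
  have hS0 : 0 ≤ S := mul_nonneg (by positivity)
    (mul_nonneg (tsum_nonneg fun _ => by positivity) (tsum_nonneg fun _ => by positivity))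
  have hgeo : Summable fun i : ℕ => (b⁻¹) ^ i :=
    summable_geometric_of_lt_one (by positivity) (inv_lt_one_of_one_lt₀ hb1)
  set R : ℝ := ∑' i : ℕ, (b⁻¹) ^ i with hR
  have hR1 : 1 ≤ R := by
    have := hgeo.sum_le_tsum {0} (fun i _ => by positivity)
    rwa [Finset.sum_singleton, pow_zero] at this
  have hG0 : 0 < 4 * A * R := by positivity
  refine ⟨C₁ * S + Real.exp c₀, by positivity, c₁ / 2 * ((4 * A * R) ^ (2 * α))⁻¹, by positivity,
    ?_⟩
  intro Ω _ P _ _ η lam L F φ h ℓ hℓ t ht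
  have hinc := hinc' Ω P η lam L F φ h
  set M := Nat.log 2 (L + 1) with hM
  have hLM : L + 1 < 2 ^ (M + 1) := Nat.lt_pow_succ_log_self one_lt_two _
  let s : Finset (Σ _ : ℕ, Σ _ : ℕ, (Fin d → ℤ)) := (Finset.range (M + 1)).sigma fun J =>
    (Finset.range (J + 1)).sigma fun j => layerGrid d L J j
  let Z : (Σ _ : ℕ, Σ _ : ℕ, (Fin d → ℤ)) → Ω → ℝ := fun p ω =>
    if p.2.1 < p.1 then ‖φ ω p.2.2 - φ ω (gridFloor (p.2.1 + 1) p.2.2)‖ else ‖φ ω p.2.2‖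
  let a : (Σ _ : ℕ, Σ _ : ℕ, (Fin d → ℤ)) → ℝ := fun p => 4 * A * (√F * (b * b) ^ p.2.1)
  let w : (Σ _ : ℕ, Σ _ : ℕ, (Fin d → ℤ)) → ℝ := fun p => y (M - p.1) * B ^ (p.1 - p.2.1)
  have hpow : ∀ e j : ℕ, e ≤ 2 → A * (√F * ((2 ^ (j + e) : ℕ) : ℝ) ^ ξ) ≤
      4 * A * (√F * (b * b) ^ j) := fun e j he => by
    have h1 : ((2 ^ (j + e) : ℕ) : ℝ) ^ ξ = (b * b) ^ j * (b * b) ^ e := by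
      push_cast
      rw [← pow_add, ← hbb, Real.rpow_pow_comm two_pos.le]
    have h2 : b * b ≤ 2 := by
      rw [← hbb]
      calc (2 : ℝ) ^ ξ ≤ (2 : ℝ) ^ (1 : ℝ) :=
            Real.rpow_le_rpow_of_exponent_le one_le_two hξ1.le
        _ = 2 := Real.rpow_one _
    have h3 : (b * b) ^ e ≤ 4 := by
      calc (b * b) ^ e ≤ 2 ^ e := by gcongr
        _ ≤ 2 ^ 2 := pow_le_pow_right₀ one_le_two he
        _ = 4 := by norm_num
    calc A * (√F * ((2 ^ (j + e) : ℕ) : ℝ) ^ ξ) = A * (√F * ((b * b) ^ j * (b * b) ^ e)) := by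
          rw [h1]
      _ ≤ A * (√F * ((b * b) ^ j * 4)) := by gcongr
      _ = _ := by ring
  have hZ : ∀ p ∈ s, HasTail P (2 * α) C₁ c₁ (Z p) (a p) := by
    rintro ⟨J, j, x⟩ hp
    obtain ⟨hJ, hp⟩ := Finset.mem_sigma.1 hp
    obtain ⟨hj, hx⟩ := Finset.mem_sigma.1 hp
    simp only [Finset.mem_range] at hJ hj hx
    by_cases hjJ : j < J
    · have hZeq : Z ⟨J, j, x⟩ = fun ω => ‖φ ω x - φ ω (gridFloor (j + 1) x)‖ := by
        funext ω; simp only [Z, hjJ, if_true]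
      rw [hZeq]
      exact (hinc x (gridFloor (j + 1) x) (2 ^ (j + 1)) Nat.one_le_two_pow
        (fun i => by exact_mod_cast abs_sub_gridFloor_le (j + 1) x i)).mono (hpow 1 j (by omega))
        le_rfl (Filter.Eventually.of_forall fun _ => le_rfl)
    · have hZeq : Z ⟨J, j, x⟩ = fun ω => ‖φ ω x‖ := by
        funext ω; simp only [Z, hjJ, if_false]
      obtain rfl : j = J := by omega
      rw [hZeq]
      obtain ⟨v, hv, rfl⟩ := Finset.mem_image.1 hx
      obtain ⟨hvL, i, hi⟩ := Finset.mem_filter.1 hv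
      obtain ⟨z, hz, hvz⟩ := exists_notMem_box_of_le (r := 2 ^ (j + 1))
        ⟨i, by push_cast; exact hi.le⟩ hvL
      refine (hasTail_norm_of_layer h hinc hz (u := gridFloor j v) (m := 2 ^ (j + 2))
        Nat.one_le_two_pow fun l => ?_).mono (hpow 2 j le_rfl) le_rfl
        (Filter.Eventually.of_forall fun _ => le_rfl)
      have h1 := abs_sub_gridFloor_le j v l
      have h2 := hvz l
      push_cast at h2 ⊢
      have h3 : (0 : ℤ) < 2 ^ j := by positivity
      rw [pow_succ] at h2
      rw [pow_add]
      rw [abs_le] at h1 h2 ⊢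
      constructor <;> linarith
  have hcard : ∑ p ∈ s, Real.exp (-(c₀ * w p)) ≤ S := by
    simp only [s, Finset.sum_sigma, w]
    exact sum_card_layerGrid_le hd hLM hy hB1 hc₀ hsum
  set t' := t / (4 * A * R) with ht'
  have ht'0 : 0 < t' := by positivity
  have hunion := measureReal_exists_lt_le (P := P) s (Z := Z) (a := a) (w := w) hβ hc₁ hC₁.le
    (fun p _ => one_le_mul_of_one_le_of_one_le (hy _) (one_le_pow₀ hB1.le)) hZ hcard ht'0
  have hexp : -(c₁ / 2) * t' ^ (2 * α) =
      -(c₁ / 2 * ((4 * A * R) ^ (2 * α))⁻¹) * t ^ (2 * α) := by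
    rw [ht', Real.div_rpow ht.le hG0.le]; ring
  rw [hexp] at hunion
  refine (measureReal_mono ?_ (measure_ne_top _ _)).trans hunion
  rintro ω ⟨v, hv, hlt⟩
  change ∃ p ∈ s, t' * w p ^ (1 / (2 * α)) * a p < Z p ω
  by_contra hcon
  push Not at hcon
  refine absurd hlt (not_lt.2 ?_)
  obtain ⟨r, hr, hr1, hrL, i, hi⟩ := exists_boundaryDist_eq hd hv
  set J := Nat.log 2 r with hJ
  have hJr : 2 ^ J ≤ r := Nat.pow_log_le_self 2 (by omega)
  have hrJ : r < 2 ^ (J + 1) := Nat.lt_pow_succ_log_self one_lt_two r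
  have hJM : J ≤ M := Nat.log_mono_right hrL
  have hyv : y (M - J) ≤ ℓ v := hℓ v hv r hr
  have hy0 : 0 < y (M - J) := by linarith [hy (M - J)]
  have hvlayer : v ∈ boundaryLayer d L J := by
    refine Finset.mem_filter.2 ⟨hv, i, ?_⟩
    have : (r : ℤ) < 2 ^ (J + 1) := by exact_mod_cast hrJ
    omega
  have hmem : ∀ j ≤ J, (⟨J, j, gridFloor j v⟩ : Σ _ : ℕ, Σ _ : ℕ, (Fin d → ℤ)) ∈ s := fun j hj =>
    Finset.mem_sigma.2 ⟨Finset.mem_range.2 (by change J < M + 1; omega),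
      Finset.mem_sigma.2 ⟨Finset.mem_range.2 (by change j < J + 1; omega),
        Finset.mem_image_of_mem _ hvlayer⟩⟩
  set T := t' * y (M - J) ^ (1 / (2 * α)) * (4 * A * √F) * (b * b) ^ J with hT
  have hT0 : 0 ≤ T := by positivity
  have hlink : ∀ j ≤ J, Z ⟨J, j, gridFloor j v⟩ ω ≤ T * (b⁻¹) ^ (J - j) := fun j hj => by
    refine (hcon _ (hmem j hj)).trans (le_of_eq ?_)
    change t' * (y (M - J) * B ^ (J - j)) ^ (1 / (2 * α)) * (4 * A * (√F * (b * b) ^ j)) = _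
    rw [Real.mul_rpow hy0.le (by positivity), hBb]
    have h1 : b ^ J = b ^ j * b ^ (J - j) := by rw [← pow_add]; congr 1; omega
    rw [hT, mul_pow, mul_pow, h1, inv_pow]
    field_simp
  -- telescoping along the chain
  have htel : ∀ j ≤ J, ‖φ ω v‖ ≤ ∑ k ∈ Finset.range j, T * (b⁻¹) ^ (J - k) +
      ‖φ ω (gridFloor j v)‖ := by
    intro j
    induction j with
    | zero => intro _; simp [gridFloor_zero]
    | succ j ih =>
      intro hj
      have h1 := hlink j (by omega)
      have hjJ : j < J := by omega
      simp only [Z, hjJ, if_true, gridFloor_succ_gridFloor] at h1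
      rw [Finset.sum_range_succ]
      have h2 := ih (by omega)
      have h3 := norm_sub_norm_le (φ ω (gridFloor j v)) (φ ω (gridFloor (j + 1) v))
      linarith
  have hlast := hlink J le_rfl
  simp only [Z, lt_irrefl, if_false] at hlast
  have hsumR : ∑ k ∈ Finset.range (J + 1), (b⁻¹) ^ (J - k) ≤ R := by
    have := Finset.sum_range_reflect (fun i => (b⁻¹) ^ i) (J + 1)
    simp only [Nat.add_sub_cancel] at this
    rw [this]
    exact hgeo.sum_le_tsum _ fun i _ => by positivity
  have hrξ : (b * b) ^ J ≤ boundaryDist L v ^ ξ := by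
    rw [hr, ← hbb, Real.rpow_pow_comm two_pos.le]
    exact Real.rpow_le_rpow (by positivity) (by exact_mod_cast hJr) hξ0.le
  calc ‖φ ω v‖ ≤ ∑ k ∈ Finset.range J, T * (b⁻¹) ^ (J - k) + ‖φ ω (gridFloor J v)‖ := htel J le_rfl
    _ ≤ ∑ k ∈ Finset.range (J + 1), T * (b⁻¹) ^ (J - k) := by
        rw [Finset.sum_range_succ]; linarith
    _ = T * ∑ k ∈ Finset.range (J + 1), (b⁻¹) ^ (J - k) := by rw [Finset.mul_sum]
    _ ≤ T * R := by gcongr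
    _ = t * √F * y (M - J) ^ (1 / (2 * α)) * (b * b) ^ J := by
        rw [hT, ht']; field_simp
    _ ≤ t * √F * ℓ v ^ (1 / (2 * α)) * boundaryDist L v ^ ξ := by
        have : y (M - J) ^ (1 / (2 * α)) ≤ ℓ v ^ (1 / (2 * α)) :=
          Real.rpow_le_rpow hy0.le hyv (by positivity)
        have hℓ0 : 0 ≤ ℓ v := hy0.le.trans hyv
        gcongr

/-! ### Logarithmic factors -/

lemma two_pow_log_sub_log_le {L r : ℕ} (hr1 : 1 ≤ r) (hr : r ≤ L + 1) :
    (2 : ℝ) ^ (Nat.log 2 (L + 1) - Nat.log 2 r) ≤ 2 * ((L : ℝ) + 1) / r := by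
  have h1 : 2 ^ Nat.log 2 (L + 1) ≤ L + 1 := Nat.pow_log_le_self 2 (by omega)
  have h2 : r < 2 ^ (Nat.log 2 r + 1) := Nat.lt_pow_succ_log_self one_lt_two r
  have h3 : Nat.log 2 r ≤ Nat.log 2 (L + 1) := Nat.log_mono_right hr
  have hr0 : (0 : ℝ) < r := by exact_mod_cast hr1
  rw [le_div_iff₀ hr0]
  have h4 : 2 ^ (Nat.log 2 (L + 1) - Nat.log 2 r) * r ≤ 2 * (L + 1) := by
    calc 2 ^ (Nat.log 2 (L + 1) - Nat.log 2 r) * r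
        ≤ 2 ^ (Nat.log 2 (L + 1) - Nat.log 2 r) * 2 ^ (Nat.log 2 r + 1) := by gcongr
      _ = 2 * 2 ^ Nat.log 2 (L + 1) := by
          rw [← pow_add, ← pow_succ']; congr 1; omega
      _ ≤ _ := by gcongr
  exact_mod_cast h4

lemma one_add_le_mul_log {L r : ℕ} (hr1 : 1 ≤ r) (hr : r ≤ L + 1) :
    1 + ((Nat.log 2 (L + 1) - Nat.log 2 r : ℕ) : ℝ) ≤
      4 * Real.log (2 * ((L : ℝ) + 1) / r) := by
  set k := Nat.log 2 (L + 1) - Nat.log 2 r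
  have hr0 : (0 : ℝ) < r := by exact_mod_cast hr1
  have h2 : (2 : ℝ) ≤ 2 * ((L : ℝ) + 1) / r := by
    rw [le_div_iff₀ hr0]
    have : (r : ℝ) ≤ L + 1 := by exact_mod_cast hr
    linarith
  have h3 := Real.log_le_log two_pos h2
  have h4 := Real.log_le_log (by positivity) (two_pow_log_sub_log_le hr1 hr)
  rw [Real.log_pow] at h4
  have h5 : 1 / 2 ≤ Real.log 2 := by linarith [Real.log_two_gt_d9]
  have h6 : (k : ℝ) * (1 / 2) ≤ k * Real.log 2 := by gcongr
  linarith

lemma one_lt_log_three : 1 < Real.log 3 := by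
  rw [Real.lt_log_iff_exp_lt (by norm_num)]
  linarith [Real.exp_one_lt_d9]

lemma log_three_le {L r : ℕ} (hr1 : 1 ≤ r) (hr : r ≤ L + 1) :
    Real.log 3 ≤ Real.log (3 * ((L : ℝ) + 1) / r) := by
  have hr0 : (0 : ℝ) < r := by exact_mod_cast hr1
  refine Real.log_le_log (by norm_num) ?_
  rw [le_div_iff₀ hr0]
  have : (r : ℝ) ≤ L + 1 := by exact_mod_cast hr
  linarith

lemma one_add_log_le_mul_log_log {L r : ℕ} (hr1 : 1 ≤ r) (hr : r ≤ L + 1) :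
    1 + Real.log (1 + ((Nat.log 2 (L + 1) - Nat.log 2 r : ℕ) : ℝ)) ≤
      (3 / Real.log (Real.log 3) + 1) * Real.log (Real.log (3 * ((L : ℝ) + 1) / r)) := by
  have hr0 : (0 : ℝ) < r := by exact_mod_cast hr1
  have h3 := one_lt_log_three
  have hz3 := log_three_le hr1 hr
  have h23 : Real.log (2 * ((L : ℝ) + 1) / r) ≤ Real.log (3 * ((L : ℝ) + 1) / r) := by
    refine Real.log_le_log (by positivity) ?_
    gcongr
    norm_num
  set z := Real.log (3 * ((L : ℝ) + 1) / r)
  have hε : 0 < Real.log (Real.log 3) := Real.log_pos h3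
  have hεz : Real.log (Real.log 3) ≤ Real.log z := Real.log_le_log (by linarith) hz3
  have h1 : 1 + ((Nat.log 2 (L + 1) - Nat.log 2 r : ℕ) : ℝ) ≤ 4 * z := by
    linarith [one_add_le_mul_log hr1 hr]
  have h2 : Real.log (1 + ((Nat.log 2 (L + 1) - Nat.log 2 r : ℕ) : ℝ)) ≤
      Real.log 4 + Real.log z := by
    rw [← Real.log_mul (by norm_num) (by linarith)]
    exact Real.log_le_log (by positivity) h1
  have h4 : Real.log 4 ≤ 2 := by
    have : (4 : ℝ) = 2 ^ 2 := by norm_num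
    rw [this, Real.log_pow]
    push_cast
    linarith [Real.log_two_lt_d9]
  have h5 : 3 ≤ 3 / Real.log (Real.log 3) * Real.log z := by
    rw [div_mul_eq_mul_div, le_div_iff₀ hε]
    linarith
  linarith

/-- Lowering a logarithm by a constant costs at most a factor, away from the zero of the lowered
logarithm. -/
lemma div_mul_le_sub {z₀ z b : ℝ} (hb : 0 ≤ b) (h0 : b < z₀) (hz : z₀ ≤ z) :
    (z₀ - b) / z₀ * z ≤ z - b := by
  have hz0 : 0 < z₀ := by linarith
  rw [div_mul_eq_mul_div, div_le_iff₀ hz0]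
  nlinarith

lemma exists_log_le_mul_log : ∃ D > 0, ∀ L r : ℕ, 2 ≤ L → 1 ≤ r → r ≤ L + 1 →
    Real.log (2 * ((L : ℝ) + 1) / r) ≤ D * Real.log (2 * (L : ℝ) / r) := by
  have hlt : Real.log (3 / 2) < Real.log 2 := Real.log_lt_log (by norm_num) (by norm_num)
  have hb : 0 ≤ Real.log (3 / 2) := Real.log_nonneg (by norm_num)
  set q := (Real.log 2 - Real.log (3 / 2)) / Real.log 2 with hq
  have hq0 : 0 < q := div_pos (by linarith) (by linarith)
  refine ⟨q⁻¹, by positivity, fun L r hL hr1 hr => ?_⟩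
  have hr0 : (0 : ℝ) < r := by exact_mod_cast hr1
  have hL0 : (2 : ℝ) ≤ L := by exact_mod_cast hL
  have hrL : (r : ℝ) ≤ L + 1 := by exact_mod_cast hr
  have h2 : Real.log 2 ≤ Real.log (2 * ((L : ℝ) + 1) / r) := by
    refine Real.log_le_log two_pos ?_
    rw [le_div_iff₀ hr0]; linarith
  have h3 := div_mul_le_sub hb hlt h2
  have h4 : Real.log (2 * ((L : ℝ) + 1) / r) - Real.log (3 / 2) ≤ Real.log (2 * (L : ℝ) / r) := by
    rw [← Real.log_div (by positivity) (by norm_num)]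
    refine Real.log_le_log (by positivity) ?_
    rw [div_le_iff₀ (by norm_num), div_mul_eq_mul_div]
    exact div_le_div_of_nonneg_right (by linarith) hr0.le
  rw [le_inv_mul_iff₀ hq0]
  exact h3.trans h4

lemma exists_log_log_le_mul_log_log : ∃ D > 0, ∀ L r : ℕ, 10 ≤ L → 1 ≤ r → r ≤ L + 1 →
    Real.log (Real.log (3 * ((L : ℝ) + 1) / r)) ≤
      D * Real.log (Real.log (3 * (L : ℝ) / r)) := by
  have h3 := one_lt_log_three
  -- this is where `L ≥ 10` enters: `30 / 11` exceeds `e`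
  have he : 1 < Real.log (30 / 11) := by
    rw [Real.lt_log_iff_exp_lt (by norm_num)]
    refine Real.exp_one_lt_d9.trans (by norm_num)
  have hb0 : 0 ≤ Real.log (11 / 10) := Real.log_nonneg (by norm_num)
  have hsub : Real.log 3 - Real.log (11 / 10) = Real.log (30 / 11) := by
    rw [← Real.log_div (by norm_num) (by norm_num)]; norm_num
  set p := Real.log (30 / 11) / Real.log 3 with hp
  have hp0 : 0 < p := by positivity
  have hp1 : p ≤ 1 := by rw [hp, div_le_one (by linarith)]; linarith
  -- passing to the iterated logarithm turns the factor `p` into the summand `log p`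
  have hlp : Real.log p = Real.log (Real.log (30 / 11)) - Real.log (Real.log 3) :=
    Real.log_div (by linarith) (by linarith)
  have hε : 0 < Real.log (Real.log (30 / 11)) := Real.log_pos he
  have hZ0 : 0 < Real.log (Real.log 3) := Real.log_pos h3
  set q := (Real.log (Real.log 3) - -Real.log p) / Real.log (Real.log 3) with hq
  have hq0 : 0 < q := div_pos (by rw [hlp]; linarith) hZ0
  refine ⟨q⁻¹, by positivity, fun L r hL hr1 hr => ?_⟩
  have hr0 : (0 : ℝ) < r := by exact_mod_cast hr1
  have hL0 : (10 : ℝ) ≤ L := by exact_mod_cast hL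
  have hz := log_three_le hr1 hr
  have h5 := div_mul_le_sub hb0 (by linarith) hz
  rw [hsub, ← hp] at h5
  have h6 : Real.log (3 * ((L : ℝ) + 1) / r) - Real.log (11 / 10) ≤
      Real.log (3 * (L : ℝ) / r) := by
    rw [← Real.log_div (by positivity) (by norm_num)]
    refine Real.log_le_log (by positivity) ?_
    rw [div_le_iff₀ (by norm_num), div_mul_eq_mul_div]
    exact div_le_div_of_nonneg_right (by linarith) hr0.le
  set z := Real.log (3 * ((L : ℝ) + 1) / r)
  have h7 := div_mul_le_sub (b := -Real.log p) (by linarith [Real.log_nonpos hp0.le hp1])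
    (by rw [hlp]; linarith) (Real.log_le_log (by linarith) hz)
  rw [← hq, sub_neg_eq_add, add_comm, ← Real.log_mul hp0.ne' (by linarith)] at h7
  rw [le_inv_mul_iff₀ hq0]
  exact h7.trans (Real.log_le_log (mul_pos hp0 (by linarith)) (h5.trans h6))

/-- Complementary form of a tail bound, with a factor `D` between two gauges absorbed into `t`. -/
lemma one_sub_le_measureReal_forall {d n L : ℕ} {Ω : Type u} [MeasurableSpace Ω] {P : Measure Ω}
    [IsProbabilityMeasure P] {φ : Ω → Surface d n} {β C c C' c' D F ξ : ℝ} (hβ : 0 < β)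
    (hD : 0 < D) {ℓ ℓ' : (Fin d → ℤ) → ℝ} (hC : 0 ≤ C) (hCC : C ≤ C') (hcc : c' ≤ c / D)
    (h : ∀ t : ℝ, 0 < t → P.real {ω | ∃ v ∈ box d L, t * √F * ℓ v ^ (1 / β) *
      boundaryDist L v ^ ξ < ‖φ ω v‖} ≤ C * Real.exp (-c * t ^ β))
    (hℓ0 : ∀ v ∈ box d L, 0 ≤ ℓ v) (hℓ : ∀ v ∈ box d L, ℓ v ≤ D * ℓ' v) {t : ℝ} (ht : 0 < t) :
    1 - C' * Real.exp (-c' * t ^ β) ≤ P.real {ω | ∀ v ∈ box d L, ‖φ ω v‖ ≤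
      t * √F * ℓ' v ^ (1 / β) * boundaryDist L v ^ ξ} := by
  set G := {ω | ∀ v ∈ box d L, ‖φ ω v‖ ≤ t * √F * ℓ' v ^ (1 / β) * boundaryDist L v ^ ξ} with hG
  have hDβ : 0 < D ^ (1 / β) := by positivity
  set t' := t / D ^ (1 / β) with ht'
  have ht'0 : 0 < t' := by positivity
  set E := {ω | ∃ v ∈ box d L, t' * √F * ℓ v ^ (1 / β) *
      boundaryDist L v ^ ξ < ‖φ ω v‖} with hE
  have hbad : Set.univ ⊆ G ∪ E := by
    intro ω _
    by_cases hω : ω ∈ E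
    · exact Or.inr hω
    · refine Or.inl fun v hv => ?_
      have h1 : ‖φ ω v‖ ≤ t' * √F * ℓ v ^ (1 / β) * boundaryDist L v ^ ξ := by
        by_contra hc
        exact hω ⟨v, hv, not_le.1 hc⟩
      have hℓ'0 : 0 ≤ ℓ' v := nonneg_of_mul_nonneg_right ((hℓ0 v hv).trans (hℓ v hv)) hD
      have h2 : ℓ v ^ (1 / β) ≤ D ^ (1 / β) * ℓ' v ^ (1 / β) := by
        rw [← Real.mul_rpow hD.le hℓ'0]
        exact Real.rpow_le_rpow (hℓ0 v hv) (hℓ v hv) (by positivity)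
      have hb : 0 ≤ boundaryDist L v ^ ξ := Real.rpow_nonneg Metric.infDist_nonneg _
      calc ‖φ ω v‖ ≤ t' * √F * ℓ v ^ (1 / β) * boundaryDist L v ^ ξ := h1
        _ ≤ t' * √F * (D ^ (1 / β) * ℓ' v ^ (1 / β)) * boundaryDist L v ^ ξ := by gcongr
        _ = _ := by rw [ht']; field_simp
  have h1 : 1 ≤ P.real G + P.real E := by
    calc (1 : ℝ) = P.real Set.univ := by simp
      _ ≤ P.real (G ∪ E) := measureReal_mono hbad
      _ ≤ _ := measureReal_union_le _ _
  have h2 := h t' ht'0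
  have h3 : t' ^ β = t ^ β / D := by
    rw [ht', Real.div_rpow ht.le hDβ.le, ← Real.rpow_mul hD.le, one_div_mul_cancel hβ.ne',
      Real.rpow_one]
  have h4 : C * Real.exp (-c * t' ^ β) ≤ C' * Real.exp (-c' * t ^ β) := by
    rw [h3]
    have hC'0 : 0 ≤ C' := hC.trans hCC
    have : c' * t ^ β ≤ c / D * t ^ β := by gcongr
    have h5 : -c * (t ^ β / D) ≤ -c' * t ^ β := by
      have : c * (t ^ β / D) = c / D * t ^ β := by ring
      linarith
    gcongr
  linarith

lemma summable_pow_mul_exp_linear {d : ℕ} (hd : 1 ≤ d) :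
    Summable fun k : ℕ => ((2 : ℝ) ^ (d - 1)) ^ k * Real.exp (-(2 * d / 2 * (1 + (k : ℝ)))) := by
  have he : (2 : ℝ) < Real.exp 1 := by linarith [Real.exp_one_gt_d9]
  have h : ∀ k : ℕ, ((2 : ℝ) ^ (d - 1)) ^ k * Real.exp (-(2 * d / 2 * (1 + (k : ℝ)))) =
      Real.exp (-d) * ((2 : ℝ) ^ (d - 1) * Real.exp (-d)) ^ k := fun k => by
    rw [mul_pow, mul_left_comm, ← Real.exp_nat_mul, ← Real.exp_add]
    congr 2
    ring
  simp only [h]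
  refine (summable_geometric_of_lt_one (by positivity) ?_).mul_left _
  rw [Real.exp_neg, ← div_eq_mul_inv, div_lt_one (Real.exp_pos _)]
  calc (2 : ℝ) ^ (d - 1) ≤ 2 ^ d := pow_le_pow_right₀ one_le_two (Nat.sub_le _ _)
    _ < Real.exp 1 ^ d := pow_lt_pow_left₀ he two_pos.le (by omega)
    _ = Real.exp d := by rw [← Real.exp_nat_mul, mul_one]

lemma summable_pow_mul_exp_log :
    Summable fun k : ℕ => ((2 : ℝ) ^ (1 - 1)) ^ k *
      Real.exp (-(4 / 2 * (1 + Real.log (1 + (k : ℝ))))) := by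
  have h : ∀ k : ℕ, ((2 : ℝ) ^ (1 - 1)) ^ k * Real.exp (-(4 / 2 * (1 + Real.log (1 + (k : ℝ))))) =
      Real.exp (-2) * (((k + 1 : ℕ) : ℝ) ^ 2)⁻¹ := fun k => by
    have hk : (0 : ℝ) < 1 + k := by positivity
    have e1 : -(4 / 2 * (1 + Real.log (1 + (k : ℝ)))) = -2 + -(Real.log ((1 + (k : ℝ)) ^ 2)) := by
      rw [Real.log_pow]; push_cast; ring
    rw [Nat.sub_self, pow_zero, one_pow, one_mul, e1, Real.exp_add, Real.exp_neg (Real.log _),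
      Real.exp_log (by positivity)]
    push_cast
    rw [add_comm (k : ℝ) 1]
  simp only [h]
  refine Summable.mul_left _ ?_
  exact (summable_nat_add_iff (f := fun k : ℕ => ((k : ℝ) ^ 2)⁻¹) 1).2
    (Real.summable_nat_pow_inv.2 one_lt_two)

/-- The mean of the height at a site is bounded by the Hölder scale of its distance to the
boundary. -/
lemma exists_lintegral_le (d n : ℕ) (hd : 1 ≤ d) (χ α K κ : ℝ)
    (hχ_lower : (d : ℝ) - 2 < χ) (hχ_upper : χ < d) (hα : 0 < α) (hK : 0 < K) (hκ : 0 < κ) :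
    ∃ C > 0,
      ∀ (Ω : Type u) [MeasurableSpace Ω] (P : Measure Ω) [IsProbabilityMeasure P]
        [MeasurableSpace (Environment d n)] (η : Ω → Environment d n) (lam : ℝ) (L : ℕ) (F : ℝ)
        (φ : Ω → Surface d n), IsConcentratedGround P η lam L χ F α K κ φ →
        (∀ v, AEMeasurable (fun ω => φ ω v) P) → ∀ v ∈ box d L,
          ∫⁻ ω, ‖φ ω v‖ₑ ∂P ≤
            ENNReal.ofReal (C * √F * boundaryDist L v ^ ((χ - ((d : ℝ) - 2)) / 2)) := by
  obtain ⟨C, hC, c, hc, A, hA, hinc⟩ :=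
    exists_hasTail_increment.{u} d n hd χ α K κ hχ_lower hχ_upper hα hK hκ
  set I := ∫ t in Set.Ioi (0 : ℝ), C * Real.exp (-c * t ^ (2 * α)) with hI
  have hI0 : 0 ≤ I := setIntegral_nonneg measurableSet_Ioi fun t _ => by positivity
  refine ⟨A * I + 1, by positivity, ?_⟩
  intro Ω _ P _ _ η lam L F φ h hmeas v hv
  obtain ⟨r, hr, hr1, -, hi⟩ := exists_boundaryDist_eq hd hv
  obtain ⟨w, hw, hvw⟩ := exists_notMem_box_of_le hi hv
  have htail := hasTail_norm_of_layer h (hinc Ω P η lam L F φ h) hw hr1 hvw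
  have hr0 : (0 : ℝ) < r := by exact_mod_cast hr1
  have hF := h.scale_pos
  have hle := htail.lintegral_le (by linarith) hc (by positivity) (fun ω => norm_nonneg _)
    (hmeas v).norm
  simp only [ofReal_norm] at hle
  refine hle.trans (ENNReal.ofReal_le_ofReal ?_)
  rw [hr, ← hI]
  have : 0 ≤ √F * (r : ℝ) ^ ((χ - ((d : ℝ) - 2)) / 2) := by positivity
  nlinarith

theorem theorem1p6 (d n : ℕ) (hd : 1 ≤ d) (hn : 1 ≤ n) (χ α K κ : ℝ)
    (hχ_lower : (d : ℝ) - 2 < χ) (hχ_upper : χ < d) (hα : 0 < α) (hK : 0 < K) (hκ : 0 < κ) :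
    ∃ C > 0, ∃ c > 0,
      ∀ (Ω : Type u) [MeasurableSpace Ω] (P : Measure Ω) [IsProbabilityMeasure P]
        [MeasurableSpace (Environment d n)] (η : Ω → Environment d n) (lam : ℝ) (L : ℕ) (F : ℝ),
        0 < lam → 1 ≤ L → 0 < F →
        IsDisorder P η → ExiMin P η → Stat P η → ChiConc P η lam L χ F α K κ →
        -- `φ` is any random ground configuration in the cube with zero boundary values
        ∀ φ : Ω → Surface d n, (∀ v, AEMeasurable (fun ω => φ ω v) P) →
          (∀ᵐ ω ∂P, IsGroundConfig (η ω) lam (box d L) 0 (φ ω)) →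
          (∀ v ∈ box d L, ∫⁻ ω, ‖φ ω v‖ₑ ∂P ≤
              ENNReal.ofReal (C * √F * boundaryDist L v ^ ((χ - ((d : ℝ) - 2)) / 2))) ∧
          (d = 1 → ∀ t : ℝ, 0 < t →
            1 - C * Real.exp (-c * t ^ (2 * α)) ≤ P.real {ω | ∀ v ∈ box d L, ‖φ ω v‖ ≤
              t * √F * Real.log (Real.log (3 * ((L : ℝ) + 1) / boundaryDist L v)) ^ (1 / (2 * α)) *
                boundaryDist L v ^ ((χ - ((d : ℝ) - 2)) / 2)} ∧
            (10 ≤ L →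
              1 - C * Real.exp (-c * t ^ (2 * α)) ≤ P.real {ω | ∀ v ∈ box d L, ‖φ ω v‖ ≤
                t * √F * Real.log (Real.log (3 * (L : ℝ) / boundaryDist L v)) ^ (1 / (2 * α)) *
                  boundaryDist L v ^ ((χ - ((d : ℝ) - 2)) / 2)})) ∧
          (2 ≤ d → ∀ t : ℝ, 0 < t →
            1 - C * Real.exp (-c * t ^ (2 * α)) ≤ P.real {ω | ∀ v ∈ box d L, ‖φ ω v‖ ≤
              t * √F * Real.log (2 * ((L : ℝ) + 1) / boundaryDist L v) ^ (1 / (2 * α)) *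
                boundaryDist L v ^ ((χ - ((d : ℝ) - 2)) / 2)} ∧
            (2 ≤ L →
              1 - C * Real.exp (-c * t ^ (2 * α)) ≤ P.real {ω | ∀ v ∈ box d L, ‖φ ω v‖ ≤
                t * √F * Real.log (2 * (L : ℝ) / boundaryDist L v) ^ (1 / (2 * α)) *
                  boundaryDist L v ^ ((χ - ((d : ℝ) - 2)) / 2)})) := by
  obtain ⟨C₁, hC₁, hmean⟩ := exists_lintegral_le.{u} d n hd χ α K κ hχ_lower hχ_upper hα hK hκ
  have hβ : 0 < 2 * α := by linarith
  rcases Nat.lt_or_ge 1 d with hd2 | hd2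
  · obtain ⟨C₂, hC₂, c, hc, hloc⟩ := exists_measureReal_localization.{u} d n hd χ α K κ hχ_lower
      hχ_upper hα hK hκ (y := fun k => 1 + (k : ℝ)) (fun k => by simp) (c₀ := 2 * d)
      (by positivity) (summable_pow_mul_exp_linear hd)
    obtain ⟨D, hD, hlog⟩ := exists_log_le_mul_log
    refine ⟨C₁ + C₂, by positivity, min (c / 4) (c / (4 * D)), by positivity, ?_⟩
    intro Ω _ P _ _ η lam L F hlam hL hF hη hE hStat hconc φ hmeas hφ
    have h : IsConcentratedGround P η lam L χ F α K κ φ := ⟨hlam, hF, hL, hη, hE, hStat, hconc, hφ⟩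
    have hbase : ∀ v ∈ box d L, 1 + ((Nat.log 2 (L + 1) - Nat.log 2 ⌊boundaryDist L v⌋₊ : ℕ) : ℝ) ≤
        4 * Real.log (2 * ((L : ℝ) + 1) / boundaryDist L v) := fun v hv => by
      obtain ⟨r, hr, hr1, hrL, -⟩ := exists_boundaryDist_eq hd hv
      rw [hr, Nat.floor_natCast]
      exact one_add_le_mul_log hr1 hrL
    have hb := hloc Ω P η lam L F φ h
      (fun v => 1 + ((Nat.log 2 (L + 1) - Nat.log 2 ⌊boundaryDist L v⌋₊ : ℕ) : ℝ))
      (fun v _ r hr => by rw [hr, Nat.floor_natCast])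
    refine ⟨fun v hv => (hmean Ω P η lam L F φ h hmeas v hv).trans (ENNReal.ofReal_le_ofReal ?_),
      fun h1 => by omega, fun _ t ht => ⟨?_, fun hL2 => ?_⟩⟩
    · have : 0 ≤ boundaryDist L v ^ ((χ - ((d : ℝ) - 2)) / 2) :=
        Real.rpow_nonneg Metric.infDist_nonneg _
      gcongr
      linarith
    · exact one_sub_le_measureReal_forall hβ (D := 4) (by norm_num) hC₂.le (by linarith)
        (min_le_left _ _) hb (fun v _ => by positivity) hbase ht
    · refine one_sub_le_measureReal_forall hβ (D := 4 * D) (by positivity) hC₂.le (by linarith)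
        (min_le_right _ _) hb (fun v _ => by positivity) (fun v hv => (hbase v hv).trans ?_) ht
      obtain ⟨r, hr, hr1, hrL, -⟩ := exists_boundaryDist_eq hd hv
      rw [hr, mul_assoc]
      have := hlog L r hL2 hr1 hrL
      linarith
  · obtain rfl : d = 1 := by omega
    obtain ⟨C₂, hC₂, c, hc, hloc⟩ := exists_measureReal_localization.{u} 1 n hd χ α K κ hχ_lower
      hχ_upper hα hK hκ (y := fun k => 1 + Real.log (1 + (k : ℝ)))
      (fun k => by simpa using Real.log_nonneg (by simp)) (c₀ := 4)
      (by norm_num) summable_pow_mul_exp_log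
    obtain ⟨D, hD, hlog⟩ := exists_log_log_le_mul_log_log
    set E : ℝ := 3 / Real.log (Real.log 3) + 1 with hEdef
    have hE0 : 0 < E := by
      have := Real.log_pos one_lt_log_three
      positivity
    refine ⟨C₁ + C₂, by positivity, min (c / E) (c / (E * D)), by positivity, ?_⟩
    intro Ω _ P _ _ η lam L F hlam hL hF hη hE hStat hconc φ hmeas hφ
    have h : IsConcentratedGround P η lam L χ F α K κ φ := ⟨hlam, hF, hL, hη, hE, hStat, hconc, hφ⟩
    have hbase : ∀ v ∈ box 1 L,
        1 + Real.log (1 + ((Nat.log 2 (L + 1) - Nat.log 2 ⌊boundaryDist L v⌋₊ : ℕ) : ℝ)) ≤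
        E * Real.log (Real.log (3 * ((L : ℝ) + 1) / boundaryDist L v)) := fun v hv => by
      obtain ⟨r, hr, hr1, hrL, -⟩ := exists_boundaryDist_eq hd hv
      rw [hr, Nat.floor_natCast]
      exact one_add_log_le_mul_log_log hr1 hrL
    have hb := hloc Ω P η lam L F φ h
      (fun v => 1 + Real.log
        (1 + ((Nat.log 2 (L + 1) - Nat.log 2 ⌊boundaryDist L v⌋₊ : ℕ) : ℝ)))
      (fun v _ r hr => by rw [hr, Nat.floor_natCast])
    have hnonneg : ∀ v ∈ box 1 L, 0 ≤ 1 + Real.log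
        (1 + ((Nat.log 2 (L + 1) - Nat.log 2 ⌊boundaryDist L v⌋₊ : ℕ) : ℝ)) := fun v _ =>
      add_nonneg zero_le_one (Real.log_nonneg (by simp))
    refine ⟨fun v hv => (hmean Ω P η lam L F φ h hmeas v hv).trans (ENNReal.ofReal_le_ofReal ?_),
      fun _ t ht => ⟨?_, fun hL10 => ?_⟩, fun h2 => by omega⟩
    · have : 0 ≤ boundaryDist L v ^ ((χ - (((1 : ℕ) : ℝ) - 2)) / 2) :=
        Real.rpow_nonneg Metric.infDist_nonneg _
      gcongr
      linarith
    · exact one_sub_le_measureReal_forall hβ hE0 hC₂.le (by linarith)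
        (min_le_left _ _) hb hnonneg hbase ht
    · refine one_sub_le_measureReal_forall hβ (D := E * D) (by positivity) hC₂.le (by linarith)
        (min_le_right _ _) hb hnonneg (fun v hv => (hbase v hv).trans ?_) ht
      obtain ⟨r, hr, hr1, hrL, -⟩ := exists_boundaryDist_eq hd hv
      rw [hr, mul_assoc]
      have := hlog L r hL10 hr1 hrL
      gcongr
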